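/- **Setting.** Subsets $\mathcal M\subseteq\mathcal P(\omega)$ are identified with $\omega$-models of the language of second order arithmetic (number quantifiers range over $\omega$, set quantifiers over $\mathcal M$); a real $z\in\omega^\omega$ belongs to $\mathcal M$ if its graph $\{\langle n,z(n)\rangle : n\in\omega\}$ does, and similarly for strategies $\sigma:\omega^{<\omega}\to\omega$, under the usual recursive coding of pairs and finite sequences. $\mathcal M$ is a *$\beta$-model* if every $\Sigma^1_1$ formula with parameters from $\mathcal M$ holds in $\mathcal M$ if and only if it is true. $\mathcal M$ satisfies *$\boldsymbol\Pi^1_2$ monotone induction* ($\boldsymbol\Pi^1_2\text{-}\mathsf{MI}$) if, for every operator $\Phi(X)=\{n : \mathcal M\models\varphi(n,X)\}$ given by a $\Pi^1_2$ formula $\varphi$ with parameters from $\mathcal M$ such that $X\subseteq Y$ implies $\Phi(X)\subseteq\Phi(Y)$ for all $X,Y\in\mathcal M$, there exists in $\mathcal M$ the prewellorder $\prec_\Phi$ (together with its field $\Phi^\infty$) of the iteration $\Phi^\xi=\Phi(\Phi^{<\xi})\cup\Phi^{<\xi}$, $\Phi^{<\xi}=\bigcup_{\zeta<\xi}\Phi^\zeta$.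 Here $\Phi^\infty=\bigcup_\xi\Phi^\xi$ is the least fixed point, and, for $m,n\in\Phi^\infty$, $m\prec_\Phi n$ iff the least $\xi$ with $m\in\Phi^\xi$ is less than the least $\zeta$ with $n\in\Phi^\zeta$. For $A\subseteq\omega^\omega$, $G(A)$ is the game in which Players I and II alternately choose natural numbers, I moving first, producing $x\in\omega^\omega$; I wins if $x\in A$, and II wins otherwise. A set $A$ is $\Sigma^0_3(z)$ if there is a set $U\subseteq\omega\times\omega\times\omega^{<\omega}$ recursive in $z$ with $x\in A\iff\exists i\,\forall j\,\exists k\;(i,j,x\restriction k)\in U$. **Theorem.** Let $\mathcal M$ be a $\beta$-model of $\boldsymbol\Pi^1_2\text{-}\mathsf{MI}$, let $z\in\omega^\omega$ be a real in $\mathcal M$, and let $A\subseteq\omega^\omega$ be $\Sigma^0_3(z)$. Then either 1. Player I has a winning strategy $\sigma$ in $G(A)$ with $\sigma\in\mathcal M$; or 2. Player II has a winning strategy $\tau$ in $G(A)$ that is $\Delta^1_3(z)$-definable over $\mathcal M$, i.e. the (coded) graph of $\tau$ is defined over $\mathcal M$ both by a $\Sigma^1_3$ formula and by a $\Pi^1_3$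 formula with $z$ as only parameter. (In both cases the strategy is winning in $V$, that is, against all plays, not only those in $\mathcal M$.) -/

import Mathlib

/-! The language of second order arithmetic, its `ω`-models, and infinite games on `ω`. -/

namespace L2

/-- Number terms of second order arithmetic with free number variables indexed by `Fin n`. -/
inductive Term (n : ℕ) : Type
  | var : Fin n → Term n
  | zero : Term n
  | one : Term n
  | add : Term n → Term n → Term n
  | mul : Term n → Term n → Term n

/-- The value of a term in the standard natural numbers. -/
def Term.val {n : ℕ} (v : Fin n → ℕ) : Term n → ℕ
  | .var i => v i
  | .zero => 0
  | .one => 1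
  | .add t u => t.val v + u.val v
  | .mul t u => t.val v * u.val v

/-- `Formula n s`: formulas of second order arithmetic with `n` free number variables and `s` free
set variables. A quantifier binds variable `0` (of its sort) of its body. -/
inductive Formula : ℕ → ℕ → Type
  | eq {n s : ℕ} : Term n → Term n → Formula n s
  | lt {n s : ℕ} : Term n → Term n → Formula n s
  | mem {n s : ℕ} : Term n → Fin s → Formula n s
  | not {n s : ℕ} : Formula n s → Formula n s
  | and {n s : ℕ} : Formula n s → Formula n s → Formula n s
  | or {n s : ℕ} : Formula n s → Formula n s → Formula n s
  | allNum {n s : ℕ} : Formula (n + 1) s → Formula n s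
  | exNum {n s : ℕ} : Formula (n + 1) s → Formula n s
  | allSet {n s : ℕ} : Formula n (s + 1) → Formula n s
  | exSet {n s : ℕ} : Formula n (s + 1) → Formula n s

/-- Satisfaction in the `ω`-model with second order part `M`: number quantifiers range over `ℕ`,
set quantifiers over the members of `M`. With `M = Set.univ` this is truth. -/
def Formula.Sat (M : Set (Set ℕ)) :
    {n s : ℕ} → Formula n s → (Fin n → ℕ) → (Fin s → Set ℕ) → Prop
  | _, _, .eq t u, v, _ => t.val v = u.val v
  | _, _, .lt t u, v, _ => t.val v < u.val v
  | _, _, .mem t i, v, V => t.val v ∈ V i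
  | _, _, .not φ, v, V => ¬ φ.Sat M v V
  | _, _, .and φ ψ, v, V => φ.Sat M v V ∧ ψ.Sat M v V
  | _, _, .or φ ψ, v, V => φ.Sat M v V ∨ ψ.Sat M v V
  | _, _, .allNum φ, v, V => ∀ k : ℕ, φ.Sat M (Matrix.vecCons k v) V
  | _, _, .exNum φ, v, V => ∃ k : ℕ, φ.Sat M (Matrix.vecCons k v) V
  | _, _, .allSet φ, v, V => ∀ X ∈ M, φ.Sat M v (Matrix.vecCons X V)
  | _, _, .exSet φ, v, V => ∃ X ∈ M, φ.Sat M v (Matrix.vecCons X V)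

/-- A formula is arithmetical if it has no set quantifiers (free set variables are allowed). -/
def Formula.IsArithmetical : {n s : ℕ} → Formula n s → Prop
  | _, _, .eq _ _ => True
  | _, _, .lt _ _ => True
  | _, _, .mem _ _ => True
  | _, _, .not φ => φ.IsArithmetical
  | _, _, .and φ ψ => φ.IsArithmetical ∧ ψ.IsArithmetical
  | _, _, .or φ ψ => φ.IsArithmetical ∧ ψ.IsArithmetical
  | _, _, .allNum φ => φ.IsArithmetical
  | _, _, .exNum φ => φ.IsArithmetical
  | _, _, .allSet _ => False
  | _, _, .exSet _ => False

/-- `Σ¹₁` formulas: `∃ X θ` with `θ` arithmetical. -/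
def Formula.IsSigma11 {n s : ℕ} (φ : Formula n s) : Prop :=
  ∃ θ : Formula n (s + 1), θ.IsArithmetical ∧ φ = .exSet θ

/-- `Π¹₂` formulas: `∀ X ∃ Y θ` with `θ` arithmetical. -/
def Formula.IsPi12 {n s : ℕ} (φ : Formula n s) : Prop :=
  ∃ θ : Formula n (s + 2), θ.IsArithmetical ∧ φ = .allSet (.exSet θ)

/-- `Σ¹₃` formulas: `∃ X ∀ Y ∃ Z θ` with `θ` arithmetical. -/
def Formula.IsSigma13 {n s : ℕ} (φ : Formula n s) : Prop :=
  ∃ θ : Formula n (s + 3), θ.IsArithmetical ∧ φ = .exSet (.allSet (.exSet θ))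

/-- `Π¹₃` formulas: `∀ X ∃ Y ∀ Z θ` with `θ` arithmetical. -/
def Formula.IsPi13 {n s : ℕ} (φ : Formula n s) : Prop :=
  ∃ θ : Formula n (s + 3), θ.IsArithmetical ∧ φ = .allSet (.exSet (.allSet θ))

/-- `M` (the `ω`-model with second order part `M`) is a `β`-model: `Σ¹₁` formulas with parameters
from `M` hold in `M` if and only if they are true. -/
def IsBetaModel (M : Set (Set ℕ)) : Prop :=
  ∀ (n s : ℕ) (φ : Formula n s), φ.IsSigma11 →
    ∀ (v : Fin n → ℕ) (V : Fin s → Set ℕ), (∀ i, V i ∈ M) →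
      (φ.Sat M v V ↔ φ.Sat Set.univ v V)

/-- The operator `X ↦ {k | M ⊨ φ(k, X)}` defined over `M` by `φ` with number parameters `v` and set
parameters `V`. -/
def operator (M : Set (Set ℕ)) {n s : ℕ} (φ : Formula (n + 1) (s + 1))
    (v : Fin n → ℕ) (V : Fin s → Set ℕ) (X : Set ℕ) : Set ℕ :=
  {k | φ.Sat M (Matrix.vecCons k v) (Matrix.vecCons X V)}

/-- The initial segment `{m | m ≺ k}` of the binary relation `≺` coded by `R`, where `m ≺ n` means
`Nat.pair m n ∈ R`. -/
def below (R : Set ℕ) (k : ℕ) : Set ℕ := {m | Nat.pair m k ∈ R}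

/-- `M` satisfies: `R` codes the (strict) prewellorder `≺` associated with the iteration
`Φ^ξ = Φ(Φ^{<ξ}) ∪ Φ^{<ξ}` of the operator `Φ`, and `F` is its field, the least fixed point of `Φ`.
Here `m ≺ n` iff `m` appears at an earlier stage than `n`; so if `k ∈ F` appears at stage `ξ` then
`Φ^{<ξ} = {m | m ≺ k}` and `Φ^ξ = {m ∈ F | ¬ k ≺ m}`. Minimal elements are required for
the subsets of `F` that belong to `M`. -/
structure IsStagePrewellorder (M : Set (Set ℕ)) (Φ : Set ℕ → Set ℕ) (F R : Set ℕ) : Prop where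
  field : ∀ m n, Nat.pair m n ∈ R → m ∈ F ∧ n ∈ F
  irrefl : ∀ m, Nat.pair m m ∉ R
  trans : ∀ k m n, Nat.pair k m ∈ R → Nat.pair m n ∈ R → Nat.pair k n ∈ R
  compare : ∀ m n, Nat.pair m n ∈ R → ∀ k ∈ F, Nat.pair m k ∈ R ∨ Nat.pair k n ∈ R
  wellFounded : ∀ Y ∈ M, Y ⊆ F → Y.Nonempty → ∃ m ∈ Y, ∀ n ∈ Y, Nat.pair n m ∉ R
  stage : ∀ k ∈ F, Φ (below R k) ∪ below R k = {m | m ∈ F ∧ Nat.pair k m ∉ R}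
  closed : Φ F ⊆ F

/-- `M` satisfies the axiom scheme of (boldface) `Π¹₂` monotone induction: every operator which is
defined over `M` by a `Π¹₂` formula with parameters from `M` and which is monotone on the sets in
`M` has its prewellorder (with its field) in `M`. -/
def SatisfiesPi12MI (M : Set (Set ℕ)) : Prop :=
  ∀ (n s : ℕ) (φ : Formula (n + 1) (s + 1)), φ.IsPi12 →
    ∀ (v : Fin n → ℕ) (V : Fin s → Set ℕ), (∀ i, V i ∈ M) →
      (∀ X ∈ M, ∀ Y ∈ M, X ⊆ Y → operator M φ v V X ⊆ operator M φ v V Y) →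
        ∃ F ∈ M, ∃ R ∈ M, IsStagePrewellorder M (operator M φ v V) F R

/-- The set of natural numbers that codes the real `z` (its graph). -/
def realCode (z : ℕ → ℕ) : Set ℕ := {m | ∃ n, m = Nat.pair n (z n)}

/-- `D` is `Δ¹₃(z)`-definable over `M`: defined over `M` both by a `Σ¹₃` formula and by a
`Π¹₃` formula whose only parameter is `z`. -/
def IsDelta13Over (M : Set (Set ℕ)) (z : ℕ → ℕ) (D : Set ℕ) : Prop :=
  (∃ φ : Formula 1 1, φ.IsSigma13 ∧ ∀ k, k ∈ D ↔ φ.Sat M ![k] ![realCode z]) ∧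
  (∃ ψ : Formula 1 1, ψ.IsPi13 ∧ ∀ k, k ∈ D ↔ ψ.Sat M ![k] ![realCode z])

end L2

namespace Game

/-- The finite initial segment of `x` of length `k`. -/
def initSeg (x : ℕ → ℕ) (k : ℕ) : List ℕ := (List.range k).map x

/-- `A` is (lightface) `Σ⁰₃(z)`: for some set `U` recursive in `z`, a real `x` is in `A` iff
`∃ i ∀ j ∃ k (i, j, x ↾ k) ∈ U`. -/
def IsSigma03 (z : ℕ → ℕ) (A : Set (ℕ → ℕ)) : Prop :=
  ∃ U : ℕ × ℕ × List ℕ → Bool, ComputableIn {(z : ℕ →. ℕ)} U ∧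
    ∀ x, x ∈ A ↔ ∃ i, ∀ j, ∃ k, U (i, j, initSeg x k) = true

/-- The strategy `σ` wins `G(A)` for Player I, who moves at positions of even length. -/
def WinsI (A : Set (ℕ → ℕ)) (σ : List ℕ → ℕ) : Prop :=
  ∀ x : ℕ → ℕ, (∀ n, x (2 * n) = σ (initSeg x (2 * n))) → x ∈ A

/-- The strategy `τ` wins `G(A)` for Player II, who moves at positions of odd length. -/
def WinsII (A : Set (ℕ → ℕ)) (τ : List ℕ → ℕ) : Prop :=
  ∀ x : ℕ → ℕ, (∀ n, x (2 * n + 1) = τ (initSeg x (2 * n + 1))) → x ∉ A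

/-- The set of natural numbers that codes a strategy (its graph). -/
def strategyCode (σ : List ℕ → ℕ) : Set ℕ :=
  {m | ∃ p : List ℕ, m = Nat.pair (Encodable.encode p) (σ p)}

end Game

/-! This is Davis's proof of Σ⁰₃ determinacy, carried out inside `M`. Write A = ⋃ᵢ Bᵢ with Bᵢ = ⋂ₙ
Oᵢₙ and Oᵢₙ open, and suppose that I has no winning strategy in `M`. Quasi-strategies T₀ ⊇ T₁ ⊇ …
for II are built so that every branch of Tᵢ₊₁ avoids Bᵢ, so that I has no winning strategy in `M`
from positions of length at least i in Tᵢ₊₁, and so that Tᵢ₊₁ and Tᵢ have the same positions of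
length at most i. By the last property II can stay in all the trees at once by choosing the move at
p in the tree of index |p| + 1.

To pass from T = Tᵢ to Tᵢ₊₁, consider the monotone operator that puts p into Φ(X) if, for some n, I
has no winning strategy from p in the game on T in which I wins by entering A or by reaching, after
p, a position in Oᵢₙ outside X. Let F be its least fixed point and ≺ its stage prewellorder. From
any position of T outside F and for any n, I can enter A or reach Oᵢₙ outside F; chaining these
strategies over n leads into A or into Bᵢ ⊆ A, so I wins (`IsGood.exists_wins`). Hence all positions
of length i in T lie in F. From there II carries a state r ∈ F with an index n witnessing that r
entered F, and keeps to nonlosing positions of the game with target Oᵢₙ \ {m | m ≺ r}. If Oᵢₙ is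
entered at m, then m ≺ r because the target is avoided, and m becomes the new state. States descend
along ≺, so they stabilise, and the open set of the last state is never entered
(`IsGood.not_gDelta`). Induction on the state also shows that I does not win on the new tree
(`IsGood.mem_nonlosing`).

Complexity: a strategy wins iff the tree of attempts to refute it is well-founded, a Π¹₁ condition
on which `M` is correct. So "I has no winning strategy in `M`" is Π¹₂ over `M`. The extra "for some
n" in Φ is absorbed by quantifying over sequences of strategies (`SatisfiesPi12MI.mem_stepOp`). This
needs simultaneous choice of winning strategies in `M`, obtained from a uniformization of Π¹₁
relations in the style of Kondo (`SatisfiesPi12MI.exists_uniformization`).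

Definability: F and ≺ are unique (`IsGood.unique`), and a code S of the first n levels of the
construction is recognised by a Π¹₂ condition over `M`. A value of II's strategy can therefore be
read off from some correct S, a Σ¹₃ statement, or from every correct S, a Π¹₃ statement. -/

namespace L2

set_option synthInstance.maxHeartbeats 1000000
set_option synthInstance.maxSize 100000

/-! ### Arithmetical definability of operations on coded objects -/

/-- The members of `γ` are coded by sets of natural numbers. -/
class Dom (γ : Type) where
  /-- The set that codes a member of `γ`. -/
  code : γ → Set ℕ

open Dom (code)

/-- The relation `P` between finite tuples of numbers and members `c` of `γ` is uniformly
arithmetical in the sets `K c`. -/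
def Ar {γ : Type} {r : ℕ} (K : γ → Fin r → Set ℕ) (n : ℕ) (P : (Fin n → ℕ) → γ → Prop) : Prop :=
  ∃ θ : Formula n r, θ.IsArithmetical ∧ ∀ M v c, θ.Sat M v (K c) ↔ P v c

/-- The code of a member of `γ`, as a family of one set. -/
def cd (γ : Type) [Dom γ] (c : γ) (_ : Fin 1) : Set ℕ := code c

section Ar

variable {γ : Type} {r : ℕ} {K : γ → Fin r → Set ℕ} {n m : ℕ} {P Q : (Fin n → ℕ) → γ → Prop}

theorem Ar.congr (h : Ar K n P) (e : ∀ v c, P v c ↔ Q v c) : Ar K n Q := by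
  obtain ⟨θ, h1, h2⟩ := h
  exact ⟨θ, h1, fun M v c => (h2 M v c).trans (e v c)⟩

theorem Ar.not (h : Ar K n P) : Ar K n fun v c => ¬ P v c := by
  obtain ⟨θ, h1, h2⟩ := h
  exact ⟨.not θ, h1, fun M v c => not_congr (h2 M v c)⟩

theorem Ar.and (hP : Ar K n P) (hQ : Ar K n Q) : Ar K n fun v c => P v c ∧ Q v c := by
  obtain ⟨θ, h1, h2⟩ := hP
  obtain ⟨χ, h3, h4⟩ := hQ
  exact ⟨.and θ χ, ⟨h1, h3⟩, fun M v c => and_congr (h2 M v c) (h4 M v c)⟩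

theorem Ar.or (hP : Ar K n P) (hQ : Ar K n Q) : Ar K n fun v c => P v c ∨ Q v c := by
  obtain ⟨θ, h1, h2⟩ := hP
  obtain ⟨χ, h3, h4⟩ := hQ
  exact ⟨.or θ χ, ⟨h1, h3⟩, fun M v c => or_congr (h2 M v c) (h4 M v c)⟩

theorem Ar.ex {P : (Fin (n + 1) → ℕ) → γ → Prop} (h : Ar K (n + 1) P) :
    Ar K n fun v c => ∃ k, P (Matrix.vecCons k v) c := by
  obtain ⟨θ, h1, h2⟩ := h
  exact ⟨.exNum θ, h1, fun M v c => exists_congr fun k => h2 M _ c⟩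

theorem Ar.all {P : (Fin (n + 1) → ℕ) → γ → Prop} (h : Ar K (n + 1) P) :
    Ar K n fun v c => ∀ k, P (Matrix.vecCons k v) c := by
  obtain ⟨θ, h1, h2⟩ := h
  exact ⟨.allNum θ, h1, fun M v c => forall_congr' fun k => h2 M _ c⟩

theorem Ar.eq (t u : Term n) : Ar K n fun v _ => t.val v = u.val v :=
  ⟨.eq t u, trivial, fun _ _ _ => Iff.rfl⟩

theorem Ar.lt (t u : Term n) : Ar K n fun v _ => t.val v < u.val v :=
  ⟨.lt t u, trivial, fun _ _ _ => Iff.rfl⟩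

theorem Ar.mem (t : Term n) (i : Fin r) : Ar K n fun v c => t.val v ∈ K c i :=
  ⟨.mem t i, trivial, fun _ _ _ => Iff.rfl⟩

theorem Term.exists_rename (a : Fin n → Fin m) (t : Term n) :
    ∃ u : Term m, ∀ v, u.val v = t.val (v ∘ a) := by
  induction t with
  | var i => exact ⟨.var (a i), fun _ => rfl⟩
  | zero => exact ⟨.zero, fun _ => rfl⟩
  | one => exact ⟨.one, fun _ => rfl⟩
  | add t u ht hu =>
    obtain ⟨t', ht⟩ := ht
    obtain ⟨u', hu⟩ := hu
    exact ⟨.add t' u', fun v => by simp [Term.val, ht, hu]⟩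
  | mul t u ht hu =>
    obtain ⟨t', ht⟩ := ht
    obtain ⟨u', hu⟩ := hu
    exact ⟨.mul t' u', fun v => by simp [Term.val, ht, hu]⟩

theorem vecCons_comp_lift (a : Fin n → Fin m) (v : Fin m → ℕ) (k : ℕ) :
    (Matrix.vecCons k v) ∘ (Matrix.vecCons 0 (Fin.succ ∘ a) : Fin (n + 1) → Fin (m + 1)) =
      Matrix.vecCons k (v ∘ a) := by
  funext i
  refine Fin.cases ?_ (fun i => ?_) i <;> simp

theorem Formula.exists_rename {s : ℕ} (θ : Formula n s) (hθ : θ.IsArithmetical) {m : ℕ}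
    (a : Fin n → Fin m) : ∃ χ : Formula m s, χ.IsArithmetical ∧
      ∀ M v V, χ.Sat M v V ↔ θ.Sat M (v ∘ a) V := by
  induction θ generalizing m with
  | eq t u =>
    obtain ⟨t', ht⟩ := t.exists_rename a
    obtain ⟨u', hu⟩ := u.exists_rename a
    exact ⟨.eq t' u', trivial, fun M v V => by simp [Formula.Sat, ht, hu]⟩
  | lt t u =>
    obtain ⟨t', ht⟩ := t.exists_rename a
    obtain ⟨u', hu⟩ := u.exists_rename a
    exact ⟨.lt t' u', trivial, fun M v V => by simp [Formula.Sat, ht, hu]⟩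
  | mem t i =>
    obtain ⟨t', ht⟩ := t.exists_rename a
    exact ⟨.mem t' i, trivial, fun M v V => by simp [Formula.Sat, ht]⟩
  | not θ ih =>
    obtain ⟨χ, h1, h2⟩ := ih hθ a
    exact ⟨.not χ, h1, fun M v V => not_congr (h2 M v V)⟩
  | and θ θ' ih ih' =>
    obtain ⟨χ, h1, h2⟩ := ih hθ.1 a
    obtain ⟨χ', h1', h2'⟩ := ih' hθ.2 a
    exact ⟨.and χ χ', ⟨h1, h1'⟩, fun M v V => and_congr (h2 M v V) (h2' M v V)⟩
  | or θ θ' ih ih' =>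
    obtain ⟨χ, h1, h2⟩ := ih hθ.1 a
    obtain ⟨χ', h1', h2'⟩ := ih' hθ.2 a
    exact ⟨.or χ χ', ⟨h1, h1'⟩, fun M v V => or_congr (h2 M v V) (h2' M v V)⟩
  | allNum θ ih =>
    obtain ⟨χ, h1, h2⟩ := ih hθ (Matrix.vecCons 0 (Fin.succ ∘ a))
    exact ⟨.allNum χ, h1, fun M v V => forall_congr' fun k => by
      rw [h2, vecCons_comp_lift]⟩
  | exNum θ ih =>
    obtain ⟨χ, h1, h2⟩ := ih hθ (Matrix.vecCons 0 (Fin.succ ∘ a))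
    exact ⟨.exNum χ, h1, fun M v V => exists_congr fun k => by
      rw [h2, vecCons_comp_lift]⟩
  | allSet => exact hθ.elim
  | exSet => exact hθ.elim

theorem Ar.rename (h : Ar K n P) (a : Fin n → Fin m) : Ar K m fun v c => P (v ∘ a) c := by
  obtain ⟨θ, h1, h2⟩ := h
  obtain ⟨χ, h3, h4⟩ := θ.exists_rename h1 a
  exact ⟨χ, h3, fun M v c => (h4 M v _).trans (h2 M _ c)⟩

/-- Arithmetical formulas about arithmetically given sets define arithmetical relations. -/
theorem Ar.subst {s : ℕ} (θ : Formula n s) (hθ : θ.IsArithmetical) {m : ℕ} (a : Fin n → Fin m)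
    (V : (Fin m → ℕ) → γ → Fin s → Set ℕ)
    (hV : ∀ i, Ar K (m + 1) fun v c => v 0 ∈ V (Fin.tail v) c i) :
    Ar K m fun v c => θ.Sat Set.univ (v ∘ a) (V v c) := by
  induction θ generalizing m with
  | eq t u =>
    obtain ⟨t', ht⟩ := t.exists_rename a
    obtain ⟨u', hu⟩ := u.exists_rename a
    exact (Ar.eq t' u').congr fun v c => by simp [Formula.Sat, ht, hu]
  | lt t u =>
    obtain ⟨t', ht⟩ := t.exists_rename a
    obtain ⟨u', hu⟩ := u.exists_rename a
    exact (Ar.lt t' u').congr fun v c => by simp [Formula.Sat, ht, hu]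
  | mem t i =>
    obtain ⟨t', ht⟩ := t.exists_rename a
    obtain ⟨t'', ht'⟩ := t'.exists_rename (Fin.succ : Fin m → Fin (m + 1))
    -- Membership t ∈ Vᵢ becomes ∃ k (k = t ∧ k ∈ Vᵢ), so that the definition of Vᵢ is needed only
    -- at a variable.
    refine (((Ar.eq t'' (.var 0)).and (hV i)).ex).congr fun v c => ?_
    have e : (Matrix.vecCons · v : ℕ → Fin (m + 1) → ℕ) = fun k => Matrix.vecCons k v := rfl
    have e' : ∀ k, (Matrix.vecCons k v) ∘ Fin.succ = v := fun k => by funext i; simp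
    have e'' : ∀ k, Fin.tail (Matrix.vecCons k v) = v := fun k => by funext i; simp [Fin.tail]
    simp [Formula.Sat, ht', ht, e', e'', Term.val]
  | not θ ih => exact (ih hθ a V hV).not
  | and θ θ' ih ih' => exact (ih hθ.1 a V hV).and (ih' hθ.2 a V hV)
  | or θ θ' ih ih' => exact (ih hθ.1 a V hV).or (ih' hθ.2 a V hV)
  | allNum θ ih =>
    have := ih hθ (Matrix.vecCons 0 (Fin.succ ∘ a)) (fun v c => V (Fin.tail v) c) fun i =>
      ((hV i).rename (Matrix.vecCons 0 (Fin.succ ∘ Fin.succ) : Fin (m + 1) → Fin (m + 2))).congr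
        fun v c => by
          simp only [Function.comp, Matrix.cons_val_zero]
          rfl
    refine this.all.congr fun v c => forall_congr' fun k => ?_
    rw [vecCons_comp_lift]
    rfl
  | exNum θ ih =>
    have := ih hθ (Matrix.vecCons 0 (Fin.succ ∘ a)) (fun v c => V (Fin.tail v) c) fun i =>
      ((hV i).rename (Matrix.vecCons 0 (Fin.succ ∘ Fin.succ) : Fin (m + 1) → Fin (m + 2))).congr
        fun v c => by
          simp only [Function.comp, Matrix.cons_val_zero]
          rfl
    refine this.ex.congr fun v c => exists_congr fun k => ?_
    rw [vecCons_comp_lift]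
    rfl
  | allSet => exact hθ.elim
  | exSet => exact hθ.elim

end Ar

/-- The operation `f` is uniformly arithmetical in the codes. -/
class Df {γ δ : Type} [Dom γ] [Dom δ] (f : γ → δ) : Prop where
  out : Ar (cd γ) 1 fun v c => v 0 ∈ code (f c)

/-- `code A` is `{2a} ∪ {2b+1}` for a pair. -/
def join (A B : Set ℕ) : Set ℕ := {k | (∃ a ∈ A, k = a + a) ∨ ∃ b ∈ B, k = b + b + 1}

theorem double_mem_join {A B : Set ℕ} {a : ℕ} : a + a ∈ join A B ↔ a ∈ A := by
  constructor
  · rintro (⟨b, hb, h⟩ | ⟨b, hb, h⟩)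
    · rwa [show a = b by omega]
    · omega
  · exact fun h => Or.inl ⟨a, h, rfl⟩

theorem double_succ_mem_join {A B : Set ℕ} {a : ℕ} : a + a + 1 ∈ join A B ↔ a ∈ B := by
  constructor
  · rintro (⟨b, hb, h⟩ | ⟨b, hb, h⟩)
    · omega
    · rwa [show a = b by omega]
  · exact fun h => Or.inr ⟨a, h, rfl⟩

instance : Dom (Set ℕ) := ⟨id⟩
instance : Dom (ℕ → ℕ) := ⟨realCode⟩
-- Truth values are coded by ω and ∅, so that predicates can be treated as definable operations;
-- membership of 0 decides which.
instance : Dom Prop := ⟨fun p => {_k | p}⟩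
-- Iterated pairs serve as contexts: any finite list of number, set and function parameters is a
-- single set parameter.
instance {γ δ : Type} [Dom γ] [Dom δ] : Dom (γ × δ) := ⟨fun c => join (code c.1) (code c.2)⟩

/-- A member of `α` is coded by the singleton of its number. -/
class NumDom (α : Type) extends Primcodable α, Dom α where
  code_eq : ∀ a : α, code a = {Encodable.encode a}

instance : NumDom ℕ := { code := fun a => {a}, code_eq := fun _ => rfl }
instance : NumDom (List ℕ) := { code := fun a => {Encodable.encode a}, code_eq := fun _ => rfl }

/-! ### Uniformly arithmetical operations and their closure properties. -/

section Df

variable {γ δ ε : Type} [Dom γ] [Dom δ] [Dom ε]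

theorem Df.comp {f : δ → ε} {g : γ → δ} (hf : Df f) (hg : Df g) : Df fun c => f (g c) := by
  obtain ⟨θ, h1, h2⟩ := hf.out
  refine ⟨(Ar.subst θ h1 id (fun _ c => cd δ (g c)) fun i => ?_).congr fun v c => h2 _ v (g c)⟩
  exact (hg.out.rename (fun _ => 0)).congr fun v c => by simp [cd]

theorem Df.of_eq {f g : γ → δ} (hf : Df f) (h : ∀ c, f c = g c) : Df g := by
  rwa [show g = f from funext fun c => (h c).symm]

instance (priority := 10000) Df.id : Df fun c : γ => c := ⟨Ar.mem (.var 0) 0⟩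

theorem Df.fst : Df fun p : γ × δ => p.1 :=
  ⟨(Ar.mem (.add (.var 0) (.var 0)) 0).congr fun _ _ => double_mem_join⟩

theorem Df.snd : Df fun p : γ × δ => p.2 :=
  ⟨(Ar.mem (.add (.add (.var 0) (.var 0)) .one) 0).congr fun _ _ => double_succ_mem_join⟩

instance Df.fst_comp {f : γ → δ × ε} [hf : Df f] : Df fun c => (f c).1 := Df.fst.comp hf
instance Df.snd_comp {f : γ → δ × ε} [hf : Df f] : Df fun c => (f c).2 := Df.snd.comp hf

instance (priority := 10) Df.pair {f : γ → δ} {g : γ → ε} [hf : Df f] [hg : Df g] : Df fun c => (f c, g c) := by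
  refine ⟨(((hf.out.rename ![(0 : Fin 2)]).and
      (Ar.eq (n := 2) (.var 1) (.add (.var 0) (.var 0)))).ex.or
    ((hg.out.rename ![(0 : Fin 2)]).and
      (Ar.eq (n := 2) (.var 1) (.add (.add (.var 0) (.var 0)) .one))).ex).congr fun v c => ?_⟩
  simp [Term.val, code, join]

/-- Definability of a predicate. -/
theorem Df.iff_ar {P : γ → Prop} : Df P ↔ Ar (cd γ) 0 fun _ c => P c := by
  constructor
  · rintro ⟨h⟩
    refine ((h.and (Ar.eq (.var 0) .zero)).ex).congr fun v c => ?_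
    simp [code, Term.val]
  · exact fun h => ⟨(h.rename Fin.elim0).congr fun v c => Iff.rfl⟩

theorem Df.ar {P : γ → Prop} (h : Df P) {n : ℕ} : Ar (cd γ) n fun _ c => P c :=
  (Df.iff_ar.1 h).rename Fin.elim0

/-- The last coordinate of a context can be traded for a number variable. -/
theorem Df.ar_snd {P : γ × ℕ → Prop} (h : Df P) : Ar (cd γ) 1 fun v c => P (c, v 0) := by
  obtain ⟨θ, h1, h2⟩ := Df.iff_ar.1 h
  refine (Ar.subst θ h1 Fin.elim0 (fun v c => cd (γ × ℕ) (c, v 0)) fun i => ?_).congr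
    fun v c => h2 _ _ (c, v 0)
  refine (((Ar.mem (n := 3) (.var 0) 0).and
      (Ar.eq (n := 3) (.var 1) (.add (.var 0) (.var 0)))).ex.or
    ((Ar.eq (n := 3) (.var 0) (.var 2)).and
      (Ar.eq (n := 3) (.var 1) (.add (.add (.var 0) (.var 0)) .one))).ex).congr fun v c => ?_
  simp [Term.val, code, join, Fin.tail, cd]

instance Df.not {P : γ → Prop} [h : Df P] : Df fun c => ¬ P c := ⟨h.out.not⟩
instance Df.and {P Q : γ → Prop} [h : Df P] [h' : Df Q] : Df fun c => P c ∧ Q c :=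
  ⟨h.out.and h'.out⟩
instance Df.or {P Q : γ → Prop} [h : Df P] [h' : Df Q] : Df fun c => P c ∨ Q c :=
  ⟨h.out.or h'.out⟩
instance Df.imp {P Q : γ → Prop} [h : Df P] [h' : Df Q] : Df fun c => P c → Q c :=
  ⟨(h.out.not.or h'.out).congr fun _ _ => by simp [code, imp_iff_not_or]⟩
instance Df.iff {P Q : γ → Prop} [h : Df P] [h' : Df Q] : Df fun c => P c ↔ Q c :=
  Df.of_eq (f := fun c => (P c → Q c) ∧ (Q c → P c)) inferInstance fun _ =>
    propext iff_iff_implies_and_implies.symm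

instance Df.exNat {P : γ → ℕ → Prop} [h : Df fun p : γ × ℕ => P p.1 p.2] :
    Df fun c => ∃ k, P c k := Df.iff_ar.2 h.ar_snd.ex

instance Df.allNat {P : γ → ℕ → Prop} [h : Df fun p : γ × ℕ => P p.1 p.2] :
    Df fun c => ∀ k, P c k := Df.iff_ar.2 h.ar_snd.all

theorem Df.set {P : γ → ℕ → Prop} (h : Df fun p : γ × ℕ => P p.1 p.2) :
    Df fun c => {k | P c k} := ⟨h.ar_snd⟩

theorem Df.const {α : Type} [NumDom α] (a : α) : Df fun _ : γ => a := by
  have : ∀ k : ℕ, ∃ t : Term 1, ∀ v, t.val v = k := fun k => by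
    induction k with
    | zero => exact ⟨.zero, fun _ => rfl⟩
    | succ k ih =>
      obtain ⟨t, ht⟩ := ih
      exact ⟨.add t .one, fun v => by simp [Term.val, ht]⟩
  obtain ⟨t, ht⟩ := this (Encodable.encode a)
  exact ⟨(Ar.eq (.var 0) t).congr fun v c => by simp [NumDom.code_eq, ht, Term.val]⟩

theorem Df.iff_graph {α : Type} [NumDom α] {t : γ → α} :
    Df t ↔ Ar (cd γ) 1 fun v c => v 0 = Encodable.encode (t c) :=
  ⟨fun h => h.out.congr fun v c => by simp [NumDom.code_eq],
    fun h => ⟨h.congr fun v c => by simp [NumDom.code_eq]⟩⟩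

theorem Df.graph {t : γ → ℕ} (h : Df t) : Ar (cd γ) 1 fun v c => v 0 = t c := Df.iff_graph.1 h

theorem Df.of_graph {t : γ → ℕ} (h : Df fun p : γ × ℕ => p.2 = t p.1) : Df t :=
  Df.iff_graph.2 h.ar_snd

/-- Binary relations between numbers are respected by substitution. -/
theorem Df.rel₂ {α β : Type} [NumDom α] [NumDom β] {R : ℕ → ℕ → Prop} {t : γ → α} {u : γ → β}
    (ht : Df t) (hu : Df u) (hR : Ar (cd γ) 2 fun v _ => R (v 0) (v 1)) :
    Df fun c => R (Encodable.encode (t c)) (Encodable.encode (u c)) := by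
  refine Df.iff_ar.2 (((((iff_graph.1 ht).rename ![(0 : Fin 2)]).and
    (((iff_graph.1 hu).rename ![(1 : Fin 2)]).and hR)).ex.ex).congr fun v c => ?_)
  simp

instance Df.eq {α : Type} [NumDom α] {t u : γ → α} [ht : Df t] [hu : Df u] :
    Df fun c => t c = u c :=
  Df.of_eq (Df.rel₂ (R := (· = ·)) ht hu (Ar.eq (.var 0) (.var 1))) fun _ =>
    propext Encodable.encode_injective.eq_iff

instance Df.lt {t u : γ → ℕ} [ht : Df t] [hu : Df u] : Df fun c => t c < u c :=
  Df.rel₂ (R := (· < ·)) ht hu (Ar.lt (.var 0) (.var 1))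

instance Df.le {t u : γ → ℕ} [ht : Df t] [hu : Df u] : Df fun c => t c ≤ u c :=
  Df.of_eq (f := fun c => ¬ u c < t c) inferInstance fun _ => propext not_lt

instance Df.mem {t : γ → ℕ} {A : γ → Set ℕ} [ht : Df t] [hA : Df A] : Df fun c => t c ∈ A c :=
  Df.iff_ar.2 ((ht.graph.and hA.out).ex.congr fun v c => by simp [code])

end Df

/-! ### Computable functions are arithmetical -/

section

variable {γ δ ε : Type} [Dom γ] [Dom δ] [Dom ε]

instance Df.add {t u : γ → ℕ} [ht : Df t] [hu : Df u] : Df fun c => t c + u c := by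
  refine Df.iff_graph.2 ((((ht.graph.rename ![(0 : Fin 3)]).and ((hu.graph.rename ![(1 : Fin 3)]).and
    (Ar.eq (n := 3) (.var 2) (.add (.var 0) (.var 1))))).ex.ex).congr fun v c => ?_)
  simp [Term.val]

instance Df.mul {t u : γ → ℕ} [ht : Df t] [hu : Df u] : Df fun c => t c * u c := by
  refine Df.iff_graph.2 ((((ht.graph.rename ![(0 : Fin 3)]).and ((hu.graph.rename ![(1 : Fin 3)]).and
    (Ar.eq (n := 3) (.var 2) (.mul (.var 0) (.var 1))))).ex.ex).congr fun v c => ?_)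
  simp [Term.val]

instance Df.const_nat (k : ℕ) : Df fun _ : γ => k := Df.const k
instance Df.const_list (k : List ℕ) : Df fun _ : γ => k := Df.const k

theorem Df.natPair : Df fun p : ℕ × ℕ => Nat.pair p.1 p.2 := by
  refine Df.of_graph (Df.of_eq (f := fun q : (ℕ × ℕ) × ℕ =>
    (q.1.1 < q.1.2 ∧ q.2 = q.1.2 * q.1.2 + q.1.1) ∨
    (¬ q.1.1 < q.1.2 ∧ q.2 = q.1.1 * q.1.1 + q.1.1 + q.1.2)) inferInstance ?_)
  rintro ⟨⟨a, b⟩, k⟩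
  by_cases h : a < b <;> simp [Nat.pair, h]

instance Df.natPair_comp {t u : γ → ℕ} [ht : Df t] [hu : Df u] :
    Df fun c => Nat.pair (t c) (u c) :=
  Df.natPair.comp (g := fun c => (t c, u c)) inferInstance

instance Df.unpair_fst {t : γ → ℕ} [ht : Df t] : Df fun c => (Nat.unpair (t c)).1 :=
  Df.comp (f := fun n : ℕ => (Nat.unpair n).1) (Df.of_graph (Df.of_eq
    (f := fun q : ℕ × ℕ => ∃ b, q.1 = Nat.pair q.2 b) inferInstance (by
      rintro ⟨n, k⟩
      simp only [eq_iff_iff]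
      constructor
      · rintro ⟨b, rfl⟩
        simp
      · rintro rfl
        exact ⟨_, (Nat.pair_unpair n).symm⟩))) ht

instance Df.unpair_snd {t : γ → ℕ} [ht : Df t] : Df fun c => (Nat.unpair (t c)).2 :=
  Df.comp (f := fun n : ℕ => (Nat.unpair n).2) (Df.of_graph (Df.of_eq
    (f := fun q : ℕ × ℕ => ∃ b, q.1 = Nat.pair b q.2) inferInstance (by
      rintro ⟨n, k⟩
      simp only [eq_iff_iff]
      constructor
      · rintro ⟨b, rfl⟩
        simp
      · rintro rfl
        exact ⟨_, (Nat.pair_unpair n).symm⟩))) ht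

instance Df.beta {t u : γ → ℕ} [ht : Df t] [hu : Df u] : Df fun c => Nat.beta (t c) (u c) :=
  Df.comp (f := fun p : ℕ × ℕ => Nat.beta p.1 p.2) (g := fun c => (t c, u c)) (Df.of_graph (Df.of_eq
    (f := fun q : (ℕ × ℕ) × ℕ => q.2 < (q.1.2 + 1) * (Nat.unpair q.1.1).2 + 1 ∧
      ∃ b, (Nat.unpair q.1.1).1 = q.2 + ((q.1.2 + 1) * (Nat.unpair q.1.1).2 + 1) * b)
      inferInstance (by
      rintro ⟨⟨n, i⟩, k⟩
      simp only [Nat.beta, eq_iff_iff]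
      constructor
      · rintro ⟨h, b, hb⟩
        rw [hb, Nat.add_mul_mod_self_left, Nat.mod_eq_of_lt h]
      · rintro rfl
        exact ⟨Nat.mod_lt _ (by omega), _, (Nat.mod_add_div _ _).symm⟩))) inferInstance

/-- Every finite sequence is coded by a number. -/
theorem exists_beta_eq (n : ℕ) (s : ℕ → ℕ) : ∃ w, ∀ i ≤ n, Nat.beta w i = s i := by
  refine ⟨Nat.unbeta ((List.range (n + 1)).map s), fun i hi => ?_⟩
  have := Nat.beta_unbeta_coe ((List.range (n + 1)).map s) ⟨i, by simp; omega⟩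
  simpa using this

/-- The partial function `f` has a graph that is arithmetical in the codes of members of `γ`. -/
def DfGraph (γ : Type) [Dom γ] (f : ℕ →. ℕ) : Prop := Df fun p : γ × ℕ × ℕ => p.2.2 ∈ f p.2.1

theorem DfGraph.app {f : ℕ →. ℕ} (h : DfGraph γ f) {o : δ → γ} {t u : δ → ℕ} (ho : Df o)
    (ht : Df t) (hu : Df u) : Df fun c => u c ∈ f (t c) :=
  Df.comp (f := fun p : γ × ℕ × ℕ => p.2.2 ∈ f p.2.1) (g := fun c => (o c, t c, u c)) h
    inferInstance

/-- Replaces a primitive recursion by the existence of a finite sequence of intermediate values,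
which the β function can code by one number. -/
theorem mem_natRec_iff {a n m : ℕ} {f h : ℕ →. ℕ} :
    m ∈ (Nat.rec (f a) (fun y IH => do
          let i ← IH
          h (Nat.pair a (Nat.pair y i))) n : Part ℕ) ↔
      ∃ s : ℕ → ℕ, s 0 ∈ f a ∧ (∀ y < n, s (y + 1) ∈ h (Nat.pair a (Nat.pair y (s y)))) ∧
        m = s n := by
  induction n generalizing m with
  | zero =>
    constructor
    · exact fun h => ⟨fun _ => m, h, fun _ h => absurd h (Nat.not_lt_zero _), rfl⟩
    · rintro ⟨s, h0, -, rfl⟩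
      exact h0
  | succ n ih =>
    simp only [Part.bind_eq_bind, Part.mem_bind_iff]
    constructor
    · rintro ⟨i, hi, hm⟩
      obtain ⟨s, h0, h1, rfl⟩ := ih.1 hi
      refine ⟨fun y => if y = n + 1 then m else s y, by simpa using h0, fun y hy => ?_, by simp⟩
      rcases Nat.lt_succ_iff_lt_or_eq.1 hy with hy' | rfl
      · have := h1 y hy'
        simpa [show y ≠ n + 1 by omega, show y ≠ n by omega] using this
      · simpa using hm
    · rintro ⟨s, h0, h1, rfl⟩
      exact ⟨s n, ih.2 ⟨s, h0, fun y hy => h1 y (by omega), rfl⟩, h1 n (by omega)⟩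

/-- Induction on the generation of recursive functions. Composition and pairing cost number
quantifiers, recursion uses the β function, and minimisation a bounded quantifier; oracles enter
only through their graphs. -/
theorem DfGraph.of_recursiveIn {O : Set (ℕ →. ℕ)} (hO : ∀ g ∈ O, DfGraph γ g) {f : ℕ →. ℕ}
    (hf : Nat.RecursiveIn O f) : DfGraph γ f := by
  induction hf with
  | zero =>
    exact Df.of_eq (f := fun p : γ × ℕ × ℕ => p.2.2 = 0) inferInstance
      fun _ => propext Part.mem_some_iff.symm
  | succ =>
    exact Df.of_eq (f := fun p : γ × ℕ × ℕ => p.2.2 = p.2.1 + 1) inferInstance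
      fun _ => propext Part.mem_some_iff.symm
  | left =>
    exact Df.of_eq (f := fun p : γ × ℕ × ℕ => p.2.2 = (Nat.unpair p.2.1).1) inferInstance
      fun _ => propext Part.mem_some_iff.symm
  | right =>
    exact Df.of_eq (f := fun p : γ × ℕ × ℕ => p.2.2 = (Nat.unpair p.2.1).2) inferInstance
      fun _ => propext Part.mem_some_iff.symm
  | oracle g hg => exact hO g hg
  | @pair f h _ _ ihf ihh =>
    have i1 : Df fun q : ((γ × ℕ × ℕ) × ℕ) × ℕ => q.1.2 ∈ f q.1.1.2.1 :=
      ihf.app (o := fun q => q.1.1.1) inferInstance inferInstance inferInstance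
    have i2 : Df fun q : ((γ × ℕ × ℕ) × ℕ) × ℕ => q.2 ∈ h q.1.1.2.1 :=
      ihh.app (o := fun q => q.1.1.1) inferInstance inferInstance inferInstance
    refine Df.of_eq (f := fun p : γ × ℕ × ℕ =>
      ∃ a, ∃ b, a ∈ f p.2.1 ∧ b ∈ h p.2.1 ∧ p.2.2 = Nat.pair a b) inferInstance fun p => ?_
    simp only [Seq.seq, eq_iff_iff]
    simp
    constructor
    · rintro ⟨a, ha, b, hb, h⟩
      exact ⟨a, ha, b, hb, h.symm⟩
    · rintro ⟨a, ha, b, hb, h⟩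
      exact ⟨a, ha, b, hb, h.symm⟩
  | @comp f h _ _ ihf ihh =>
    have i1 : Df fun q : (γ × ℕ × ℕ) × ℕ => q.1.2.2 ∈ f q.2 :=
      ihf.app (o := fun q => q.1.1) inferInstance inferInstance inferInstance
    have i2 : Df fun q : (γ × ℕ × ℕ) × ℕ => q.2 ∈ h q.1.2.1 :=
      ihh.app (o := fun q => q.1.1) inferInstance inferInstance inferInstance
    exact Df.of_eq (f := fun p : γ × ℕ × ℕ => ∃ a, a ∈ h p.2.1 ∧ p.2.2 ∈ f a) inferInstance
      fun p => propext Part.mem_bind_iff.symm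
  | @prec f h _ _ ihf ihh =>
    have i1 : Df fun q : (γ × ℕ × ℕ) × ℕ => Nat.beta q.2 0 ∈ f (Nat.unpair q.1.2.1).1 :=
      ihf.app (o := fun q => q.1.1) inferInstance inferInstance inferInstance
    have i2 : Df fun q : ((γ × ℕ × ℕ) × ℕ) × ℕ => Nat.beta q.1.2 (q.2 + 1) ∈
        h (Nat.pair (Nat.unpair q.1.1.2.1).1 (Nat.pair q.2 (Nat.beta q.1.2 q.2))) :=
      ihh.app (o := fun q => q.1.1.1) inferInstance inferInstance inferInstance
    refine Df.of_eq (f := fun p : γ × ℕ × ℕ => ∃ w, Nat.beta w 0 ∈ f (Nat.unpair p.2.1).1 ∧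
      (∀ y, y < (Nat.unpair p.2.1).2 → Nat.beta w (y + 1) ∈
        h (Nat.pair (Nat.unpair p.2.1).1 (Nat.pair y (Nat.beta w y)))) ∧
      p.2.2 = Nat.beta w (Nat.unpair p.2.1).2) inferInstance fun p => ?_
    refine propext (Iff.trans ?_ mem_natRec_iff.symm)
    constructor
    · rintro ⟨w, h0, h1, h2⟩
      exact ⟨Nat.beta w, h0, h1, h2⟩
    · rintro ⟨s, h0, h1, h2⟩
      obtain ⟨w, hw⟩ := exists_beta_eq (Nat.unpair p.2.1).2 s
      refine ⟨w, by rwa [hw _ (Nat.zero_le _)], fun y hy => ?_, by rwa [hw _ le_rfl]⟩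
      rw [hw _ hy, hw _ hy.le]
      exact h1 y hy
  | @rfind f _ ihf =>
    have i1 : Df fun q : γ × ℕ × ℕ => 0 ∈ f (Nat.pair q.2.1 q.2.2) :=
      ihf.app (o := fun q => q.1) inferInstance inferInstance inferInstance
    have i2 : Df fun q : ((γ × ℕ × ℕ) × ℕ) × ℕ => q.2 ∈ f (Nat.pair q.1.1.2.1 q.1.2) :=
      ihf.app (o := fun q => q.1.1.1) inferInstance inferInstance inferInstance
    refine Df.of_eq (f := fun p : γ × ℕ × ℕ => 0 ∈ f (Nat.pair p.2.1 p.2.2) ∧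
      ∀ k, k < p.2.2 → ∃ j, j ∈ f (Nat.pair p.2.1 k) ∧ ¬ j = 0) inferInstance fun p => ?_
    refine propext (Iff.trans ?_ Nat.mem_rfind.symm)
    simp

theorem Df.of_computable {α β : Type} [NumDom α] [NumDom β] {f : α → β} (hf : Computable f) :
    Df f := by
  have h : DfGraph ℕ _ := DfGraph.of_recursiveIn (O := ∅) (by simp)
    (Partrec.recursiveIn hf.partrec : Nat.RecursiveIn ∅ _)
  have h' : Ar (cd α) 1 fun v c => ∃ k, k ∈ code c ∧ v 0 ∈ Part.bind (↑(Encodable.decode (α := α) k))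
      fun a => (Part.some (f a)).map Encodable.encode := by
    have := (h.app (δ := ℕ × ℕ) (o := Prod.fst) (t := Prod.fst) (u := Prod.snd) Df.fst Df.fst
      Df.snd)
    obtain ⟨θ, h1, h2⟩ := Df.iff_ar.1 this
    have hθ : Ar (cd α) 2 fun v _ => v 1 ∈ Part.bind (↑(Encodable.decode (α := α) (v 0)))
      fun a => (Part.some (f a)).map Encodable.encode := by
      refine (Ar.subst θ h1 Fin.elim0 (fun v c => cd (ℕ × ℕ) (v 0, v 1)) fun i => ?_).congr
        fun v c => h2 _ _ (v 0, v 1)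
      refine (((Ar.eq (n := 4) (.var 0) (.var 2)).and
          (Ar.eq (n := 4) (.var 1) (.add (.var 0) (.var 0)))).ex.or
        ((Ar.eq (n := 4) (.var 0) (.var 3)).and
          (Ar.eq (n := 4) (.var 1) (.add (.add (.var 0) (.var 0)) .one))).ex).congr fun v c => ?_
      simp [Term.val, code, join, Fin.tail, cd]
    exact ((Ar.mem (.var 0) 0).and (hθ.rename (m := 2) ![0, 1])).ex.congr fun v c => by
      simp [Term.val, cd]
  refine Df.iff_graph.2 (h'.congr fun v c => ?_)
  simp [NumDom.code_eq]

theorem Df.encode_comp {α : Type} [NumDom α] {t : γ → α} (ht : Df t) :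
    Df fun c => Encodable.encode (t c) :=
  (Df.of_computable Computable.encode).comp ht

theorem Df.of_computable₂ {α β σ : Type} [NumDom α] [NumDom β] [NumDom σ] [Inhabited α]
    [Inhabited β] {f : α → β → σ} (hf : Computable₂ f) {t : γ → α} {u : γ → β} (ht : Df t)
    (hu : Df u) : Df fun c => f (t c) (u c) := by
  -- Both arguments are packed into one number. The defaults are never used, because only codes are
  -- decoded.
  have hc : Computable fun k : ℕ => f ((Encodable.decode (α := α) k.unpair.1).getD default)
      ((Encodable.decode (α := β) k.unpair.2).getD default) :=
    hf.comp
      ((Primrec.option_getD.comp (Primrec.decode.comp (Primrec.fst.comp Primrec.unpair))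
        (Primrec.const _)).to_comp)
      ((Primrec.option_getD.comp (Primrec.decode.comp (Primrec.snd.comp Primrec.unpair))
        (Primrec.const _)).to_comp)
  have := ht.encode_comp
  have := hu.encode_comp
  refine ((Df.of_computable hc).comp (g := fun c =>
    Nat.pair (Encodable.encode (t c)) (Encodable.encode (u c))) inferInstance).of_eq fun c => ?_
  simp

end

/-! ### Further definable operations -/

section

variable {γ δ ε : Type} [Dom γ] [Dom δ] [Dom ε]

instance (priority := 50) Df.eval {x : γ → ℕ → ℕ} {t : γ → ℕ} [hx : Df x] [ht : Df t] :
    Df fun c => x c (t c) := by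
  refine Df.comp (f := fun p : (ℕ → ℕ) × ℕ => p.1 p.2) (g := fun c => (x c, t c))
    (Df.of_graph ?_) inferInstance
  have h : Df fun p : ((ℕ → ℕ) × ℕ) × ℕ => p.1.1 := inferInstance
  have h1 : Df fun p : ((ℕ → ℕ) × ℕ) × ℕ => Nat.pair p.1.2 p.2 := inferInstance
  refine Df.iff_ar.2 ((h1.graph.and h.out).ex.congr fun v c => ?_)
  simp only [Matrix.cons_val_zero, code, realCode, Set.mem_ofPred_eq, exists_eq_left,
    Nat.pair_eq_pair]
  constructor
  · rintro ⟨n, rfl, h⟩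
    exact h
  · exact fun h => ⟨_, rfl, h⟩

theorem Df.fun {t : γ → ℕ → ℕ} (h : Df fun p : γ × ℕ => t p.1 p.2) : Df t := by
  have h' : Df fun p : (γ × ℕ) × ℕ => t p.1.1 p.2 :=
    h.comp (g := fun p : (γ × ℕ) × ℕ => (p.1.1, p.2)) inferInstance
  refine ⟨(Df.ar_snd (P := fun p : γ × ℕ => ∃ k, p.2 = Nat.pair k (t p.1 k))
    inferInstance).congr fun v c => Iff.rfl⟩

instance Df.setOf {P : γ → ℕ → Prop} [h : Df fun p : γ × ℕ => P p.1 p.2] :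
    Df fun c => {k | P c k} := h.set

instance Df.ite {P : γ → Prop} {i : ∀ c, Decidable (P c)} {t u : γ → δ} [hP : Df P] [ht : Df t]
    [hu : Df u] : Df fun c => @ite δ (P c) (i c) (t c) (u c) := by
  refine ⟨((hP.ar.and ht.out).or (hP.ar.not.and hu.out)).congr fun v c => ?_⟩
  by_cases h : P c <;> simp [h]

instance Df.sInf_comp {S : γ → Set ℕ} [h : Df S] : Df fun c => sInf (S c) := by
  -- The second disjunct is the convention that the infimum of the empty set is 0.
  refine Df.comp (f := fun S : Set ℕ => sInf S) (Df.of_graph (Df.of_eq (f := fun p : Set ℕ × ℕ =>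
    (p.2 ∈ p.1 ∧ ∀ j, j < p.2 → ¬ j ∈ p.1) ∨ (p.2 = 0 ∧ ∀ j, ¬ j ∈ p.1)) inferInstance
    fun ⟨S, k⟩ => ?_)) h
  simp only [eq_iff_iff]
  constructor
  · rintro (⟨h1, h2⟩ | ⟨rfl, h⟩)
    · exact le_antisymm (not_lt.1 fun h => h2 _ h (Nat.sInf_mem ⟨_, h1⟩)) (Nat.sInf_le h1)
    · rw [Set.eq_empty_of_forall_notMem h]
      simp
  · rintro rfl
    rcases S.eq_empty_or_nonempty with rfl | h
    · exact Or.inr ⟨by simp, by simp⟩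
    · exact Or.inl ⟨Nat.sInf_mem h, fun j => Nat.notMem_of_lt_sInf⟩

/-- The list with a given number. -/
def lst (k : ℕ) : List ℕ := Denumerable.ofNat (List ℕ) k

@[simp] theorem encode_lst (k : ℕ) : Encodable.encode (lst k) = k := Denumerable.encode_ofNat k
@[simp] theorem lst_encode (p : List ℕ) : lst (Encodable.encode p) = p := Denumerable.ofNat_encode p

theorem computable_lst : Computable lst := by
  refine Primrec.to_comp (((Primrec.option_getD.comp (Primrec.decode (α := List ℕ))
    (Primrec.const []))).of_eq fun k => ?_)
  simp [lst, Denumerable.decode_eq_ofNat]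

instance Df.lst_comp {t : γ → ℕ} [h : Df t] : Df fun c => lst (t c) := (Df.of_computable computable_lst).comp h

instance Df.encode_inst {α : Type} [NumDom α] {t : γ → α} [h : Df t] :
    Df fun c => Encodable.encode (t c) := h.encode_comp

instance Df.exList {P : γ → List ℕ → Prop} [h : Df fun p : γ × List ℕ => P p.1 p.2] :
    Df fun c => ∃ k, P c k := by
  have : Df fun p : γ × ℕ => P p.1 (lst p.2) :=
    h.comp (g := fun p : γ × ℕ => (p.1, lst p.2)) inferInstance
  refine Df.of_eq (f := fun c => ∃ k, P c (lst k)) inferInstance fun c => propext ?_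
  exact ⟨fun ⟨k, hk⟩ => ⟨_, hk⟩, fun ⟨p, hp⟩ => ⟨Encodable.encode p, by simpa using hp⟩⟩

instance Df.allList {P : γ → List ℕ → Prop} [h : Df fun p : γ × List ℕ => P p.1 p.2] :
    Df fun c => ∀ k, P c k :=
  Df.of_eq (f := fun c => ¬ ∃ k, ¬ P c k) inferInstance fun c => by simp

theorem Df.of_graph_list {t : γ → List ℕ} (h : Df fun p : γ × List ℕ => p.2 = t p.1) : Df t := by
  have h1 : Df fun p : γ × ℕ => p.2 = Encodable.encode (t p.1) := by
    refine (h.comp (g := fun p : γ × ℕ => (p.1, lst p.2)) inferInstance).of_eq fun p => ?_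
    simp only [eq_iff_iff]
    constructor
    · intro h
      rw [← h, encode_lst]
    · intro h
      rw [h, lst_encode]
  exact Df.iff_graph.2 h1.ar_snd

instance Df.length {t : γ → List ℕ} [ht : Df t] : Df fun c => (t c).length :=
  (Df.of_computable (f := List.length (α := ℕ)) Primrec.list_length.to_comp).comp ht

instance Df.take {n : γ → ℕ} {t : γ → List ℕ} [hn : Df n] [ht : Df t] :
    Df fun c => (t c).take (n c) :=
  Df.of_computable₂ Primrec.list_take.to_comp hn ht

instance Df.getI {n : γ → ℕ} {t : γ → List ℕ} [hn : Df n] [ht : Df t] :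
    Df fun c => (t c).getI (n c) :=
  Df.of_computable₂ Primrec.list_getI.to_comp ht hn

instance Df.append {t u : γ → List ℕ} [ht : Df t] [hu : Df u] : Df fun c => t c ++ u c :=
  Df.of_computable₂ Primrec.list_append.to_comp ht hu

instance Df.singleton {t : γ → ℕ} [ht : Df t] : Df fun c => [t c] :=
  (Df.of_computable (f := fun k : ℕ => [k])
    (Primrec.list_cons.comp Primrec.id (Primrec.const [])).to_comp).comp ht

instance Df.mod {t u : γ → ℕ} [ht : Df t] [hu : Df u] : Df fun c => t c % u c :=
  Df.of_computable₂ (Primrec.nat_mod).to_comp ht hu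

instance Df.sub {t u : γ → ℕ} [ht : Df t] [hu : Df u] : Df fun c => t c - u c :=
  Df.of_computable₂ (Primrec.nat_sub).to_comp ht hu

theorem length_initSeg (x : ℕ → ℕ) (k : ℕ) : (Game.initSeg x k).length = k := by
  simp [Game.initSeg]

theorem getI_initSeg {x : ℕ → ℕ} {k i : ℕ} (h : i < k) : (Game.initSeg x k).getI i = x i := by
  rw [List.getI_eq_getElem _ (by rwa [length_initSeg])]
  simp [Game.initSeg]

theorem eq_initSeg_iff {l : List ℕ} {x : ℕ → ℕ} {k : ℕ} :
    l = Game.initSeg x k ↔ l.length = k ∧ ∀ i < k, l.getI i = x i := by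
  constructor
  · rintro rfl
    exact ⟨length_initSeg x k, fun i hi => getI_initSeg hi⟩
  · rintro ⟨rfl, h⟩
    refine List.ext_getElem (length_initSeg _ _).symm fun i h1 h2 => ?_
    rw [← List.getI_eq_getElem _ h1, ← List.getI_eq_getElem _ h2, h i h1, getI_initSeg h1]

instance Df.initSeg_comp {x : γ → ℕ → ℕ} {t : γ → ℕ} [hx : Df x] [ht : Df t] :
    Df fun c => Game.initSeg (x c) (t c) :=
  Df.comp (f := fun p : (ℕ → ℕ) × ℕ => Game.initSeg p.1 p.2) (g := fun c => (x c, t c))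
    (Df.of_graph_list (Df.of_eq (f := fun p : ((ℕ → ℕ) × ℕ) × List ℕ => p.2.length = p.1.2 ∧
      ∀ i, i < p.1.2 → p.2.getI i = p.1.1 i) inferInstance fun _ => propext eq_initSeg_iff.symm))
    inferInstance

/-- The function with a given graph. -/
noncomputable def fn (X : Set ℕ) (n : ℕ) : ℕ := sInf {k | Nat.pair n k ∈ X}

@[simp] theorem fn_realCode (x : ℕ → ℕ) : fn (realCode x) = x := by
  funext n
  have : {k | Nat.pair n k ∈ realCode x} = {x n} := by
    ext k
    simp only [realCode, Set.mem_ofPred_eq, Nat.pair_eq_pair, Set.mem_singleton_iff]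
    exact ⟨fun ⟨m, h1, h2⟩ => by rw [h2, h1], fun h => ⟨n, rfl, h⟩⟩
  rw [fn, this, csInf_singleton]

instance Df.fn_comp {X : γ → Set ℕ} [h : Df X] : Df fun c => fn (X c) :=
  Df.comp (f := fn) (Df.fun (t := fn) (inferInstanceAs
    (Df fun p : Set ℕ × ℕ => sInf {k | Nat.pair p.2 k ∈ p.1}))) h

/-- The `t`-th function of a sequence of functions. -/
def row (x : ℕ → ℕ) (t n : ℕ) : ℕ := x (Nat.pair t n)

instance Df.row_comp {x : γ → ℕ → ℕ} {t : γ → ℕ} [hx : Df x] [ht : Df t] : Df fun c => row (x c) (t c) :=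
  Df.comp (f := fun p : (ℕ → ℕ) × ℕ => row p.1 p.2) (g := fun c => (x c, t c))
    (Df.fun (t := fun p : (ℕ → ℕ) × ℕ => row p.1 p.2) (inferInstanceAs
      (Df fun p : ((ℕ → ℕ) × ℕ) × ℕ => p.1.1 (Nat.pair p.1.2 p.2)))) inferInstance

/-- The `t`-th set of a sequence of sets. -/
def sect (X : Set ℕ) (t : ℕ) : Set ℕ := {n | Nat.pair t n ∈ X}

instance Df.sect_comp {X : γ → Set ℕ} {t : γ → ℕ} [hX : Df X] [ht : Df t] : Df fun c => sect (X c) (t c) :=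
  Df.comp (f := fun p : Set ℕ × ℕ => sect p.1 p.2) (g := fun c => (X c, t c))
    (inferInstanceAs (Df fun p : Set ℕ × ℕ => {n | Nat.pair p.2 n ∈ p.1})) inferInstance

end

/-! ### Closure properties of `β`-models -/

section

variable {γ δ ε : Type} [Dom γ] [Dom δ] [Dom ε]

theorem Ar.join {ι : Type} {r n : ℕ} {K : ι → Fin r → Set ℕ}
    {A B : (Fin n → ℕ) → ι → Set ℕ} (hA : Ar K (n + 1) fun v c => v 0 ∈ A (Fin.tail v) c)
    (hB : Ar K (n + 1) fun v c => v 0 ∈ B (Fin.tail v) c) :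
    Ar K (n + 1) fun v c => v 0 ∈ join (A (Fin.tail v) c) (B (Fin.tail v) c) := by
  refine ((((hA.rename (Matrix.vecCons 0 (Fin.succ ∘ Fin.succ) : Fin (n + 1) → Fin (n + 2))).and
      (Ar.eq (n := n + 2) (.var 1) (.add (.var 0) (.var 0)))).ex).or
    (((hB.rename (Matrix.vecCons 0 (Fin.succ ∘ Fin.succ) : Fin (n + 1) → Fin (n + 2))).and
      (Ar.eq (n := n + 2) (.var 1) (.add (.add (.var 0) (.var 0)) .one))).ex)).congr fun v c => ?_
  have e : ∀ k, Fin.tail ((Matrix.vecCons k v) ∘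
      (Matrix.vecCons 0 (Fin.succ ∘ Fin.succ) : Fin (n + 1) → Fin (n + 2))) = Fin.tail v :=
    fun k => by
      funext i
      simp [Fin.tail]
  simp only [e, Function.comp, Matrix.cons_val_zero, Term.val, L2.join, Set.mem_ofPred_eq]
  rfl

/-- A definable predicate as a formula. -/
theorem Df.exists_formula {P : γ → Prop} (h : Df P) {n r : ℕ}
    (J : (Fin n → ℕ) → (Fin r → Set ℕ) → Set ℕ)
    (hJ : Ar (fun V : Fin r → Set ℕ => V) (n + 1) fun v V => v 0 ∈ J (Fin.tail v) V) :
    ∃ θ : Formula n r, θ.IsArithmetical ∧ ∀ M v V c, code c = J v V → (θ.Sat M v V ↔ P c) := by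
  obtain ⟨θ, h1, h2⟩ := Df.iff_ar.1 h
  obtain ⟨χ, h3, h4⟩ := Ar.subst θ h1 Fin.elim0 (fun v V (_ : Fin 1) => J v V) fun _ => hJ
  refine ⟨χ, h3, fun M v V c e => (h4 M v V).trans ?_⟩
  have : cd γ c = fun _ => J v V := funext fun _ => e
  have h := h2 Set.univ (v ∘ Fin.elim0) c
  rwa [this] at h

theorem Ar.mem_var {r n : ℕ} (i : Fin r) :
    Ar (fun V : Fin r → Set ℕ => V) (n + 1) fun v V => v 0 ∈ V i := Ar.mem (.var 0) i

variable {M : Set (Set ℕ)}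

/-- The statement ∃ X (X = A V) is Σ¹₁ with parameters in `M` and true, so it holds in `M`; its
arithmetical matrix leaves `A V` as the only possible witness. -/
theorem IsBetaModel.mem_of_ar (hβ : IsBetaModel M) {r : ℕ} {A : (Fin r → Set ℕ) → Set ℕ}
    (hA : Ar (fun V : Fin r → Set ℕ => V) 1 fun v V => v 0 ∈ A V) (V : Fin r → Set ℕ)
    (hV : ∀ i, V i ∈ M) : A V ∈ M := by
  obtain ⟨θ, h1, h2⟩ := hA
  obtain ⟨χ, h3, h4⟩ := Ar.subst (K := fun V : Fin (r + 1) → Set ℕ => V) θ h1 id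
    (fun _ V => Fin.tail V) fun i => Ar.mem (.var 0) i.succ
  let φ : Formula 0 (r + 1) := .allNum (.and (.or (.not (.mem (.var 0) 0)) χ)
    (.or (.not χ) (.mem (.var 0) 0)))
  have hφ : φ.IsArithmetical := ⟨⟨trivial, h3⟩, h3, trivial⟩
  have key : ∀ N X, φ.Sat N ![] (Matrix.vecCons X V) ↔ X = A V := by
    intro N X
    have h5 : ∀ k, χ.Sat N (Matrix.vecCons k ![]) (Matrix.vecCons X V) ↔ k ∈ A V := fun k => by
      exact (h4 _ _ _).trans (h2 _ _ V)
    have : φ.Sat N ![] (Matrix.vecCons X V) ↔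
        ∀ k, (¬ k ∈ X ∨ k ∈ A V) ∧ (¬ k ∈ A V ∨ k ∈ X) :=
      forall_congr' fun k => and_congr (or_congr Iff.rfl (h5 k))
        (or_congr (not_congr (h5 k)) Iff.rfl)
    rw [this, Set.ext_iff]
    exact forall_congr' fun k => by tauto
  obtain ⟨X, hX, h⟩ := (hβ 0 r (.exSet φ) ⟨φ, hφ, rfl⟩ ![] V hV).2
    ⟨A V, trivial, (key _ _).2 rfl⟩
  rwa [← (key _ _).1 h]

theorem IsBetaModel.code_pair (hβ : IsBetaModel M) {c : γ} {d : δ} (hc : code c ∈ M)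
    (hd : code d ∈ M) : code (c, d) ∈ M :=
  hβ.mem_of_ar (r := 2) (A := fun V => join (V 0) (V 1))
    (Ar.join (K := fun V : Fin 2 → Set ℕ => V) (n := 0) (A := fun _ V => V 0) (B := fun _ V => V 1) (Ar.mem_var 0) (Ar.mem_var 1)) ![code c, code d]
    fun i => by fin_cases i <;> assumption

theorem IsBetaModel.code_apply (hβ : IsBetaModel M) {f : γ → δ} (hf : Df f) {c : γ}
    (hc : code c ∈ M) : code (f c) ∈ M := by
  obtain ⟨θ, h1, h2⟩ := hf.out
  have h := hβ.mem_of_ar (r := 1) (A := fun V => {k | θ.Sat Set.univ ![k] V})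
    ((Ar.subst θ h1 id (fun _ V => V) fun i => Ar.mem_var i).congr fun v V => ?_) (cd γ c)
    fun _ => hc
  · convert h using 1
    ext k
    exact (h2 Set.univ ![k] c).symm
  · rw [Set.mem_ofPred_eq, Function.comp_id, show ![v 0] = v from funext fun i => by simp [Subsingleton.elim i 0]]

/-- `Σ¹₁` facts about members of a `β`-model have witnesses in the model. -/
theorem IsBetaModel.exists_real (hβ : IsBetaModel M) {P : γ → (ℕ → ℕ) → Prop}
    (hP : Df fun p : γ × (ℕ → ℕ) => P p.1 p.2) {c : γ} (hc : code c ∈ M) (h : ∃ x, P c x) :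
    ∃ x, code x ∈ M ∧ P c x := by
  have hP' : Df fun p : γ × Set ℕ => P p.1 (fn p.2) :=
    hP.comp (g := fun p : γ × Set ℕ => (p.1, fn p.2)) inferInstance
  obtain ⟨θ, h1, h2⟩ := hP'.exists_formula (n := 0) (r := 2) (fun _ V => join (V 1) (V 0))
    (Ar.join (K := fun V : Fin 2 → Set ℕ => V) (n := 0) (A := fun _ V => V 1) (B := fun _ V => V 0) (Ar.mem_var 1) (Ar.mem_var 0))
  obtain ⟨x, hx⟩ := h
  obtain ⟨X, hX, h⟩ := (hβ 0 1 (.exSet θ) ⟨θ, h1, rfl⟩ ![] ![code c]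
    fun i => by fin_cases i; exact hc).2
    ⟨realCode x, trivial, (h2 _ _ _ (c, realCode x) rfl).2 (by simpa using hx)⟩
  exact ⟨fn X, hβ.code_apply (Df.fn_comp (X := fun X => X)) hX, (h2 _ _ _ (c, X) rfl).1 h⟩

/-- Set quantifiers of the language and quantifiers over reals of `M` are interchangeable, because
`fn` maps `M` to reals in `M` and inverts `realCode`. -/
theorem forall_real (hβ : IsBetaModel M) {Q : (ℕ → ℕ) → Prop} :
    (∀ X ∈ M, Q (fn X)) ↔ ∀ x, code x ∈ M → Q x :=
  ⟨fun h x hx => by simpa using h _ (show realCode x ∈ M from hx), fun h X hX => h _ (hβ.code_apply (Df.fn_comp (X := fun X => X)) hX)⟩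

theorem exists_real (hβ : IsBetaModel M) {Q : (ℕ → ℕ) → Prop} :
    (∃ X ∈ M, Q (fn X)) ↔ ∃ x, code x ∈ M ∧ Q x :=
  ⟨fun ⟨X, hX, h⟩ => ⟨_, hβ.code_apply (Df.fn_comp (X := fun X => X)) hX, h⟩,
    fun ⟨x, hx, h⟩ => ⟨realCode x, hx, by simpa using h⟩⟩

theorem Df.exists_matrix {P : γ → ℕ → Set ℕ → (ℕ → ℕ) → (ℕ → ℕ) → Prop}
    (hP : Df fun p : (((γ × ℕ) × Set ℕ) × (ℕ → ℕ)) × (ℕ → ℕ) => P p.1.1.1.1 p.1.1.1.2 p.1.1.2 p.1.2 p.2) :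
    ∃ θ : Formula 1 4, θ.IsArithmetical ∧ ∀ M k X Y Z c,
      θ.Sat M ![k] ![Z, Y, X, code c] ↔ P c k X (fn Y) (fn Z) := by
  have hP' : Df fun p : (((γ × ℕ) × Set ℕ) × Set ℕ) × Set ℕ =>
      P p.1.1.1.1 p.1.1.1.2 p.1.1.2 (fn p.1.2) (fn p.2) :=
    hP.comp (g := fun p : (((γ × ℕ) × Set ℕ) × Set ℕ) × Set ℕ =>
      (((p.1.1.1, p.1.1.2), fn p.1.2), fn p.2)) inferInstance
  obtain ⟨θ, h1, h2⟩ := hP'.exists_formula (n := 1) (r := 4)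
    (fun v V => join (join (join (join (V 3) {v 0}) (V 2)) (V 1)) (V 0))
    (Ar.join (K := fun V : Fin 4 → Set ℕ => V) (n := 1) (A := fun v V => join (join (join (V 3) {v 0}) (V 2)) (V 1)) (B := fun _ V => V 0)
      (Ar.join (K := fun V : Fin 4 → Set ℕ => V) (n := 1) (A := fun v V => join (join (V 3) {v 0}) (V 2)) (B := fun _ V => V 1)
        (Ar.join (K := fun V : Fin 4 → Set ℕ => V) (n := 1) (A := fun v V => join (V 3) {v 0}) (B := fun _ V => V 2)
          (Ar.join (K := fun V : Fin 4 → Set ℕ => V) (n := 1) (A := fun _ V => V 3) (B := fun v _ => {v 0}) (Ar.mem_var 3)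
            (Ar.eq (.var 0) (.var 1))) (Ar.mem_var 2)) (Ar.mem_var 1)) (Ar.mem_var 0))
  exact ⟨θ, h1, fun M k X Y Z c => h2 M ![k] ![Z, Y, X, code c] ((((c, k), X), Y), Z) rfl⟩

/-- Monotone induction for operators given by definable matrices. -/
theorem SatisfiesPi12MI.exists_prewellorder (hMI : SatisfiesPi12MI M) (hβ : IsBetaModel M)
    {P : γ → ℕ → Set ℕ → (ℕ → ℕ) → (ℕ → ℕ) → Prop}
    (hP : Df fun p : (((γ × ℕ) × Set ℕ) × (ℕ → ℕ)) × (ℕ → ℕ) => P p.1.1.1.1 p.1.1.1.2 p.1.1.2 p.1.2 p.2)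
    {c : γ} (hc : code c ∈ M) {Φ : Set ℕ → Set ℕ}
    (hΦ : ∀ X k, k ∈ Φ X ↔ ∀ x, code x ∈ M → ∃ y, code y ∈ M ∧ P c k X x y)
    (hmono : ∀ X ∈ M, ∀ Y ∈ M, X ⊆ Y → Φ X ⊆ Φ Y) :
    ∃ F ∈ M, ∃ R ∈ M, IsStagePrewellorder M Φ F R := by
  obtain ⟨θ, h1, h2⟩ := hP.exists_matrix
  have e : operator M (.allSet (.exSet θ)) ![] ![code c] = Φ := by
    funext X
    ext k
    rw [hΦ, ← forall_real hβ]
    simp only [← exists_real hβ]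
    exact forall₂_congr fun Y _ => exists_congr fun Z => and_congr_right fun _ => h2 M k X Y Z c
  rw [← e] at hmono ⊢
  exact hMI 0 1 (.allSet (.exSet θ)) ⟨θ, h1, rfl⟩ ![] ![code c]
    (fun i => by fin_cases i; exact hc) hmono

/-- `Π¹₂` comprehension. -/
theorem SatisfiesPi12MI.comprehension (hMI : SatisfiesPi12MI M) (hβ : IsBetaModel M)
    {P : γ → ℕ → (ℕ → ℕ) → (ℕ → ℕ) → Prop}
    (hP : Df fun p : ((γ × ℕ) × (ℕ → ℕ)) × (ℕ → ℕ) => P p.1.1.1 p.1.1.2 p.1.2 p.2)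
    {c : γ} (hc : code c ∈ M) :
    {k | ∀ x, code x ∈ M → ∃ y, code y ∈ M ∧ P c k x y} ∈ M := by
  have hP' : Df fun p : (((γ × ℕ) × Set ℕ) × (ℕ → ℕ)) × (ℕ → ℕ) =>
      P p.1.1.1.1 p.1.1.1.2 p.1.2 p.2 :=
    hP.comp (g := fun p : (((γ × ℕ) × Set ℕ) × (ℕ → ℕ)) × (ℕ → ℕ) =>
      ((p.1.1.1, p.1.2), p.2)) inferInstance
  -- The operator is constant, so its least fixed point is the set to be comprehended.
  obtain ⟨F, hF, R, -, h⟩ := hMI.exists_prewellorder hβ (P := fun c k _ x y => P c k x y) hP' hc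
    (Φ := fun _ => {k | ∀ x, code x ∈ M → ∃ y, code y ∈ M ∧ P c k x y}) (fun _ _ => Iff.rfl)
    (fun _ _ _ _ _ => le_rfl)
  convert hF
  refine Set.Subset.antisymm h.closed fun k hk => ?_
  -- An element of the field does not precede itself, so it was contributed by the operator at its
  -- own stage.
  have := (h.stage k hk).symm.subset ⟨hk, h.irrefl k⟩
  exact this.resolve_right (h.irrefl k)

/-- `Σ¹₂` comprehension. -/
theorem SatisfiesPi12MI.comprehension' (hMI : SatisfiesPi12MI M) (hβ : IsBetaModel M)
    {P : γ → ℕ → (ℕ → ℕ) → (ℕ → ℕ) → Prop}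
    (hP : Df fun p : ((γ × ℕ) × (ℕ → ℕ)) × (ℕ → ℕ) => P p.1.1.1 p.1.1.2 p.1.2 p.2)
    {c : γ} (hc : code c ∈ M) :
    {k | ∃ x, code x ∈ M ∧ ∀ y, code y ∈ M → P c k x y} ∈ M := by
  have h := hMI.comprehension hβ (P := fun c k x y => ¬ P c k x y)
    (Df.not (h := hP)) hc
  have h' := hβ.code_apply (γ := Set ℕ) (δ := Set ℕ) (f := fun X => {k | ¬ k ∈ X}) inferInstance
    (c := {k | ∀ x, code x ∈ M → ∃ y, code y ∈ M ∧ ¬ P c k x y}) h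
  convert h' using 1
  change _ = {k | ¬ ∀ x, code x ∈ M → ∃ y, code y ∈ M ∧ ¬ P c k x y}
  simp

/-- The `Σ¹₃` formula with a given definable matrix. -/
theorem Df.sigma13 (hβ : IsBetaModel M) {P : γ → ℕ → Set ℕ → (ℕ → ℕ) → (ℕ → ℕ) → Prop}
    (hP : Df fun p : (((γ × ℕ) × Set ℕ) × (ℕ → ℕ)) × (ℕ → ℕ) => P p.1.1.1.1 p.1.1.1.2 p.1.1.2 p.1.2 p.2) :
    ∃ φ : Formula 1 1, φ.IsSigma13 ∧ ∀ k c, φ.Sat M ![k] ![code c] ↔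
      ∃ S ∈ M, ∀ x, code x ∈ M → ∃ y, code y ∈ M ∧ P c k S x y := by
  obtain ⟨θ, h1, h2⟩ := hP.exists_matrix
  refine ⟨.exSet (.allSet (.exSet θ)), ⟨θ, h1, rfl⟩, fun k c => ?_⟩
  refine exists_congr fun S => and_congr_right fun _ => ?_
  rw [← forall_real hβ]
  simp only [← exists_real hβ]
  exact forall₂_congr fun Y _ => exists_congr fun Z => and_congr_right fun _ => h2 M k S Y Z c

/-- The `Π¹₃` formula with a given definable matrix. -/
theorem Df.pi13 (hβ : IsBetaModel M) {P : γ → ℕ → Set ℕ → (ℕ → ℕ) → (ℕ → ℕ) → Prop}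
    (hP : Df fun p : (((γ × ℕ) × Set ℕ) × (ℕ → ℕ)) × (ℕ → ℕ) => P p.1.1.1.1 p.1.1.1.2 p.1.1.2 p.1.2 p.2) :
    ∃ φ : Formula 1 1, φ.IsPi13 ∧ ∀ k c, φ.Sat M ![k] ![code c] ↔
      ¬ ∃ S ∈ M, ∀ x, code x ∈ M → ∃ y, code y ∈ M ∧ P c k S x y := by
  obtain ⟨θ, h1, h2⟩ := (Df.not (h := hP)).exists_matrix
    (P := fun c k X x y => ¬ P c k X x y)
  refine ⟨.allSet (.exSet (.allSet θ)), ⟨θ, h1, rfl⟩, fun k c => ?_⟩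
  push Not
  refine forall₂_congr fun S _ => ?_
  rw [← exists_real hβ (Q := fun x => ∀ y, code y ∈ M → ¬ P c k S x y)]
  simp only [← forall_real hβ]
  exact exists_congr fun Y => and_congr_right fun _ => forall₂_congr fun Z _ => h2 M k S Y Z c

end

/-! ### Uniformization of `Π¹₁` relations in a `β`-model -/

section Kondo

variable (G : (ℕ → ℕ) → List ℕ → Prop)

/-- The node `s'` is an immediate successor of `s` in the tree given by `X`. -/
def Child (X : ℕ → ℕ) (s' s : List ℕ) : Prop := ∃ a, s' = s ++ [a] ∧ G X s'

theorem initSeg_succ (x : ℕ → ℕ) (k : ℕ) : Game.initSeg x (k + 1) = Game.initSeg x k ++ [x k] := by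
  simp [Game.initSeg, List.range_succ]

variable {G}

theorem child_chain {X : ℕ → ℕ} {f : ℕ → List ℕ} (hf : ∀ n, Child G X (f (n + 1)) (f n)) (n : ℕ) :
    (f n).length = (f 0).length + n ∧ ∀ m, n ≤ m → f n <+: f m := by
  constructor
  · induction n with
    | zero => rfl
    | succ n ih =>
      obtain ⟨a, h, -⟩ := hf n
      rw [h, List.length_append, ih]
      rfl
  · intro m h
    induction m, h using Nat.le_induction with
    | base => exact List.prefix_rfl
    | succ m _ ih =>
      obtain ⟨a, h, -⟩ := hf m
      exact ih.trans ⟨[a], h.symm⟩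

theorem of_prefix (hcl : ∀ X s a, G X (s ++ [a]) → G X s) {X : ℕ → ℕ} {s s' : List ℕ}
    (h : s <+: s') (h' : G X s') : G X s := by
  obtain ⟨r, rfl⟩ := h
  induction r using List.reverseRecOn with
  | nil => simpa using h'
  | append_singleton r a ih => exact ih (hcl _ _ a (by simpa using h'))

/-- A tree is well-founded if and only if it has no infinite branch. -/
theorem wellFounded_child_iff (hcl : ∀ X s a, G X (s ++ [a]) → G X s) {X : ℕ → ℕ} :
    WellFounded (Child G X) ↔ ∀ y, ∃ k, ¬ G X (Game.initSeg y k) := by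
  constructor
  · intro h y
    by_contra! hy
    exact (wellFounded_iff_isEmpty_descending_chain.1 h).false
      ⟨fun k => Game.initSeg y k, fun k => ⟨y k, initSeg_succ y k, hy _⟩⟩
  · intro h
    refine wellFounded_iff_isEmpty_descending_chain.2 ⟨fun ⟨f, hf⟩ => ?_⟩
    obtain ⟨k, hk⟩ := h fun i => (f (i + 1)).getI i
    refine hk ?_
    have : Game.initSeg (fun i => (f (i + 1)).getI i) k <+: f (k + 1) := by
      have hl := (child_chain hf (k + 1)).1
      rw [show Game.initSeg (fun i => (f (i + 1)).getI i) k = (f (k + 1)).take k from ?_]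
      · exact List.take_prefix _ _
      · symm
        rw [eq_initSeg_iff]
        refine ⟨by rw [List.length_take]; omega, fun i hi => ?_⟩
        have h1 := (child_chain hf (i + 1)).1
        obtain ⟨r, hr⟩ := (child_chain hf (i + 1)).2 (k + 1) (by omega)
        rw [List.getI_eq_getElem _ (by rw [List.length_take]; omega),
          List.getI_eq_getElem _ (by omega), List.getElem_take]
        simp only [← hr]
        rw [List.getElem_append_left]
    refine of_prefix hcl this ?_
    exact (hf k).choose_spec.2

variable (G)

open Classical in
/-- The rank of a node of a well-founded tree. -/
noncomputable def rk (X : ℕ → ℕ) (s : List ℕ) : Ordinal :=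
  if h : WellFounded (Child G X) then (h.apply s).rank else 0

/-- A simulation of the tree of `Y` by the tree of `X`. -/
def Sim (Y X z : ℕ → ℕ) : Prop :=
  ∀ s s' : List ℕ, z (Nat.pair (Encodable.encode s) (Encodable.encode s')) = 0 →
    ∀ a, G Y (s ++ [a]) → ∃ b, G X (s' ++ [b]) ∧
      z (Nat.pair (Encodable.encode (s ++ [a])) (Encodable.encode (s' ++ [b]))) = 0

/-- The simulation `z` witnesses that `Y` is less than `X` in the first `i` values and ranks. -/
def Less (i : ℕ) (Y X z : ℕ → ℕ) : Prop :=
  Sim G Y X z ∧ ∃ j, j < i ∧ (∀ j', j' < j → Y j' = X j' ∧ z (Nat.pair j' j') = 0) ∧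
    ((∃ b, G X (lst j ++ [b]) ∧ z (Nat.pair j (Encodable.encode (lst j ++ [b]))) = 0) ∨
      (z (Nat.pair j j) = 0 ∧ Y j < X j))

/-- `Y` is less than `X` in the first `i` values and ranks. -/
def LexLess (i : ℕ) (Y X : ℕ → ℕ) : Prop :=
  ∃ j, j < i ∧ (∀ j', j' < j → Y j' = X j' ∧ rk G Y (lst j') ≤ rk G X (lst j')) ∧
    (rk G Y (lst j) < rk G X (lst j) ∨ (rk G Y (lst j) ≤ rk G X (lst j) ∧ Y j < X j))

variable {G}

theorem rk_lt_of_child {X : ℕ → ℕ} (h : WellFounded (Child G X)) {s' s : List ℕ}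
    (hs : Child G X s' s) : rk G X s' < rk G X s := by
  rw [rk, rk, dif_pos h, dif_pos h]
  exact Acc.rank_lt_of_rel _ hs

theorem exists_child_of_lt_rk {X : ℕ → ℕ} (h : WellFounded (Child G X)) {s : List ℕ} {o : Ordinal}
    (ho : o < rk G X s) : ∃ s', Child G X s' s ∧ o ≤ rk G X s' := by
  rw [rk, dif_pos h, Acc.rank_eq, Ordinal.lt_iSup_iff] at ho
  obtain ⟨⟨s', hs'⟩, h1⟩ := ho
  refine ⟨s', hs', ?_⟩
  rw [rk, dif_pos h]
  exact Order.lt_succ_iff.1 h1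

theorem rk_le_of_sim {X Y z : ℕ → ℕ} (hX : WellFounded (Child G X)) (hY : WellFounded (Child G Y))
    (hz : Sim G Y X z) {s s' : List ℕ}
    (h : z (Nat.pair (Encodable.encode s) (Encodable.encode s')) = 0) : rk G Y s ≤ rk G X s' := by
  induction s' using hX.induction generalizing s with
  | _ s' ih =>
    by_contra! hlt
    obtain ⟨_, ⟨a, rfl, ha⟩, h1⟩ := exists_child_of_lt_rk hY hlt
    obtain ⟨b, hb, h2⟩ := hz s s' h a ha
    exact absurd ((h1.trans (ih _ ⟨b, rfl, hb⟩ h2)).trans_lt (rk_lt_of_child hX ⟨b, rfl, hb⟩))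
      (lt_irrefl _)

/-- Unlike the comparison of ranks, this assumes nothing about the tree of `Y`: a simulation into a
well-founded tree transports well-foundedness. This lets a single Σ¹₁ statement express both that
`Y` qualifies and that it is smaller. -/
theorem acc_of_sim {X Y z : ℕ → ℕ} (hX : WellFounded (Child G X))
    (hz : Sim G Y X z) {s s' : List ℕ}
    (h : z (Nat.pair (Encodable.encode s) (Encodable.encode s')) = 0) : Acc (Child G Y) s := by
  induction s' using hX.induction generalizing s with
  | _ s' ih =>
    refine Acc.intro _ ?_
    rintro _ ⟨a, rfl, ha⟩
    obtain ⟨b, hb, h2⟩ := hz s s' h a ha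
    exact ih _ ⟨b, rfl, hb⟩ h2

theorem wellFounded_child_of_acc (hcl : ∀ X s a, G X (s ++ [a]) → G X s) {Y : ℕ → ℕ}
    (h : Acc (Child G Y) []) : WellFounded (Child G Y) := by
  rw [wellFounded_child_iff hcl]
  intro y
  by_contra! hy
  exact (acc_iff_isEmpty_descending_chain.1 h).false
      ⟨fun k => Game.initSeg y k, rfl, fun k => ⟨y k, initSeg_succ y k, hy _⟩⟩

/-- Ordinal ranks are not available to second order formulas. Against a well-founded tree, rank
comparison is equivalent to the existence of a simulation, which makes "a qualifying `Y` is smaller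
than `X`" a Σ¹₁ condition. -/
theorem exists_less_iff (hcl : ∀ X s a, G X (s ++ [a]) → G X s) {i : ℕ} {Y X : ℕ → ℕ}
    (hX : WellFounded (Child G X)) :
    (∃ z, Less G i Y X z) ↔ WellFounded (Child G Y) ∧ LexLess G i Y X := by
  constructor
  · rintro ⟨z, hz, j, hj, h1, h2⟩
    have hY : WellFounded (Child G Y) := by
      refine wellFounded_child_of_acc hcl ?_
      -- The root has number 0, so coordinate 0 of the comparison already simulates the root of the
      -- tree of `Y`.
      have e0 : Encodable.encode ([] : List ℕ) = 0 := rfl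
      rcases Nat.eq_zero_or_pos j with rfl | hj
      · rcases h2 with ⟨b, -, h⟩ | ⟨h, -⟩
        · exact acc_of_sim (s' := lst 0 ++ [b]) hX hz (by rwa [e0])
        · exact acc_of_sim (s' := []) hX hz (by rwa [e0])
      · exact acc_of_sim (s' := []) hX hz (by rw [e0]; exact (h1 0 hj).2)
    have key : ∀ j', z (Nat.pair j' j') = 0 → rk G Y (lst j') ≤ rk G X (lst j') := fun j' h =>
      rk_le_of_sim hX hY hz (by rwa [encode_lst])
    refine ⟨hY, j, hj, fun j' hj' => ⟨(h1 j' hj').1, key _ (h1 j' hj').2⟩, h2.imp ?_ ?_⟩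
    · rintro ⟨b, hb, h⟩
      exact (rk_le_of_sim hX hY hz (by rwa [encode_lst])).trans_lt (rk_lt_of_child hX ⟨b, rfl, hb⟩)
    · exact fun h => ⟨key _ h.1, h.2⟩
  · classical
    rintro ⟨hY, j, hj, h1, h2⟩
    -- The largest simulation relates two nodes exactly when their ranks compare.
    refine ⟨fun m => if rk G Y (lst (Nat.unpair m).1) ≤ rk G X (lst (Nat.unpair m).2) then 0 else 1,
      ?_, j, hj, fun j' hj' => ⟨(h1 j' hj').1, by simp [(h1 j' hj').2]⟩, h2.imp ?_ ?_⟩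
    · intro s s' h a ha
      have h : rk G Y s ≤ rk G X s' := by
        by_contra h'
        simp [h'] at h
      obtain ⟨_, ⟨b, rfl, hb⟩, h3⟩ := exists_child_of_lt_rk hX
        ((rk_lt_of_child hY ⟨a, rfl, ha⟩).trans_le h)
      exact ⟨b, hb, by simp [h3]⟩
    · intro h
      obtain ⟨_, ⟨b, rfl, hb⟩, h3⟩ := exists_child_of_lt_rk hX h
      exact ⟨b, hb, by simp [h3]⟩
    · exact fun h => ⟨by simp [h.1], h.2⟩

variable (G) in
/-- `X` is minimal in the first `i` values and ranks among the members of `K` with a well-founded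
tree. -/
def IsLexMin (K : Set (ℕ → ℕ)) (i : ℕ) (X : ℕ → ℕ) : Prop :=
  X ∈ K ∧ WellFounded (Child G X) ∧ ∀ Y ∈ K, WellFounded (Child G Y) → ¬ LexLess G i Y X

variable {K : Set (ℕ → ℕ)}

theorem IsLexMin.mono {i i' : ℕ} (h : i ≤ i') {X : ℕ → ℕ} (hX : IsLexMin G K i' X) :
    IsLexMin G K i X :=
  ⟨hX.1, hX.2.1, fun Y hY hY' ⟨j, hj, h'⟩ => hX.2.2 Y hY hY' ⟨j, hj.trans_le h, h'⟩⟩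

/-- At each coordinate the order compares ranks first and values second, and this is linear; two
minimal functions therefore tie everywhere. Consequently the limit of minimal functions has uniquely
determined values. -/
theorem IsLexMin.agree {i : ℕ} {X Y : ℕ → ℕ} (hX : IsLexMin G K i X) (hY : IsLexMin G K i Y) {j : ℕ}
    (hj : j < i) : Y j = X j ∧ rk G Y (lst j) = rk G X (lst j) := by
  induction j using Nat.strong_induction_on with
  | _ j ih =>
    have h1 := hX.2.2 Y hY.1 hY.2.1
    have h2 := hY.2.2 X hX.1 hX.2.1
    have h3 : rk G Y (lst j) = rk G X (lst j) := by
      refine le_antisymm (not_lt.1 fun h => h2 ⟨j, hj, fun j' hj' => ?_, Or.inl h⟩)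
        (not_lt.1 fun h => h1 ⟨j, hj, fun j' hj' => ?_, Or.inl h⟩)
      · exact ⟨(ih j' hj' (hj'.trans hj)).1.symm, (ih j' hj' (hj'.trans hj)).2.ge⟩
      · exact ⟨(ih j' hj' (hj'.trans hj)).1, (ih j' hj' (hj'.trans hj)).2.le⟩
    refine ⟨le_antisymm
      (not_lt.1 fun h => h2 ⟨j, hj, fun j' hj' => ?_, Or.inr ⟨h3.ge, h⟩⟩)
      (not_lt.1 fun h => h1 ⟨j, hj, fun j' hj' => ?_, Or.inr ⟨h3.le, h⟩⟩), h3⟩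
    · exact ⟨(ih j' hj' (hj'.trans hj)).1.symm, (ih j' hj' (hj'.trans hj)).2.ge⟩
    · exact ⟨(ih j' hj' (hj'.trans hj)).1, (ih j' hj' (hj'.trans hj)).2.le⟩

theorem exists_isLexMin (h : ∃ X ∈ K, WellFounded (Child G X)) (i : ℕ) :
    ∃ X, IsLexMin G K i X := by
  induction i with
  | zero =>
    obtain ⟨X, hX, hX'⟩ := h
    exact ⟨X, hX, hX', fun Y _ _ ⟨j, hj, _⟩ => absurd hj (Nat.not_lt_zero j)⟩
  | succ i ih =>
    -- Among the functions minimal in the first i coordinates, take one with the least pair of the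
    -- rank of node i and the value at i.
    obtain ⟨X, hX, hmin⟩ := (InvImage.wf (fun X => toLex (rk G X (lst i), X i))
      (wellFounded_lt : WellFounded ((· < ·) : Ordinal ×ₗ ℕ → _ → _))).has_min
      {X | IsLexMin G K i X} ih
    refine ⟨X, hX.1, hX.2.1, fun Y hY hY' => ?_⟩
    rintro ⟨j, hj, h1, h2⟩
    rcases Nat.lt_succ_iff_lt_or_eq.1 hj with hj | rfl
    · exact hX.2.2 Y hY hY' ⟨j, hj, h1, h2⟩
    · refine hmin Y ⟨hY, hY', fun Y' hY1 hY2 => ?_⟩ ?_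
      · rintro ⟨j', hj', h3, h4⟩
        refine hX.2.2 Y' hY1 hY2 ⟨j', hj', fun j'' hj'' => ?_, ?_⟩
        · exact ⟨(h3 j'' hj'').1.trans (h1 _ (hj''.trans hj')).1,
            (h3 j'' hj'').2.trans (h1 _ (hj''.trans hj')).2⟩
        · rcases h4 with h4 | ⟨h4, h5⟩
          · exact Or.inl (h4.trans_le (h1 j' hj').2)
          · exact Or.inr ⟨h4.trans (h1 j' hj').2, (h1 j' hj').1 ▸ h5⟩
      · rw [InvImage, Prod.Lex.toLex_lt_toLex]
        rcases h2 with h2 | ⟨h2, h3⟩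
        · exact Or.inl h2
        · exact h2.lt_or_eq.imp_right fun h => ⟨h, h3⟩

/-- The limit of lexicographically minimal functions has a well-founded tree. -/
theorem wellFounded_child_limit
    (hcont : ∀ X s, ∃ k, ∀ Y, (∀ i < k, Y i = X i) → (G X s ↔ G Y s))
    (h : ∃ X ∈ K, WellFounded (Child G X)) {Z : ℕ → ℕ}
    (hZ : ∀ j X, IsLexMin G K (j + 1) X → Z j = X j) : WellFounded (Child G Z) := by
  choose X hX using exists_isLexMin (G := G) (K := K) h
  -- The limit tree is ranked by assigning to each node the rank that it has for all sufficiently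
  -- minimal functions.
  refine Subrelation.wf (r := InvImage (· < ·) fun s => rk G (X (Encodable.encode s + 1)) s) ?_
    (InvImage.wf _ wellFounded_lt)
  rintro s' s ⟨a, rfl, hs⟩
  obtain ⟨k, hk⟩ := hcont Z (s ++ [a])
  -- Beyond this index `X i` agrees with `Z` far enough to decide the child node, and its ranks at
  -- both nodes are final.
  set i := k + (Encodable.encode s + 1) + (Encodable.encode (s ++ [a]) + 1) with hi
  have h1 : G (X i) (s ++ [a]) := by
    refine (hk _ fun j hj => ?_).1 hs
    exact (hZ j _ ((hX i).mono (by omega))).symm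
  have h2 : ∀ s, Encodable.encode s + 1 ≤ i → rk G (X i) s = rk G (X (Encodable.encode s + 1)) s :=
    fun s hs => by simpa using ((hX _).agree ((hX i).mono hs) (Nat.lt_succ_self _)).2
  change rk G _ _ < rk G _ _
  rw [← h2 _ (by omega), ← h2 _ (by omega)]
  exact rk_lt_of_child (hX i).2.1 ⟨a, rfl, h1⟩

end Kondo

/-! ### A uniform choice of witnesses inside the model. -/

section Uniformization

variable {γ : Type} [Dom γ] {M : Set (Set ℕ)}

/-- The sequence that consists of three functions. -/
def triple (x y z : ℕ → ℕ) (n : ℕ) : ℕ :=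
  if (Nat.unpair n).1 = 0 then x (Nat.unpair n).2 else
    if (Nat.unpair n).1 = 1 then y (Nat.unpair n).2 else z (Nat.unpair n).2

theorem row_triple (x y z : ℕ → ℕ) :
    row (triple x y z) 0 = x ∧ row (triple x y z) 1 = y ∧ row (triple x y z) 2 = z := by
  refine ⟨?_, ?_, ?_⟩ <;> funext n <;> simp [row, triple]

theorem Df.triple : Df fun p : ((ℕ → ℕ) × (ℕ → ℕ)) × (ℕ → ℕ) => triple p.1.1 p.1.2 p.2 :=
  Df.fun (t := fun p : ((ℕ → ℕ) × (ℕ → ℕ)) × (ℕ → ℕ) => L2.triple p.1.1 p.1.2 p.2) (inferInstanceAs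
    (Df fun q : (((ℕ → ℕ) × (ℕ → ℕ)) × (ℕ → ℕ)) × ℕ =>
      if (Nat.unpair q.2).1 = 0 then q.1.1.1 (Nat.unpair q.2).2 else
        if (Nat.unpair q.2).1 = 1 then q.1.1.2 (Nat.unpair q.2).2 else q.1.2 (Nat.unpair q.2).2))

variable {G : γ → ℕ → (ℕ → ℕ) → List ℕ → Prop}

theorem Df.less (hG : Df fun p : ((γ × ℕ) × (ℕ → ℕ)) × List ℕ => G p.1.1.1 p.1.1.2 p.1.2 p.2) :
    Df fun p : ((((γ × ℕ) × ℕ) × (ℕ → ℕ)) × (ℕ → ℕ)) × (ℕ → ℕ) =>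
      Less (G p.1.1.1.1.1 p.1.1.1.1.2) p.1.1.1.2 p.1.1.2 p.1.2 p.2 := by
  have hG' : ∀ {δ : Type} [Dom δ] {c : δ → γ} {t : δ → ℕ} {X : δ → ℕ → ℕ} {s : δ → List ℕ}
      [Df c] [Df t] [Df X] [Df s], Df fun d => G (c d) (t d) (X d) (s d) := by
    intro δ _ c t X s _ _ _ _
    exact hG.comp (g := fun d => (((c d, t d), X d), s d)) inferInstance
  unfold Less Sim
  infer_instance

/-- `G c t X` is a tree that depends continuously on `X`; its well-foundedness is the Π¹₁ condition
to be uniformized. The value of `row Z t` at j is the common value there of all functions of `M`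
minimal in the first j + 1 coordinates. The graph is Σ¹₂ over `M`, and the limit satisfies the
condition by `wellFounded_child_limit`. -/
theorem SatisfiesPi12MI.exists_uniformization (hMI : SatisfiesPi12MI M) (hβ : IsBetaModel M)
    (hG : Df fun p : ((γ × ℕ) × (ℕ → ℕ)) × List ℕ => G p.1.1.1 p.1.1.2 p.1.2 p.2)
    (hcl : ∀ c t X s a, G c t X (s ++ [a]) → G c t X s)
    (hcont : ∀ c t X s, ∃ k, ∀ Y, (∀ i < k, Y i = X i) → (G c t X s ↔ G c t Y s))
    {c : γ} (hc : code c ∈ M) :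
    ∃ Z : ℕ → ℕ, code Z ∈ M ∧ ∀ t,
      (∃ X : ℕ → ℕ, code X ∈ M ∧ ∀ y, ∃ k, ¬ G c t X (Game.initSeg y k)) →
        ∀ y, ∃ k, ¬ G c t (row Z t) (Game.initSeg y k) := by
  have hG' : ∀ {δ : Type} [Dom δ] {c : δ → γ} {t : δ → ℕ} {X : δ → ℕ → ℕ} {s : δ → List ℕ}
      [Df c] [Df t] [Df X] [Df s], Df fun d => G (c d) (t d) (X d) (s d) := by
    intro δ _ c t X s _ _ _ _
    exact hG.comp (g := fun d => (((c d, t d), X d), s d)) inferInstance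
  have hL := Df.less hG
  have hL' : ∀ {δ : Type} [Dom δ] {c : δ → γ} {t i : δ → ℕ} {Y X z : δ → ℕ → ℕ}
      [Df c] [Df t] [Df i] [Df Y] [Df X] [Df z],
      Df fun d => Less (G (c d) (t d)) (i d) (Y d) (X d) (z d) := by
    intro δ _ c t i Y X z _ _ _ _ _ _
    exact hL.comp (g := fun d => (((((c d, t d), i d), Y d), X d), z d)) inferInstance
  have hcode : ∀ k : ℕ, code k ∈ M := fun k => hβ.code_apply (Df.const (γ := γ) k) hc
  let K : Set (ℕ → ℕ) := {X | code X ∈ M}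
  -- Here m codes ((t, j), a). The single universal real `W` carries three challenges: a branch
  -- through the tree of `X`, a competitor, and a simulation showing the competitor smaller.
  let P : γ → ℕ → (ℕ → ℕ) → (ℕ → ℕ) → Prop := fun c m X W =>
    (∃ k, ¬ G c (Nat.unpair (Nat.unpair m).1).1 X (Game.initSeg (row W 0) k)) ∧
    ¬ Less (G c (Nat.unpair (Nat.unpair m).1).1) ((Nat.unpair (Nat.unpair m).1).2 + 1)
      (row W 1) X (row W 2) ∧ X (Nat.unpair (Nat.unpair m).1).2 = (Nat.unpair m).2
  have hP : Df fun p : ((γ × ℕ) × (ℕ → ℕ)) × (ℕ → ℕ) => P p.1.1.1 p.1.1.2 p.1.2 p.2 := by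
    unfold P
    infer_instance
  have hD := hMI.comprehension' hβ hP hc
  set D := {k | ∃ x, code x ∈ M ∧ ∀ y, code y ∈ M → P c k x y} with hDdef
  have key : ∀ t j a, Nat.pair (Nat.pair t j) a ∈ D ↔
      ∃ X, IsLexMin (G c t) K (j + 1) X ∧ X j = a := by
    intro t j a
    rw [hDdef, Set.mem_ofPred_eq]
    refine exists_congr fun X => ?_
    simp only [P, Nat.unpair_pair]
    constructor
    · rintro ⟨hX, h⟩
      have h' : ∀ x y z : ℕ → ℕ, code x ∈ M → code y ∈ M → code z ∈ M →
          (∃ k, ¬ G c t X (Game.initSeg x k)) ∧ ¬ Less (G c t) (j + 1) y X z ∧ X j = a := by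
        intro x y z hx hy hz
        have h1 := h (triple x y z) (hβ.code_apply Df.triple
          (hβ.code_pair (hβ.code_pair hx hy) hz))
        obtain ⟨e1, e2, e3⟩ := row_triple x y z
        rwa [e1, e2, e3] at h1
      have hw : WellFounded (Child (G c t) X) := by
        rw [wellFounded_child_iff (hcl c t)]
        by_contra! hy
        -- A true infinite branch would give one in `M`, so well-foundedness tested in `M` is
        -- genuine.
        obtain ⟨y, hy1, hy2⟩ := hβ.exists_real
          (P := fun (d : (γ × ℕ) × (ℕ → ℕ)) y => ∀ k, G d.1.1 d.1.2 d.2 (Game.initSeg y k))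
          inferInstance (c := ((c, t), X)) (hβ.code_pair (hβ.code_pair hc (hcode t)) hX) hy
        obtain ⟨k, hk⟩ := (h' y X X hy1 hX hX).1
        exact hk (hy2 k)
      refine ⟨⟨hX, hw, fun Y hY hY' hlt => ?_⟩, (h' X X X hX hX hX).2.2⟩
      obtain ⟨z, hz1, hz2⟩ := hβ.exists_real
        (P := fun (d : (((γ × ℕ) × ℕ) × (ℕ → ℕ)) × (ℕ → ℕ)) z =>
          Less (G d.1.1.1.1 d.1.1.1.2) d.1.1.2 d.1.2 d.2 z) inferInstance
          (c := ((((c, t), j + 1), Y), X))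
          (hβ.code_pair (hβ.code_pair (hβ.code_pair (hβ.code_pair hc (hcode t)) (hcode _)) hY) hX)
          ((exists_less_iff (hcl c t) hw).2 ⟨hY', hlt⟩)
      exact (h' X Y z hX hY hz1).2.1 hz2
    · rintro ⟨⟨hX, hw, hmin⟩, ha⟩
      refine ⟨hX, fun W hW => ⟨(wellFounded_child_iff (hcl c t)).1 hw _, fun hless => ?_, ha⟩⟩
      obtain ⟨h1, h2⟩ := (exists_less_iff (hcl c t) hw).1 ⟨_, hless⟩
      exact hmin _ (hβ.code_apply (f := fun p : (ℕ → ℕ) × ℕ => row p.1 p.2) inferInstance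
        (c := (W, 1)) (hβ.code_pair hW (hcode 1))) h1 h2
  refine ⟨fn D, hβ.code_apply (Df.fn_comp (X := fun X => X)) hD, fun t ⟨X, hX, hw⟩ => ?_⟩
  rw [← wellFounded_child_iff (hcl c t)] at hw ⊢
  refine wellFounded_child_limit (K := K) (hcont c t) ⟨X, hX, hw⟩ fun j Y hY => ?_
  have : {a | Nat.pair (Nat.pair t j) a ∈ D} = {Y j} := by
    ext a
    rw [Set.mem_ofPred_eq, key, Set.mem_singleton_iff]
    constructor
    · rintro ⟨X', hX', rfl⟩
      exact (hY.agree hX' (Nat.lt_succ_self j)).1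
    · rintro rfl
      exact ⟨Y, hY, rfl⟩
  rw [row, fn, this, csInf_singleton]

end Uniformization

/-! ### `Σ⁰₃` games restricted to a tree -/

/-- The number of a position. -/
abbrev num (p : List ℕ) : ℕ := Encodable.encode p

/-- The set `u` puts the basic open set of `p` into the `j`-th open set of the `i`-th `Gδ` set. -/
def Hit (u : Set ℕ) (i j : ℕ) (p : List ℕ) : Prop :=
  ∃ k, k ≤ p.length ∧ Nat.pair i (Nat.pair j (num (p.take k))) ∈ u

/-- The `i`-th `Gδ` set given by `u`. -/
def GDelta (u : Set ℕ) (i : ℕ) (x : ℕ → ℕ) : Prop := ∀ j, ∃ k, Hit u i j (Game.initSeg x k)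

/-- The `Σ⁰₃` set given by `u`. -/
def Payoff (u : Set ℕ) (x : ℕ → ℕ) : Prop := ∃ i, GDelta u i x

/-- The play `x` through the position `q` in the tree `T` refutes the strategy `σ` for Player I, who
tries to get into the `Σ⁰₃` set given by `u` or to reach the set `C` of positions after `q`. -/
def Refutes (u T C : Set ℕ) (q : List ℕ) (σ x : ℕ → ℕ) : Prop :=
  Game.initSeg x q.length = q ∧ (∀ k, num (Game.initSeg x k) ∈ T) ∧
    (∀ k, q.length ≤ k → k % 2 = 0 → x k = σ (num (Game.initSeg x k))) ∧
    ¬ Payoff u x ∧ ∀ k, q.length < k → ¬ num (Game.initSeg x k) ∈ C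

/-- The strategy `σ` wins for Player I from `q`. -/
def Wins (u T C : Set ℕ) (q : List ℕ) (σ : ℕ → ℕ) : Prop := ∀ x, ¬ Refutes u T C q σ x

section Definability

variable {γ : Type} [Dom γ]

instance Df.hit {u : γ → Set ℕ} {i j : γ → ℕ} {p : γ → List ℕ} [hu : Df u] [hi : Df i] [hj : Df j]
    [hp : Df p] : Df fun c => Hit (u c) (i c) (j c) (p c) :=
  Df.comp (f := fun c : ((Set ℕ × ℕ) × ℕ) × List ℕ => Hit c.1.1.1 c.1.1.2 c.1.2 c.2)
    (g := fun c => (((u c, i c), j c), p c)) (by unfold Hit; infer_instance) inferInstance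

instance Df.payoff {u : γ → Set ℕ} {x : γ → ℕ → ℕ} [hu : Df u] [hx : Df x] :
    Df fun c => Payoff (u c) (x c) :=
  Df.comp (f := fun c : Set ℕ × (ℕ → ℕ) => Payoff c.1 c.2)
    (g := fun c => (u c, x c)) (by unfold Payoff GDelta; infer_instance) inferInstance

instance Df.refutes {u T C : γ → Set ℕ} {q : γ → List ℕ} {σ x : γ → ℕ → ℕ} [hu : Df u] [hT : Df T]
    [hC : Df C] [hq : Df q] [hσ : Df σ] [hx : Df x] :
    Df fun c => Refutes (u c) (T c) (C c) (q c) (σ c) (x c) :=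
  Df.comp (f := fun c : (((((Set ℕ × Set ℕ) × Set ℕ) × List ℕ)) × (ℕ → ℕ)) × (ℕ → ℕ) =>
      Refutes c.1.1.1.1.1 c.1.1.1.1.2 c.1.1.1.2 c.1.1.2 c.1.2 c.2)
    (g := fun c => (((((u c, T c), C c), q c), σ c), x c)) (by unfold Refutes; infer_instance)
    inferInstance

end Definability

/-! ### Refutations of a strategy as branches of a tree. -/

section Tree

theorem take_initSeg {x : ℕ → ℕ} {k n : ℕ} (h : k ≤ n) :
    (Game.initSeg x n).take k = Game.initSeg x k := by
  rw [Game.initSeg, Game.initSeg, ← List.map_take, List.take_range, min_eq_left h]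

theorem initSeg_congr {x x' : ℕ → ℕ} {n : ℕ} (h : ∀ i < n, x i = x' i) :
    Game.initSeg x n = Game.initSeg x' n := by
  rw [eq_initSeg_iff]
  exact ⟨length_initSeg _ _, fun i hi => by rw [getI_initSeg hi, h i hi]⟩

theorem Hit.mono {u : Set ℕ} {i j : ℕ} {x : ℕ → ℕ} {k n : ℕ} (hkn : k ≤ n)
    (h : Hit u i j (Game.initSeg x k)) : Hit u i j (Game.initSeg x n) := by
  obtain ⟨l, hl, h⟩ := h
  rw [length_initSeg] at hl
  refine ⟨l, by rw [length_initSeg]; omega, ?_⟩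
  rwa [take_initSeg (hl.trans hkn), ← take_initSeg hl]

/-- The first `n` values of `x` and of the Skolem function `f` are compatible with a refutation. -/
def PartialRefutes (u T C : Set ℕ) (q : List ℕ) (σ x f : ℕ → ℕ) (n : ℕ) : Prop :=
  (∀ k, k < n → k < q.length → x k = q.getI k) ∧
    (∀ k, k ≤ n → num (Game.initSeg x k) ∈ T) ∧
    (∀ k, k < n → q.length ≤ k → k % 2 = 0 → x k = σ (num (Game.initSeg x k))) ∧
    (∀ i, i < n → ∀ k, k ≤ n → ¬ Hit u i (f i) (Game.initSeg x k)) ∧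
    ∀ k, k ≤ n → q.length < k → ¬ num (Game.initSeg x k) ∈ C

variable {u T C : Set ℕ} {q : List ℕ} {σ x f : ℕ → ℕ}

theorem PartialRefutes.mono {m n : ℕ} (hmn : m ≤ n) (h : PartialRefutes u T C q σ x f n) :
    PartialRefutes u T C q σ x f m :=
  ⟨fun k hk => h.1 k (by omega), fun k hk => h.2.1 k (by omega), fun k hk => h.2.2.1 k (by omega),
    fun i hi k hk => h.2.2.2.1 i (by omega) k (by omega), fun k hk => h.2.2.2.2 k (by omega)⟩

theorem PartialRefutes.congr {σ' x' f' : ℕ → ℕ} {n : ℕ} (hx : ∀ i < n, x i = x' i)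
    (hf : ∀ i < n, f i = f' i)
    (hσ : ∀ k < n, σ (num (Game.initSeg x k)) = σ' (num (Game.initSeg x k)))
    (h : PartialRefutes u T C q σ x f n) : PartialRefutes u T C q σ' x' f' n := by
  have e : ∀ k ≤ n, Game.initSeg x' k = Game.initSeg x k := fun k hk =>
    (initSeg_congr fun i hi => hx i (by omega)).symm
  refine ⟨fun k hk => ?_, fun k hk => ?_, fun k hk => ?_, fun i hi k hk => ?_, fun k hk => ?_⟩
  · rw [← hx k hk]
    exact h.1 k hk
  · rw [e k hk]
    exact h.2.1 k hk
  · rw [e k hk.le, ← hx k hk, ← hσ k hk]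
    exact h.2.2.1 k hk
  · rw [e k hk, ← hf i hi]
    exact h.2.2.2.1 i hi k hk
  · rw [e k hk]
    exact h.2.2.2.2 k hk

/-- Missing the payoff means ∀ i ∃ j ∀ k ¬ Hit. With a Skolem function for j interleaved with the
play, every condition becomes closed, so refutations are infinite branches and "`σ` wins" is
well-foundedness. -/
theorem exists_refutes_iff :
    (∃ x, Refutes u T C q σ x) ↔ ∃ y : ℕ → ℕ, ∀ n,
      PartialRefutes u T C q σ (fun k => (Nat.unpair (y k)).1) (fun k => (Nat.unpair (y k)).2) n := by
  constructor
  · rintro ⟨x, h1, h2, h3, h4, h5⟩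
    simp only [Payoff, GDelta, not_exists, not_forall] at h4
    choose f hf using h4
    refine ⟨fun k => Nat.pair (x k) (f k), fun n => ?_⟩
    simp only [Nat.unpair_pair]
    exact ⟨fun k _ hk => (((eq_initSeg_iff.1 h1.symm).2 k hk)).symm, fun k _ => h2 k,
      fun k _ => h3 k, fun i _ k _ => hf i k, fun k _ => h5 k⟩
  · rintro ⟨y, h⟩
    refine ⟨fun k => (Nat.unpair (y k)).1, ?_, fun k => (h k).2.1 k le_rfl,
      fun k => (h (k + 1)).2.2.1 k (Nat.lt_succ_self k), ?_,
      fun k => (h k).2.2.2.2 k le_rfl⟩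
    · exact (eq_initSeg_iff.2 ⟨rfl, fun i hi => ((h (i + 1)).1 i (Nat.lt_succ_self i) hi).symm⟩).symm
    · rintro ⟨i, hi⟩
      obtain ⟨k, hk⟩ := hi (Nat.unpair (y i)).2
      exact (h (i + 1 + k)).2.2.2.1 i (by omega) k (by omega) hk

end Tree

/-! ### Simultaneous choice of winning strategies. -/

section Strategies

variable {M : Set (Set ℕ)}

/-- The tree of attempts to refute `X` in the game with index `t`. -/
def Attempt (c : (Set ℕ × Set ℕ) × Set ℕ) (t : ℕ) (X : ℕ → ℕ) (s : List ℕ) : Prop :=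
  PartialRefutes c.1.1 (sect c.1.2 (Nat.unpair t).1) (sect c.2 (Nat.unpair t).1)
    (lst (Nat.unpair t).2) X (fun k => (Nat.unpair (s.getI k)).1)
    (fun k => (Nat.unpair (s.getI k)).2) s.length

instance Df.unpairGetI_fst {γ : Type} [Dom γ] {s : γ → List ℕ} [hs : Df s] :
    Df fun c => fun k => (Nat.unpair ((s c).getI k)).1 :=
  Df.comp (f := fun s : List ℕ => fun k => (Nat.unpair (s.getI k)).1)
    (Df.fun (t := fun s : List ℕ => fun k => (Nat.unpair (s.getI k)).1) inferInstance) hs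

instance Df.unpairGetI_snd {γ : Type} [Dom γ] {s : γ → List ℕ} [hs : Df s] :
    Df fun c => fun k => (Nat.unpair ((s c).getI k)).2 :=
  Df.comp (f := fun s : List ℕ => fun k => (Nat.unpair (s.getI k)).2)
    (Df.fun (t := fun s : List ℕ => fun k => (Nat.unpair (s.getI k)).2) inferInstance) hs

theorem Df.attempt : Df fun p : ((((Set ℕ × Set ℕ) × Set ℕ) × ℕ) × (ℕ → ℕ)) × List ℕ =>
    Attempt p.1.1.1 p.1.1.2 p.1.2 p.2 := by
  have h : Df fun p : ((((((Set ℕ × Set ℕ) × Set ℕ) × List ℕ) × (ℕ → ℕ)) × (ℕ → ℕ)) × (ℕ → ℕ)) × ℕ =>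
      PartialRefutes p.1.1.1.1.1.1.1 p.1.1.1.1.1.1.2 p.1.1.1.1.1.2 p.1.1.1.1.2 p.1.1.1.2 p.1.1.2 p.1.2 p.2 := by
    unfold PartialRefutes
    infer_instance
  exact h.comp (g := fun p : ((((Set ℕ × Set ℕ) × Set ℕ) × ℕ) × (ℕ → ℕ)) × List ℕ =>
    (((((((p.1.1.1.1.1, sect p.1.1.1.1.2 (Nat.unpair p.1.1.2).1), sect p.1.1.1.2 (Nat.unpair p.1.1.2).1),
      lst (Nat.unpair p.1.1.2).2), p.1.2), (fun k => (Nat.unpair (p.2.getI k)).1)),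
      (fun k => (Nat.unpair (p.2.getI k)).2)), p.2.length)) inferInstance

theorem getI_append_singleton {s : List ℕ} {a i : ℕ} (h : i < s.length) :
    (s ++ [a]).getI i = s.getI i := by
  rw [List.getI_eq_getElem _ (by rw [List.length_append]; omega), List.getI_eq_getElem _ h,
    List.getElem_append_left]

theorem attempt_initSeg {c : (Set ℕ × Set ℕ) × Set ℕ} {t : ℕ} {X y : ℕ → ℕ} {n : ℕ} :
    Attempt c t X (Game.initSeg y n) ↔
      PartialRefutes c.1.1 (sect c.1.2 (Nat.unpair t).1) (sect c.2 (Nat.unpair t).1)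
        (lst (Nat.unpair t).2) X (fun k => (Nat.unpair (y k)).1) (fun k => (Nat.unpair (y k)).2) n := by
  rw [Attempt, length_initSeg]
  constructor <;> refine PartialRefutes.congr (fun i hi => ?_) (fun i hi => ?_) fun _ _ => rfl <;>
    rw [getI_initSeg hi]

/-- Winning strategies in a sequence of games can be chosen simultaneously. -/
theorem SatisfiesPi12MI.exists_strategies (hMI : SatisfiesPi12MI M) (hβ : IsBetaModel M)
    {u Tf Cf : Set ℕ} (hu : u ∈ M) (hT : Tf ∈ M) (hC : Cf ∈ M) :
    ∃ Z : ℕ → ℕ, code Z ∈ M ∧ ∀ a q,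
      (∃ σ : ℕ → ℕ, code σ ∈ M ∧ Wins u (sect Tf a) (sect Cf a) q σ) →
        Wins u (sect Tf a) (sect Cf a) q (row Z (Nat.pair a (num q))) := by
  have hw : ∀ a q σ, Wins u (sect Tf a) (sect Cf a) q σ ↔
      ∀ y, ∃ k, ¬ Attempt ((u, Tf), Cf) (Nat.pair a (num q)) σ (Game.initSeg y k) := by
    intro a q σ
    rw [Wins, ← not_exists, exists_refutes_iff]
    simp only [attempt_initSeg, Nat.unpair_pair, lst_encode, not_exists, not_forall]
  have hcl : ∀ c t X s a, Attempt c t X (s ++ [a]) → Attempt c t X s := by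
    intro c t X s a h
    refine PartialRefutes.congr (fun i hi => ?_) (fun i hi => ?_) (fun _ _ => rfl)
      (PartialRefutes.mono (m := s.length) (by simp) h) <;> rw [getI_append_singleton hi]
  have hcont : ∀ c t X s, ∃ k, ∀ Y : ℕ → ℕ, (∀ i < k, Y i = X i) →
      (Attempt c t X s ↔ Attempt c t Y s) := by
    intro c t X s
    -- A finite attempt consults the strategy only at the initial segments of its play; the bound
    -- exceeds all their numbers.
    refine ⟨(Finset.range s.length).sup (fun k => num (Game.initSeg
      (fun k => (Nat.unpair (s.getI k)).1) k)) + 1, fun Y hY => ?_⟩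
    have : ∀ k < s.length, Y (num (Game.initSeg (fun k => (Nat.unpair (s.getI k)).1) k)) =
        X (num (Game.initSeg (fun k => (Nat.unpair (s.getI k)).1) k)) := fun k hk =>
      hY _ (Nat.lt_succ_of_le (Finset.le_sup (f := fun k => num (Game.initSeg
        (fun k => (Nat.unpair (s.getI k)).1) k)) (Finset.mem_range.2 hk)))
    constructor
    · exact PartialRefutes.congr (fun _ _ => rfl) (fun _ _ => rfl) fun k hk => (this k hk).symm
    · exact PartialRefutes.congr (fun _ _ => rfl) (fun _ _ => rfl) this
  obtain ⟨Z, hZ, h⟩ := hMI.exists_uniformization hβ (G := Attempt) Df.attempt hcl hcont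
    (c := ((u, Tf), Cf)) (hβ.code_pair (hβ.code_pair hu hT) hC)
  refine ⟨Z, hZ, fun a q ⟨σ, hσ, hq⟩ => ?_⟩
  rw [hw] at hq ⊢
  exact h _ ⟨σ, hσ, hq⟩

end Strategies

/-! ### Positions that are not lost for Player II -/

/-- The positions in `T` from which Player I has no winning strategy in `M`. -/
def Nonlosing (M : Set (Set ℕ)) (u T C : Set ℕ) : Set ℕ :=
  {m | m ∈ T ∧ ∀ σ : ℕ → ℕ, code σ ∈ M → ∃ x, Refutes u T C (lst m) σ x}

/-- The constant sequence of sets. -/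
def constSeq (T : Set ℕ) : Set ℕ := {k | (Nat.unpair k).2 ∈ T}

theorem sect_constSeq (T : Set ℕ) (a : ℕ) : sect (constSeq T) a = T := by
  ext k
  simp [sect, constSeq]

/-- The sequence of the sets of nonlosing positions for a sequence of games. -/
def nonlosingSeq (M : Set (Set ℕ)) (u Tf Cf : Set ℕ) : Set ℕ :=
  {k | (Nat.unpair k).2 ∈ Nonlosing M u (sect Tf (Nat.unpair k).1) (sect Cf (Nat.unpair k).1)}

theorem sect_nonlosingSeq (M : Set (Set ℕ)) (u Tf Cf : Set ℕ) (a : ℕ) :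
    sect (nonlosingSeq M u Tf Cf) a = Nonlosing M u (sect Tf a) (sect Cf a) := by
  ext k
  simp [sect, nonlosingSeq]

section Definability

variable {γ : Type} [Dom γ]

instance Df.constSeq {T : γ → Set ℕ} [hT : Df T] : Df fun c => constSeq (T c) :=
  Df.comp (f := fun T : Set ℕ => L2.constSeq T) (inferInstanceAs
    (Df fun T : Set ℕ => {k | (Nat.unpair k).2 ∈ T})) hT

instance Df.below {R : γ → Set ℕ} {k : γ → ℕ} [hR : Df R] [hk : Df k] :
    Df fun c => below (R c) (k c) :=
  Df.comp (f := fun p : Set ℕ × ℕ => L2.below p.1 p.2) (g := fun c => (R c, k c)) (inferInstanceAs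
    (Df fun p : Set ℕ × ℕ => {m | Nat.pair m p.2 ∈ p.1})) inferInstance

end Definability

section

variable {M : Set (Set ℕ)}

theorem IsBetaModel.constSeq_mem (hβ : IsBetaModel M) {T : Set ℕ} (hT : T ∈ M) : constSeq T ∈ M :=
  hβ.code_apply (γ := Set ℕ) (δ := Set ℕ) (Df.constSeq (T := fun X => X)) hT

theorem IsBetaModel.exists_refutes (hβ : IsBetaModel M) {u T C : Set ℕ} {q : List ℕ} {σ : ℕ → ℕ}
    (hu : u ∈ M) (hT : T ∈ M) (hC : C ∈ M) (hσ : code σ ∈ M) (h : ∃ x, Refutes u T C q σ x) :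
    ∃ x : ℕ → ℕ, code x ∈ M ∧ Refutes u T C q σ x :=
  hβ.exists_real (P := fun (d : ((((Set ℕ × Set ℕ) × Set ℕ) × List ℕ) × (ℕ → ℕ))) x =>
    Refutes d.1.1.1.1 d.1.1.1.2 d.1.1.2 d.1.2 d.2 x) inferInstance (c := ((((u, T), C), q), σ))
    (hβ.code_pair (hβ.code_pair (hβ.code_pair (hβ.code_pair hu hT) hC)
      (hβ.code_apply (γ := Set ℕ) (Df.const q) hu)) hσ) h

/-- A strategy in `M` refuted in reality is refuted by a play in `M`, so being nonlosing is Π¹₂ over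
`M` and comprehension applies. -/
theorem SatisfiesPi12MI.nonlosingSeq_mem (hMI : SatisfiesPi12MI M) (hβ : IsBetaModel M)
    {u Tf Cf : Set ℕ} (hu : u ∈ M) (hT : Tf ∈ M) (hC : Cf ∈ M) : nonlosingSeq M u Tf Cf ∈ M := by
  have h := hMI.comprehension hβ (P := fun (c : (Set ℕ × Set ℕ) × Set ℕ) k σ x =>
    (Nat.unpair k).2 ∈ sect c.1.2 (Nat.unpair k).1 ∧
      Refutes c.1.1 (sect c.1.2 (Nat.unpair k).1) (sect c.2 (Nat.unpair k).1)
        (lst (Nat.unpair k).2) σ x) inferInstance (c := ((u, Tf), Cf))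
    (hβ.code_pair (hβ.code_pair hu hT) hC)
  convert h using 1
  -- Any real in `M` would do: membership in the tree stands inside the quantifier over strategies
  -- and is extracted by one instance.
  have hf : code (fn u) ∈ M := hβ.code_apply (Df.fn_comp (X := fun X => X)) hu
  have hs : ∀ {X : Set ℕ} (a : ℕ), X ∈ M → sect X a ∈ M := fun {X} a hX =>
    hβ.code_apply (γ := Set ℕ) (δ := Set ℕ) (f := fun X => sect X a) inferInstance hX
  ext k
  constructor
  · rintro ⟨h1, h2⟩ σ hσ
    obtain ⟨x, hx, h3⟩ := hβ.exists_refutes hu (hs _ hT) (hs _ hC) hσ (h2 σ hσ)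
    exact ⟨x, hx, h1, h3⟩
  · intro h
    refine ⟨(h _ hf).choose_spec.2.1, fun σ hσ => ?_⟩
    obtain ⟨x, -, -, hx⟩ := h σ hσ
    exact ⟨x, hx⟩

theorem SatisfiesPi12MI.nonlosing_mem (hMI : SatisfiesPi12MI M) (hβ : IsBetaModel M)
    {u T C : Set ℕ} (hu : u ∈ M) (hT : T ∈ M) (hC : C ∈ M) : Nonlosing M u T C ∈ M := by
  have h1 := hMI.nonlosingSeq_mem hβ hu (hβ.constSeq_mem hT) (hβ.constSeq_mem hC)
  have h2 := hβ.code_apply (γ := Set ℕ) (δ := Set ℕ) (f := fun X => sect X 0) inferInstance h1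
  change sect (nonlosingSeq M u (constSeq T) (constSeq C)) 0 ∈ M at h2
  rwa [sect_nonlosingSeq, sect_constSeq, sect_constSeq] at h2

theorem exists_wins_of_notMem {u T C : Set ℕ} {q : List ℕ} (hq : num q ∈ T)
    (h : ¬ num q ∈ Nonlosing M u T C) : ∃ σ : ℕ → ℕ, code σ ∈ M ∧ Wins u T C q σ := by
  by_contra! h'
  refine h ⟨hq, fun σ hσ => ?_⟩
  rw [lst_encode]
  by_contra h2
  exact h' σ hσ (not_exists.1 h2)

open Classical in
/-- Follow `σ` until the set `N` is left after `ℓ` moves, and from then on the strategy that `Z`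
provides for the position reached. -/
noncomputable def switch (N : Set ℕ) (Z σ : ℕ → ℕ) (ℓ m : ℕ) : ℕ :=
  if ∃ k, ℓ < k ∧ k ≤ (lst m).length ∧ ¬ num ((lst m).take k) ∈ N then
    row Z (Nat.pair 0 (num ((lst m).take (sInf {k | ℓ < k ∧ k ≤ (lst m).length ∧
      ¬ num ((lst m).take k) ∈ N})))) m
  else σ m

theorem Df.switch : Df fun p : ((Set ℕ × (ℕ → ℕ)) × (ℕ → ℕ)) × ℕ =>
    switch p.1.1.1 p.1.1.2 p.1.2 p.2 := by
  refine Df.fun (t := fun p : ((Set ℕ × (ℕ → ℕ)) × (ℕ → ℕ)) × ℕ =>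
    L2.switch p.1.1.1 p.1.1.2 p.1.2 p.2) ?_
  unfold L2.switch row
  infer_instance

/-- From a nonlosing position Player II can answer a strategy of Player I by a play all of whose
positions are nonlosing. -/
theorem SatisfiesPi12MI.exists_play (hMI : SatisfiesPi12MI M) (hβ : IsBetaModel M)
    {u T C : Set ℕ} (hu : u ∈ M) (hT : T ∈ M) (hC : C ∈ M) {q : List ℕ}
    (hq : num q ∈ Nonlosing M u T C) {σ : ℕ → ℕ} (hσ : code σ ∈ M) :
    ∃ x, Refutes u T C q σ x ∧
      ∀ k, q.length < k → num (Game.initSeg x k) ∈ Nonlosing M u T C := by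
  obtain ⟨Z, hZ, hw⟩ := hMI.exists_strategies hβ hu (hβ.constSeq_mem hT) (hβ.constSeq_mem hC)
  have hN := hMI.nonlosing_mem hβ hu hT hC
  have hℓ : code q.length ∈ M := hβ.code_apply (γ := Set ℕ) (Df.const _) hu
  -- Refute the composite strategy. A refutation that left the nonlosing positions would, from its
  -- first exit on, refute the winning strategy used there; so it never leaves, and is a refutation
  -- of `σ` itself.
  obtain ⟨x, h1, h2, h3, h4, h5⟩ := hq.2 (switch (Nonlosing M u T C) Z σ q.length)
    (hβ.code_apply Df.switch (hβ.code_pair (hβ.code_pair (hβ.code_pair hN hZ) hσ) hℓ))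
  rw [lst_encode] at h1 h3 h5
  by_cases hx : ∀ k, q.length < k → num (Game.initSeg x k) ∈ Nonlosing M u T C
  · refine ⟨x, ⟨h1, h2, fun k hk hk' => ?_, h4, h5⟩, hx⟩
    rw [h3 k hk hk', switch, if_neg]
    rintro ⟨j, hj1, hj2, hj3⟩
    rw [lst_encode, length_initSeg] at hj2
    rw [lst_encode, take_initSeg hj2] at hj3
    exact hj3 (hx j hj1)
  · exfalso
    set S : Set ℕ := {k | q.length < k ∧ ¬ num (Game.initSeg x k) ∈ Nonlosing M u T C} with hS
    have hne : S.Nonempty := by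
      push Not at hx
      exact hx
    have hmin := Nat.sInf_mem hne
    set k₀ := sInf S with hk₀
    have hex := exists_wins_of_notMem (h2 k₀) hmin.2
    have hwin := hw 0 (Game.initSeg x k₀) (by rwa [sect_constSeq, sect_constSeq])
    rw [sect_constSeq, sect_constSeq] at hwin
    refine hwin x ⟨by rw [length_initSeg], h2, fun k hk hk' => ?_, h4, fun k hk => ?_⟩
    · rw [length_initSeg] at hk
      -- At every later position the composite strategy recomputes the same first exit k₀, so it
      -- follows one fixed strategy from there on.
      have e : {j | q.length < j ∧ j ≤ (lst (num (Game.initSeg x k))).length ∧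
          ¬ num ((lst (num (Game.initSeg x k))).take j) ∈ Nonlosing M u T C} =
          {j | j ∈ S ∧ j ≤ k} := by
        ext j
        simp only [Set.mem_ofPred_eq, lst_encode, length_initSeg, hS]
        constructor
        · rintro ⟨a, b, c⟩
          rw [take_initSeg b] at c
          exact ⟨⟨a, c⟩, b⟩
        · rintro ⟨⟨a, c⟩, b⟩
          rw [take_initSeg b]
          exact ⟨a, b, c⟩
      have e' : sInf {j | j ∈ S ∧ j ≤ k} = k₀ := by
        refine le_antisymm (Nat.sInf_le ⟨hmin, hk⟩) ?_
        exact Nat.sInf_le (Nat.sInf_mem (s := {j | j ∈ S ∧ j ≤ k}) ⟨k₀, hmin, hk⟩).1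
      have hc : ∃ j, q.length < j ∧ j ≤ (lst (num (Game.initSeg x k))).length ∧
          ¬ num ((lst (num (Game.initSeg x k))).take j) ∈ Nonlosing M u T C :=
        e.symm.subset (show k₀ ∈ {j | j ∈ S ∧ j ≤ k} from ⟨hmin, hk⟩) |> fun h => ⟨k₀, h⟩
      rw [h3 k (hmin.1.le.trans hk) hk', switch, if_pos hc, e, e', lst_encode, take_initSeg hk]
    · rw [length_initSeg] at hk
      exact h5 k (hmin.1.trans hk)

end

/-! ### The monotone operator and its stage prewellorder. -/

section Operator

/-- The positions in the `n`-th open set of the `i`-th `Gδ` set that are not in `X`. -/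
def Target (u : Set ℕ) (i n : ℕ) (X : Set ℕ) : Set ℕ := {m | Hit u i n (lst m) ∧ ¬ m ∈ X}

instance Df.target {γ : Type} [Dom γ] {u : γ → Set ℕ} {i n : γ → ℕ} {X : γ → Set ℕ} [hu : Df u]
    [hi : Df i] [hn : Df n] [hX : Df X] : Df fun c => Target (u c) (i c) (n c) (X c) :=
  Df.comp (f := fun p : ((Set ℕ × ℕ) × ℕ) × Set ℕ => Target p.1.1.1 p.1.1.2 p.1.2 p.2)
    (g := fun c => (((u c, i c), n c), X c)) (inferInstanceAs (Df fun p : ((Set ℕ × ℕ) × ℕ) × Set ℕ =>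
      {m | Hit p.1.1.1 p.1.1.2 p.1.2 (lst m) ∧ ¬ m ∈ p.2})) inferInstance

variable (M : Set (Set ℕ))

/-- The operator that adds the positions from which, for some `n`, Player I can not both miss the
payoff and keep Player II from reaching the `n`-th open set outside of `X`. -/
def stepOp (u T : Set ℕ) (i : ℕ) (X : Set ℕ) : Set ℕ :=
  {m | ∀ σ : ℕ → ℕ, code σ ∈ M →
    ∃ x, m ∈ T ∧ ∃ n, Refutes u T (Target u i n X) (lst m) (row σ n) x}

variable {M} {u T X : Set ℕ} {i : ℕ}

/-- The exchange ∃ n ∀ σ ↔ ∀ (σₙ) ∃ n that puts the operator into Π¹₂ form. If I had a winning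
strategy in `M` for every n, a sequence of such strategies in `M` would defeat the right-hand side.
-/
theorem SatisfiesPi12MI.mem_stepOp (hMI : SatisfiesPi12MI M) (hβ : IsBetaModel M) (hu : u ∈ M)
    (hT : T ∈ M) (hX : X ∈ M) {m : ℕ} :
    m ∈ stepOp M u T i X ↔ ∃ n, m ∈ Nonlosing M u T (Target u i n X) := by
  constructor
  · intro h
    have hf : code (fn u) ∈ M := hβ.code_apply (Df.fn_comp (X := fun X => X)) hu
    have hm : m ∈ T := (h _ hf).choose_spec.1
    by_contra! hn
    have hcf : {k | (Nat.unpair k).2 ∈ Target u i (Nat.unpair k).1 X} ∈ M :=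
      hβ.code_apply (γ := Set ℕ × Set ℕ) (δ := Set ℕ)
        (f := fun p => {k | (Nat.unpair k).2 ∈ Target p.1 i (Nat.unpair k).1 p.2}) inferInstance
        (c := (u, X)) (hβ.code_pair hu hX)
    obtain ⟨Z, hZ, hw⟩ := hMI.exists_strategies hβ hu (hβ.constSeq_mem hT) hcf
    have hs : ∀ n, sect {k | (Nat.unpair k).2 ∈ Target u i (Nat.unpair k).1 X} n = Target u i n X :=
      fun n => by
        ext k
        simp [sect]
    -- The chosen strategies are reindexed so that the n-th row is the one for game n at the fixed
    -- position m.
    obtain ⟨x, -, n, hx⟩ := h (fun k => Z (Nat.pair (Nat.pair (Nat.unpair k).1 m) (Nat.unpair k).2))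
      (hβ.code_apply (γ := ℕ → ℕ) (f := fun Z k =>
        Z (Nat.pair (Nat.pair (Nat.unpair k).1 m) (Nat.unpair k).2))
        (Df.fun (t := fun (Z : ℕ → ℕ) k =>
          Z (Nat.pair (Nat.pair (Nat.unpair k).1 m) (Nat.unpair k).2)) inferInstance) hZ)
    have h1 := hw n (lst m)
    rw [sect_constSeq, hs, num, encode_lst] at h1
    refine h1 (exists_wins_of_notMem (by rwa [num, encode_lst]) (by rw [num, encode_lst]; exact hn n)) x ?_
    convert hx using 1
    funext k
    simp [row]
  · rintro ⟨n, hm, h⟩ σ hσ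
    obtain ⟨x, hx⟩ := h (row σ n) (hβ.code_apply (γ := ℕ → ℕ) (f := fun σ => row σ n) inferInstance hσ)
    exact ⟨x, hm, n, hx⟩

/-- `F` with `R` is the least fixed point of the operator `stepOp` with its stages. -/
structure IsGood (M : Set (Set ℕ)) (u T : Set ℕ) (i : ℕ) (F R : Set ℕ) : Prop where
  wf : WellFounded fun m k => Nat.pair m k ∈ R
  field : ∀ m n, Nat.pair m n ∈ R → m ∈ F ∧ n ∈ F
  trans : ∀ k m n, Nat.pair k m ∈ R → Nat.pair m n ∈ R → Nat.pair k n ∈ R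
  compare : ∀ m n, Nat.pair m n ∈ R → ∀ k ∈ F, Nat.pair m k ∈ R ∨ Nat.pair k n ∈ R
  stage : ∀ k ∈ F, ∀ m, ((∃ n, m ∈ Nonlosing M u T (Target u i n (below R k))) ∨ Nat.pair m k ∈ R) ↔
    m ∈ F ∧ ¬ Nat.pair k m ∈ R
  closed : ∀ m n, m ∈ Nonlosing M u T (Target u i n F) → m ∈ F

theorem Refutes.mono {C C' : Set ℕ} {q : List ℕ} {σ x : ℕ → ℕ} (h : C' ⊆ C)
    (hx : Refutes u T C q σ x) : Refutes u T C' q σ x :=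
  ⟨hx.1, hx.2.1, hx.2.2.1, hx.2.2.2.1, fun k hk hC => hx.2.2.2.2 k hk (h hC)⟩

/-- Enlarging X shrinks the target and helps II, so the operator is monotone and monotone induction
applies. The axiom provides minimal elements only for sets in `M`; the β property upgrades this to
true well-foundedness. -/
theorem SatisfiesPi12MI.exists_isGood (hMI : SatisfiesPi12MI M) (hβ : IsBetaModel M) (hu : u ∈ M)
    (hT : T ∈ M) (i : ℕ) : ∃ F ∈ M, ∃ R ∈ M, IsGood M u T i F R := by
  have hi : code i ∈ M := hβ.code_apply (γ := Set ℕ) (Df.const _) hu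
  have ht : ∀ {X} n, X ∈ M → Target u i n X ∈ M := fun {X} n hX =>
    hβ.code_apply (γ := Set ℕ × Set ℕ) (δ := Set ℕ) (f := fun p => Target p.1 i n p.2) inferInstance
      (c := (u, X)) (hβ.code_pair hu hX)
  obtain ⟨F, hF, R, hR, h⟩ := hMI.exists_prewellorder hβ (P := fun (c : (Set ℕ × Set ℕ) × ℕ) m X σ x =>
      m ∈ c.1.2 ∧ ∃ n, Refutes c.1.1 c.1.2 (Target c.1.1 c.2 n X) (lst m) (row σ n) x)
    inferInstance (c := ((u, T), i)) (hβ.code_pair (hβ.code_pair hu hT) hi) (Φ := fun X =>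
      {m | ∀ σ : ℕ → ℕ, code σ ∈ M → ∃ x : ℕ → ℕ, code x ∈ M ∧
        (m ∈ T ∧ ∃ n, Refutes u T (Target u i n X) (lst m) (row σ n) x)})
    (fun X k => Iff.rfl) (fun X _ Y _ hXY m hm σ hσ => by
      obtain ⟨x, hx, hmT, n, h⟩ := hm σ hσ
      exact ⟨x, hx, hmT, n, h.mono (show Target u i n Y ⊆ Target u i n X from
        fun k hk => ⟨hk.1, fun hkX => hk.2 (hXY hkX)⟩)⟩)
  have hop : ∀ X ∈ M, ∀ m, m ∈ {m | ∀ σ : ℕ → ℕ, code σ ∈ M → ∃ x : ℕ → ℕ, code x ∈ M ∧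
        (m ∈ T ∧ ∃ n, Refutes u T (Target u i n X) (lst m) (row σ n) x)} ↔
      ∃ n, m ∈ Nonlosing M u T (Target u i n X) := by
    intro X hX m
    rw [← hMI.mem_stepOp hβ hu hT hX]
    refine forall₂_congr fun σ hσ => ⟨fun ⟨x, _, h⟩ => ⟨x, h⟩, ?_⟩
    rintro ⟨x, hm, n, h⟩
    obtain ⟨y, hy, h⟩ := hβ.exists_refutes hu hT (ht n hX)
      (hβ.code_apply (γ := ℕ → ℕ) (f := fun σ => row σ n) inferInstance hσ) ⟨x, h⟩
    exact ⟨y, hy, hm, n, h⟩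
  have hb : ∀ k, below R k ∈ M := fun k =>
    hβ.code_apply (γ := Set ℕ) (δ := Set ℕ) (f := fun R => below R k) inferInstance hR
  refine ⟨F, hF, R, hR, ?_, h.field, h.trans, h.compare, fun k hk m => ?_, fun m n hm => ?_⟩
  · refine wellFounded_iff_isEmpty_descending_chain.2 ⟨fun ⟨f, hf⟩ => ?_⟩
    have hd : Df fun p : Set ℕ × (ℕ → ℕ) => ∀ n, Nat.pair (p.2 (n + 1)) (p.2 n) ∈ p.1 :=
      inferInstance
    -- A descending sequence would yield one in `M`, whose range is then a nonempty set in `M`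
    -- without minimal element.
    obtain ⟨y, hy, hd⟩ := hβ.exists_real (γ := Set ℕ) (P := fun R y =>
      ∀ n, Nat.pair (y (n + 1)) (y n) ∈ R) hd hR ⟨f, hf⟩
    obtain ⟨m, ⟨n, rfl⟩, hm⟩ := h.wellFounded {m | ∃ n, m = y n}
      (hβ.code_apply (γ := ℕ → ℕ) (δ := Set ℕ) (f := fun y => {m | ∃ n, m = y n}) inferInstance hy)
      (by rintro _ ⟨n, rfl⟩; exact (h.field _ _ (hd n)).2) ⟨_, 0, rfl⟩
    exact hm _ ⟨n + 1, rfl⟩ (hd n)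
  · rw [← hop _ (hb k)]
    exact Set.ext_iff.1 (h.stage k hk) m
  · exact h.closed ((hop F hF m).2 ⟨n, hm⟩)

end Operator

/-! ### Strategies with a state -/

/-- The state after `k` moves following the first `ℓ` moves of `p`. -/
def run (s : ℕ) (f : ℕ → ℕ) (ℓ : ℕ) (p : List ℕ) : ℕ → ℕ
  | 0 => s
  | k + 1 => f (Nat.pair (run s f ℓ p k) (num (p.take (ℓ + k + 1))))

/-- The state at the position `p`, if the state is `s` after `ℓ` moves and is updated by `f`. -/
def stateAt (s : ℕ) (f : ℕ → ℕ) (ℓ : ℕ) (p : List ℕ) : ℕ := run s f ℓ p (p.length - ℓ)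

section

variable {s ℓ : ℕ} {f : ℕ → ℕ} {p : List ℕ}

theorem run_append {k : ℕ} (q : List ℕ) (h : ℓ + k ≤ p.length) :
    run s f ℓ (p ++ q) k = run s f ℓ p k := by
  induction k with
  | zero => rfl
  | succ k ih => rw [run, run, ih (by omega), List.take_append_of_le_length (by omega)]

theorem stateAt_of_length_le (h : p.length ≤ ℓ) : stateAt s f ℓ p = s := by
  rw [stateAt, Nat.sub_eq_zero_of_le h, run]

theorem stateAt_concat {a : ℕ} (h : ℓ ≤ p.length) :
    stateAt s f ℓ (p ++ [a]) = f (Nat.pair (stateAt s f ℓ p) (num (p ++ [a]))) := by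
  have e : (p ++ [a]).length - ℓ = p.length - ℓ + 1 := by simp; omega
  rw [stateAt, e, run, run_append _ (by omega), stateAt, List.take_of_length_le (by simp; omega)]

theorem stateAt_initSeg_succ {x : ℕ → ℕ} {k : ℕ} (h : ℓ ≤ k) :
    stateAt s f ℓ (Game.initSeg x (k + 1)) =
      f (Nat.pair (stateAt s f ℓ (Game.initSeg x k)) (num (Game.initSeg x (k + 1)))) := by
  rw [initSeg_succ, stateAt_concat (by rwa [length_initSeg])]

theorem stateAt_initSeg_of_forall {x : ℕ → ℕ} {k n : ℕ} (h : ℓ ≤ k) (hkn : k ≤ n)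
    (hf : ∀ j, k < j → j ≤ n → f (Nat.pair (stateAt s f ℓ (Game.initSeg x k))
      (num (Game.initSeg x j))) = stateAt s f ℓ (Game.initSeg x k)) :
    stateAt s f ℓ (Game.initSeg x n) = stateAt s f ℓ (Game.initSeg x k) := by
  induction n, hkn using Nat.le_induction with
  | base => rfl
  | succ n hn ih =>
    rw [stateAt_initSeg_succ (h.trans hn), ih fun j h1 h2 => hf j h1 (h2.trans n.le_succ),
      hf _ (Nat.lt_succ_of_le hn) le_rfl]

end

instance Df.stateAt {γ : Type} [Dom γ] {s ℓ : γ → ℕ} {f : γ → ℕ → ℕ} {p : γ → List ℕ} [hs : Df s]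
    [hf : Df f] [hl : Df ℓ] [hp : Df p] : Df fun c => stateAt (s c) (f c) (ℓ c) (p c) := by
  have h : Df fun q : (((ℕ × (ℕ → ℕ)) × ℕ) × List ℕ) × ℕ => ∃ w, Nat.beta w 0 = q.1.1.1.1 ∧
      (∀ j, j < q.1.2.length - q.1.1.2 → Nat.beta w (j + 1) = q.1.1.1.2 (Nat.pair (Nat.beta w j)
        (num (q.1.2.take (q.1.1.2 + j + 1))))) ∧ q.2 = Nat.beta w (q.1.2.length - q.1.1.2) :=
    inferInstance
  refine Df.comp (f := fun q : ((ℕ × (ℕ → ℕ)) × ℕ) × List ℕ => L2.stateAt q.1.1.1 q.1.1.2 q.1.2 q.2)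
    (g := fun c => (((s c, f c), ℓ c), p c)) (Df.of_graph (h.of_eq fun q => propext ?_)) inferInstance
  obtain ⟨⟨⟨⟨s, f⟩, ℓ⟩, p⟩, v⟩ := q
  dsimp only
  constructor
  · rintro ⟨w, h0, h1, rfl⟩
    have : ∀ j ≤ p.length - ℓ, Nat.beta w j = run s f ℓ p j := by
      intro j hj
      induction j with
      | zero => exact h0
      | succ j ih => rw [h1 j hj, ih (by omega), run]
    exact this _ le_rfl
  · rintro rfl
    obtain ⟨w, hw⟩ := exists_beta_eq (p.length - ℓ) (run s f ℓ p)
    refine ⟨w, hw 0 (Nat.zero_le _), fun j hj => ?_, (hw _ le_rfl).symm⟩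
    rw [hw _ hj, hw _ hj.le, run]

/-! ### Player I wins outside the least fixed point. -/

section PlayerI

variable {M : Set (Set ℕ)} {u T F R : Set ℕ} {i : ℕ}

open Classical in
/-- The update of the state `⟨n, r⟩` when Player I reaches the `n`-th open set outside of `F`. -/
noncomputable def advance (u : Set ℕ) (i : ℕ) (F : Set ℕ) (k : ℕ) : ℕ :=
  if (Nat.unpair k).2 ∈ Target u i (Nat.unpair (Nat.unpair k).1).1 F then
    Nat.pair ((Nat.unpair (Nat.unpair k).1).1 + 1) (Nat.unpair k).2
  else (Nat.unpair k).1

theorem advance_of_mem {n r m : ℕ} (h : m ∈ Target u i n F) :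
    advance u i F (Nat.pair (Nat.pair n r) m) = Nat.pair (n + 1) m := by
  rw [advance, if_pos (by simpa only [Nat.unpair_pair] using h)]
  simp only [Nat.unpair_pair]

theorem advance_of_notMem {n r m : ℕ} (h : ¬ m ∈ Target u i n F) :
    advance u i F (Nat.pair (Nat.pair n r) m) = Nat.pair n r := by
  rw [advance, if_neg (by simpa only [Nat.unpair_pair] using h), Nat.unpair_pair]

theorem Df.advance : Df fun p : (Set ℕ × ℕ) × Set ℕ => advance p.1.1 p.1.2 p.2 := by
  refine Df.fun (t := fun p : (Set ℕ × ℕ) × Set ℕ => L2.advance p.1.1 p.1.2 p.2) ?_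
  unfold L2.advance
  infer_instance

/-- From a position outside of the least fixed point Player I wins, by reaching one open set after
the other. -/
theorem IsGood.exists_wins (hMI : SatisfiesPi12MI M) (hβ : IsBetaModel M) (hu : u ∈ M) (hT : T ∈ M)
    (hF : F ∈ M) (h : IsGood M u T i F R) {p : List ℕ} (hpF : ¬ num p ∈ F) :
    ∃ σ : ℕ → ℕ, code σ ∈ M ∧ Wins u T ∅ p σ := by
  have hcf : {k | (Nat.unpair k).2 ∈ Target u i (Nat.unpair k).1 F} ∈ M :=
    hβ.code_apply (γ := Set ℕ × Set ℕ) (δ := Set ℕ)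
      (f := fun p => {k | (Nat.unpair k).2 ∈ Target p.1 i (Nat.unpair k).1 p.2}) inferInstance
      (c := (u, F)) (hβ.code_pair hu hF)
  have hs : ∀ n, sect {k | (Nat.unpair k).2 ∈ Target u i (Nat.unpair k).1 F} n = Target u i n F :=
    fun n => by
      ext k
      simp [sect]
  obtain ⟨Z, hZ, hw⟩ := hMI.exists_strategies hβ hu (hβ.constSeq_mem hT) hcf
  have hw' : ∀ n q, num q ∈ T → ¬ num q ∈ F →
      Wins u T (Target u i n F) q (row Z (Nat.pair n (num q))) := by
    intro n q hq hqF
    have := hw n q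
    rw [sect_constSeq, hs] at this
    exact this (exists_wins_of_notMem hq fun h' => hqF (h.closed _ _ h'))
  have hd : Df fun c : (ℕ → ℕ) × (ℕ → ℕ) => fun m =>
      row c.1 (stateAt (Nat.pair 0 (num p)) c.2 p.length (lst m)) m :=
    Df.fun (t := fun (c : (ℕ → ℕ) × (ℕ → ℕ)) m =>
      row c.1 (stateAt (Nat.pair 0 (num p)) c.2 p.length (lst m)) m)
      (inferInstanceAs (Df fun q : ((ℕ → ℕ) × (ℕ → ℕ)) × ℕ =>
        q.1.1 (Nat.pair (stateAt (Nat.pair 0 (num p)) q.1.2 p.length (lst q.2)) q.2)))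
  have hadv : code (advance u i F) ∈ M :=
    hβ.code_apply Df.advance (c := ((u, i), F))
      (hβ.code_pair (hβ.code_pair hu (hβ.code_apply (γ := Set ℕ) (Df.const i) hu)) hF)
  -- The state codes the index n of the current open set together with the position at which that
  -- task began; it selects the row of `Z` to be followed.
  refine ⟨_, hβ.code_apply hd (c := (Z, advance u i F)) (hβ.code_pair hZ hadv), fun x hx => ?_⟩
  obtain ⟨h1, h2, h3, h4, -⟩ := hx
  set st := fun k => stateAt (Nat.pair 0 (num p)) (advance u i F) p.length (Game.initSeg x k) with hst
  have key : ∀ n, ∃ k, p.length ≤ k ∧ st k = Nat.pair n (num (Game.initSeg x k)) ∧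
      (¬ num (Game.initSeg x k) ∈ F) ∧ ∀ j < n, Hit u i j (Game.initSeg x k) := by
    intro n
    induction n with
    | zero =>
      refine ⟨p.length, le_rfl, ?_, by rwa [h1], fun j hj => by omega⟩
      simp only [hst]
      rw [h1, stateAt_of_length_le le_rfl]
    | succ n ih =>
      obtain ⟨k, hk, hsk, hF', hj⟩ := ih
      have hex : ∃ j, k < j ∧ num (Game.initSeg x j) ∈ Target u i n F := by
        -- If the n-th target were never reached, the state would stay frozen and x would refute a
        -- strategy that wins from its position at time k.
        by_contra! hno
        have hconst : ∀ j, k ≤ j → st j = st k := fun j hj =>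
          stateAt_initSeg_of_forall hk hj fun l hl _ => by
            change advance u i F (Nat.pair (st k) _) = st k
            rw [hsk, advance_of_notMem (hno l hl)]
        refine hw' n (Game.initSeg x k) (h2 k) hF' x ⟨by rw [length_initSeg], h2, fun j hj hj' => ?_,
          h4, fun j hj => ?_⟩
        · rw [length_initSeg] at hj
          rw [h3 j (hk.trans hj) hj']
          beta_reduce
          rw [lst_encode]
          change row Z (st j) _ = _
          rw [hconst j hj, hsk]
        · rw [length_initSeg] at hj
          exact hno j hj
      classical
      obtain ⟨hj1, hj2⟩ := Nat.find_spec hex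
      obtain ⟨j', hj'⟩ : ∃ j', Nat.find hex = j' + 1 := ⟨Nat.find hex - 1, by omega⟩
      rw [hj'] at hj1 hj2
      have hno : ∀ l, k < l → l ≤ j' → ¬ num (Game.initSeg x l) ∈ Target u i n F := fun l hl hl' hh =>
        Nat.find_min hex (m := l) (by omega) ⟨hl, hh⟩
      have hc : st j' = st k := stateAt_initSeg_of_forall hk (by omega) fun l hl hl' => by
        change advance u i F (Nat.pair (st k) _) = st k
        rw [hsk, advance_of_notMem (hno l hl hl')]
      refine ⟨j' + 1, by omega, ?_, hj2.2, fun l hl => ?_⟩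
      · simp only [hst]
        rw [stateAt_initSeg_succ (by omega)]
        change advance u i F (Nat.pair (st j') _) = _
        rw [hc, hsk, advance_of_mem hj2]
      · rcases Nat.lt_succ_iff_lt_or_eq.1 hl with hl | rfl
        · exact (hj l hl).mono hj1.le
        · simpa [lst_encode] using hj2.1
  -- All the open sets have been entered, so the play is in the i-th Gδ set and hence in the payoff.
  refine h4 ⟨i, fun j => ?_⟩
  obtain ⟨k, -, -, -, hk⟩ := key (j + 1)
  exact ⟨k, hk j (Nat.lt_succ_self j)⟩

end PlayerI

/-! ### The quasi-strategies of Player II -/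

/-- The set `F` for `r = 0`, and the set of the predecessors of `r - 1` otherwise. -/
def level (F R : Set ℕ) (r : ℕ) : Set ℕ := {m | (r = 0 ∧ m ∈ F) ∨ (0 < r ∧ m ∈ below R (r - 1))}

theorem level_zero (F R : Set ℕ) : level F R 0 = F := by
  ext m
  simp [level]

theorem level_succ (F R : Set ℕ) (r : ℕ) : level F R (r + 1) = below R r := by
  ext m
  simp [level]

/-- The sequence of the target sets of all levels. -/
def targetSeq (u : Set ℕ) (i : ℕ) (F R : Set ℕ) : Set ℕ :=
  {k | (Nat.unpair k).2 ∈ Target u i (Nat.unpair (Nat.unpair k).1).1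
    (level F R (Nat.unpair (Nat.unpair k).1).2)}

theorem sect_targetSeq (u : Set ℕ) (i : ℕ) (F R : Set ℕ) (a : ℕ) :
    sect (targetSeq u i F R) a = Target u i (Nat.unpair a).1 (level F R (Nat.unpair a).2) := by
  ext k
  simp [sect, targetSeq]

/-- The sequence of the sets of nonlosing positions of all levels. -/
def levelSeq (M : Set (Set ℕ)) (u T : Set ℕ) (i : ℕ) (F R : Set ℕ) : Set ℕ :=
  nonlosingSeq M u (constSeq T) (targetSeq u i F R)

theorem mem_levelSeq {M : Set (Set ℕ)} {u T : Set ℕ} {i : ℕ} {F R : Set ℕ} {n r m : ℕ} :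
    Nat.pair (Nat.pair n r) m ∈ levelSeq M u T i F R ↔
      m ∈ Nonlosing M u T (Target u i n (level F R r)) := by
  change m ∈ sect (levelSeq M u T i F R) (Nat.pair n r) ↔ _
  rw [levelSeq, sect_nonlosingSeq, sect_constSeq, sect_targetSeq, Nat.unpair_pair]

/-- The open set that Player II keeps out of in the state `r`. -/
noncomputable def avoid (N : Set ℕ) (r : ℕ) : ℕ := sInf {n | Nat.pair (Nat.pair n (r + 1)) r ∈ N}

theorem avoid_mem {N : Set ℕ} {n r : ℕ} (h : Nat.pair (Nat.pair n (r + 1)) r ∈ N) :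
    Nat.pair (Nat.pair (avoid N r) (r + 1)) r ∈ N :=
  Nat.sInf_mem (s := {n | Nat.pair (Nat.pair n (r + 1)) r ∈ N}) ⟨n, h⟩

open Classical in
/-- The new state when the open set of the state is reached. -/
noncomputable def hop (u : Set ℕ) (i : ℕ) (N : Set ℕ) (k : ℕ) : ℕ :=
  if Hit u i (avoid N (Nat.unpair k).1) (lst (Nat.unpair k).2) then (Nat.unpair k).2
  else (Nat.unpair k).1

/-- The state of Player II at the position `p`. -/
noncomputable def stateII (u : Set ℕ) (i : ℕ) (N : Set ℕ) (p : List ℕ) : ℕ :=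
  stateAt (num (p.take i)) (hop u i N) i p

/-- In the state `r`, Player II can move to the position `m`. -/
def Safe (u : Set ℕ) (i : ℕ) (R N : Set ℕ) (r m : ℕ) : Prop :=
  Nat.pair (Nat.pair (avoid N r) (r + 1)) m ∈ N ∧ ¬ m ∈ Target u i (avoid N r) (below R r)

/-- The subtree of `T` on which Player II keeps out of the `i`-th `Gδ` set. -/
def subtree (u : Set ℕ) (i : ℕ) (T R N : Set ℕ) : Set ℕ :=
  {m | m ∈ T ∧ ∀ k, i ≤ k → k < (lst m).length →
    Safe u i R N (stateII u i N ((lst m).take k)) (num ((lst m).take (k + 1)))}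

section Definability

variable {γ : Type} [Dom γ] {u T F R N : γ → Set ℕ} {i : γ → ℕ}

instance Df.level {r : γ → ℕ} [hF : Df F] [hR : Df R] [hr : Df r] :
    Df fun c => level (F c) (R c) (r c) :=
  Df.comp (f := fun p : (Set ℕ × Set ℕ) × ℕ => L2.level p.1.1 p.1.2 p.2)
    (g := fun c => ((F c, R c), r c)) (inferInstanceAs (Df fun p : (Set ℕ × Set ℕ) × ℕ =>
      {m | (p.2 = 0 ∧ m ∈ p.1.1) ∨ (0 < p.2 ∧ m ∈ L2.below p.1.2 (p.2 - 1))})) inferInstance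

instance Df.targetSeq [hu : Df u] [hi : Df i] [hF : Df F] [hR : Df R] :
    Df fun c => targetSeq (u c) (i c) (F c) (R c) :=
  Df.comp (f := fun p : ((Set ℕ × ℕ) × Set ℕ) × Set ℕ => L2.targetSeq p.1.1.1 p.1.1.2 p.1.2 p.2)
    (g := fun c => (((u c, i c), F c), R c)) (by unfold L2.targetSeq; infer_instance) inferInstance

instance Df.avoid {r : γ → ℕ} [hN : Df N] [hr : Df r] : Df fun c => avoid (N c) (r c) :=
  Df.comp (f := fun p : Set ℕ × ℕ => L2.avoid p.1 p.2) (g := fun c => (N c, r c))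
    (by unfold L2.avoid; infer_instance) inferInstance

instance Df.hop [hu : Df u] [hi : Df i] [hN : Df N] : Df fun c => hop (u c) (i c) (N c) :=
  Df.comp (f := fun p : (Set ℕ × ℕ) × Set ℕ => L2.hop p.1.1 p.1.2 p.2)
    (g := fun c => ((u c, i c), N c))
    (Df.fun (t := fun p : (Set ℕ × ℕ) × Set ℕ => L2.hop p.1.1 p.1.2 p.2)
      (by unfold L2.hop; infer_instance)) inferInstance

instance Df.stateII {p : γ → List ℕ} [hu : Df u] [hi : Df i] [hN : Df N] [hp : Df p] :
    Df fun c => stateII (u c) (i c) (N c) (p c) :=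
  inferInstanceAs (Df fun c => L2.stateAt (num ((p c).take (i c))) (L2.hop (u c) (i c) (N c)) (i c) (p c))

instance Df.safe {r m : γ → ℕ} [hu : Df u] [hi : Df i] [hR : Df R] [hN : Df N] [hr : Df r] [hm : Df m] :
    Df fun c => Safe (u c) (i c) (R c) (N c) (r c) (m c) :=
  Df.comp (f := fun p : ((((Set ℕ × ℕ) × Set ℕ) × Set ℕ) × ℕ) × ℕ =>
      Safe p.1.1.1.1.1 p.1.1.1.1.2 p.1.1.1.2 p.1.1.2 p.1.2 p.2)
    (g := fun c => (((((u c, i c), R c), N c), r c), m c)) (by unfold Safe; infer_instance) inferInstance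

instance Df.subtree [hu : Df u] [hi : Df i] [hT : Df T] [hR : Df R] [hN : Df N] :
    Df fun c => subtree (u c) (i c) (T c) (R c) (N c) :=
  Df.comp (f := fun p : (((Set ℕ × ℕ) × Set ℕ) × Set ℕ) × Set ℕ =>
      L2.subtree p.1.1.1.1 p.1.1.1.2 p.1.1.2 p.1.2 p.2)
    (g := fun c => ((((u c, i c), T c), R c), N c)) (by unfold L2.subtree; infer_instance) inferInstance

end Definability

/-- `T` is a quasi-strategy for Player II. -/
structure IsQuasi (T : Set ℕ) : Prop where
  nil : num [] ∈ T
  prefix_mem : ∀ p a, num (p ++ [a]) ∈ T → num p ∈ T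
  even : ∀ p, p.length % 2 = 0 → num p ∈ T → ∀ a, num (p ++ [a]) ∈ T
  odd : ∀ p, p.length % 2 = 1 → num p ∈ T → ∃ a, num (p ++ [a]) ∈ T

/-! ### Positions and states in the subtree. -/

section

variable {u T R N : Set ℕ} {i : ℕ} {p : List ℕ}

theorem subtree_subset : subtree u i T R N ⊆ T := fun _ h => h.1

theorem mem_subtree_of_length_le (h : p.length ≤ i) : num p ∈ subtree u i T R N ↔ num p ∈ T := by
  refine ⟨fun h => h.1, fun hp => ⟨hp, fun k hk hk' => ?_⟩⟩
  rw [lst_encode] at hk'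
  omega

theorem mem_subtree_concat (hT : IsQuasi T) {a : ℕ} (h : i ≤ p.length) :
    num (p ++ [a]) ∈ subtree u i T R N ↔ num p ∈ subtree u i T R N ∧ num (p ++ [a]) ∈ T ∧
      Safe u i R N (stateII u i N p) (num (p ++ [a])) := by
  simp only [subtree, Set.mem_ofPred_eq, lst_encode, List.length_append, List.length_singleton]
  constructor
  · rintro ⟨h1, h2⟩
    refine ⟨⟨hT.prefix_mem _ _ h1, fun k hk hk' => ?_⟩, h1, ?_⟩
    · have := h2 k hk (by omega)
      rwa [List.take_append_of_le_length hk'.le, List.take_append_of_le_length hk'] at this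
    · have := h2 p.length h (by omega)
      rwa [List.take_append_of_le_length le_rfl, List.take_length,
        List.take_of_length_le (by simp)] at this
  · rintro ⟨⟨-, h2⟩, h1, h3⟩
    refine ⟨h1, fun k hk hk' => ?_⟩
    rcases Nat.lt_succ_iff_lt_or_eq.1 hk' with hk' | rfl
    · rw [List.take_append_of_le_length hk'.le, List.take_append_of_le_length hk']
      exact h2 k hk hk'
    · rwa [List.take_append_of_le_length le_rfl, List.take_length, List.take_of_length_le (by simp)]

theorem stateII_of_length_eq (h : p.length = i) : stateII u i N p = num p := by
  rw [stateII, stateAt_of_length_le h.le, List.take_of_length_le h.le]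

theorem stateII_concat_of_hit {a : ℕ} (h : i ≤ p.length)
    (hh : Hit u i (avoid N (stateII u i N p)) (p ++ [a])) :
    stateII u i N (p ++ [a]) = num (p ++ [a]) := by
  rw [stateII, stateAt_concat h, List.take_append_of_le_length h]
  change hop u i N (Nat.pair (stateII u i N p) _) = _
  rw [hop, if_pos (by simpa only [Nat.unpair_pair, lst_encode] using hh), Nat.unpair_pair]

theorem stateII_concat_of_not_hit {a : ℕ} (h : i ≤ p.length)
    (hh : ¬ Hit u i (avoid N (stateII u i N p)) (p ++ [a])) :
    stateII u i N (p ++ [a]) = stateII u i N p := by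
  rw [stateII, stateAt_concat h, List.take_append_of_le_length h]
  change hop u i N (Nat.pair (stateII u i N p) _) = _
  rw [hop, if_neg (by simpa only [Nat.unpair_pair, lst_encode] using hh), Nat.unpair_pair]

theorem initSeg_eq_initSeg_iff {x x' : ℕ → ℕ} {n : ℕ} :
    Game.initSeg x n = Game.initSeg x' n ↔ ∀ k < n, x k = x' k := by
  refine ⟨fun h k hk => ?_, initSeg_congr⟩
  rw [← getI_initSeg (x := x) hk, h, getI_initSeg hk]

end

/-! ### One refinement of a quasi-strategy. -/

section Step

variable {M : Set (Set ℕ)} {u T F R : Set ℕ} {i : ℕ}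

/-- Since r does not precede itself, it entered F through the operator applied to its predecessors;
this supplies an index n, and `avoid` is the least one. -/
theorem IsGood.avoid_spec (h : IsGood M u T i F R) {r : ℕ} (hr : r ∈ F) :
    r ∈ Nonlosing M u T (Target u i (avoid (levelSeq M u T i F R) r) (below R r)) := by
  have hirr : ¬ Nat.pair r r ∈ R := h.wf.irrefl.irrefl r
  obtain ⟨n, hn⟩ := ((h.stage r hr r).2 ⟨hr, hirr⟩).resolve_right hirr
  rw [← level_succ F] at hn ⊢
  exact mem_levelSeq.1 (avoid_mem (mem_levelSeq.2 hn))

theorem safe_levelSeq_iff {r m : ℕ} : Safe u i R (levelSeq M u T i F R) r m ↔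
    m ∈ Nonlosing M u T (Target u i (avoid (levelSeq M u T i F R) r) (below R r)) ∧
      ¬ m ∈ Target u i (avoid (levelSeq M u T i F R) r) (below R r) := by
  rw [Safe, mem_levelSeq, level_succ]

/-- The subtree given by `F` and `R`. -/
abbrev nextTree (M : Set (Set ℕ)) (u T : Set ℕ) (i : ℕ) (F R : Set ℕ) : Set ℕ :=
  subtree u i T R (levelSeq M u T i F R)

/-- The state of Player II given by `F` and `R`. -/
noncomputable abbrev nextState (M : Set (Set ℕ)) (u T : Set ℕ) (i : ℕ) (F R : Set ℕ) (p : List ℕ) : ℕ :=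
  stateII u i (levelSeq M u T i F R) p

/-- A safe position is outside the target. If it lies in the open set of the state, it must
therefore be a predecessor of the state: the state strictly descends whenever it is updated. -/
theorem state_or (hTq : IsQuasi T) {p : List ℕ} {a : ℕ}
    (hi : i ≤ p.length) (hp : num (p ++ [a]) ∈ nextTree M u T i F R) :
    (Hit u i (avoid (levelSeq M u T i F R) (nextState M u T i F R p)) (p ++ [a]) ∧
        nextState M u T i F R (p ++ [a]) = num (p ++ [a]) ∧
        Nat.pair (nextState M u T i F R (p ++ [a])) (nextState M u T i F R p) ∈ R) ∨
      (¬ Hit u i (avoid (levelSeq M u T i F R) (nextState M u T i F R p)) (p ++ [a]) ∧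
        nextState M u T i F R (p ++ [a]) = nextState M u T i F R p) := by
  by_cases hh : Hit u i (avoid (levelSeq M u T i F R) (nextState M u T i F R p)) (p ++ [a])
  · have e := stateII_concat_of_hit hi hh
    refine Or.inl ⟨hh, e, ?_⟩
    have h2 := (safe_levelSeq_iff.1 ((mem_subtree_concat hTq hi).1 hp).2.2).2
    by_contra h3
    refine h2 ⟨by rwa [lst_encode], fun h4 => h3 ?_⟩
    rw [nextState, e]
    exact h4
  · exact Or.inr ⟨hh, stateII_concat_of_not_hit hi hh⟩

/-- The invariant of II's play. After an update the position is itself the state, and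
`IsGood.avoid_spec` applies; otherwise safety of the last move keeps it nonlosing for the old state.
The hypothesis `hb` starts the induction at length i. -/
theorem IsGood.state_spec (h : IsGood M u T i F R) (hTq : IsQuasi T)
    (hb : ∀ p : List ℕ, p.length = i → num p ∈ T → num p ∈ F) {p : List ℕ} (hi : i ≤ p.length)
    (hp : num p ∈ nextTree M u T i F R) :
    nextState M u T i F R p ∈ F ∧ num p ∈ Nonlosing M u T
      (Target u i (avoid (levelSeq M u T i F R) (nextState M u T i F R p))
        (below R (nextState M u T i F R p))) := by
  induction p using List.reverseRecOn with
  | nil =>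
    have e : nextState M u T i F R [] = num [] := stateII_of_length_eq (by simp at hi; simp [hi])
    have hF := hb [] (by simp at hi; simp [hi]) hp.1
    rw [e]
    exact ⟨hF, h.avoid_spec hF⟩
  | append_singleton q a ih =>
    rcases (show i = (q ++ [a]).length ∨ i ≤ q.length by simp at hi ⊢; omega) with hi' | hi'
    · have e : nextState M u T i F R (q ++ [a]) = num (q ++ [a]) := stateII_of_length_eq hi'.symm
      have hF := hb _ hi'.symm hp.1
      rw [e]
      exact ⟨hF, h.avoid_spec hF⟩
    · obtain ⟨h1, h2, h3⟩ := (mem_subtree_concat hTq hi').1 hp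
      rcases state_or hTq hi' hp with ⟨-, e, hR⟩ | ⟨-, e⟩
      · have hF := (h.field _ _ hR).1
        rw [e] at hF ⊢
        exact ⟨hF, h.avoid_spec hF⟩
      · rw [e]
        exact ⟨(ih hi' h1).1, (safe_levelSeq_iff.1 h3).1⟩

/-- Player II avoids the `i`-th `Gδ` set along the branches of the subtree. -/
theorem IsGood.not_gDelta (h : IsGood M u T i F R) (hTq : IsQuasi T) {x : ℕ → ℕ}
    (hx : ∀ k, num (Game.initSeg x k) ∈ nextTree M u T i F R) : ¬ GDelta u i x := by
  intro hG
  have hs : ∀ r k, i ≤ k → nextState M u T i F R (Game.initSeg x k) = r → False := by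
    intro r
    induction r using h.wf.induction with
    | _ r ih =>
      intro k hk hr
      have hc : ∀ n, k ≤ n → nextState M u T i F R (Game.initSeg x n) = r ∧
          ∀ j, k < j → j ≤ n → ¬ Hit u i (avoid (levelSeq M u T i F R) r) (Game.initSeg x j) := by
        intro n hn
        induction n, hn using Nat.le_induction with
        | base => exact ⟨hr, fun j h1 h2 => by omega⟩
        | succ n hn ihn =>
          have hp := hx (n + 1)
          rw [initSeg_succ] at hp
          rcases state_or hTq (by rw [length_initSeg]; omega) hp with ⟨-, -, hR⟩ | ⟨hh, e⟩
          · rw [ihn.1, ← initSeg_succ] at hR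
            exact (ih _ hR (n + 1) (by omega) rfl).elim
          · rw [ihn.1, ← initSeg_succ] at hh e
            refine ⟨e, fun j h1 h2 => ?_⟩
            rcases Nat.le_succ_iff.1 h2 with h2 | rfl
            · exact ihn.2 j h1 h2
            · exact hh
      obtain ⟨n, hn⟩ := hG (avoid (levelSeq M u T i F R) r)
      -- The hit may occur before time k, but hits persist, so it is still present at a time after
      -- k.
      exact (hc (n + k + 1) (by omega)).2 _ (by omega) le_rfl (hn.mono (by omega))
  exact hs _ i le_rfl rfl

variable (hMI : SatisfiesPi12MI M) (hβ : IsBetaModel M) (hu : u ∈ M) (hT : T ∈ M) (hF : F ∈ M)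
  (hR : R ∈ M)

include hβ hu hR in
theorem target_below_mem (n r : ℕ) : Target u i n (below R r) ∈ M :=
  hβ.code_apply (γ := Set ℕ × Set ℕ) (δ := Set ℕ) (f := fun p => Target p.1 i n (below p.2 r))
    inferInstance (c := (u, R)) (hβ.code_pair hu hR)

include hMI hβ hu hT hF hR in
theorem SatisfiesPi12MI.levelSeq_mem : levelSeq M u T i F R ∈ M :=
  hMI.nonlosingSeq_mem hβ hu (hβ.constSeq_mem hT)
    (hβ.code_apply (γ := (Set ℕ × Set ℕ) × Set ℕ) (δ := Set ℕ)
      (f := fun p => targetSeq p.1.1 i p.1.2 p.2) inferInstance (c := ((u, F), R))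
      (hβ.code_pair (hβ.code_pair hu hF) hR))

include hMI hβ hu hT hF hR in
theorem SatisfiesPi12MI.nextTree_mem : nextTree M u T i F R ∈ M :=
  hβ.code_apply (γ := ((Set ℕ × Set ℕ) × Set ℕ) × Set ℕ) (δ := Set ℕ)
    (f := fun p => subtree p.1.1.1 i p.1.1.2 p.1.2 p.2) inferInstance
    (c := (((u, T), R), levelSeq M u T i F R))
    (hβ.code_pair (hβ.code_pair (hβ.code_pair hu hT) hR) (hMI.levelSeq_mem hβ hu hT hF hR))

include hMI hβ hu hT hR in
/-- From a position of the subtree with state `r`, Player II can answer a strategy of Player I by a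
play that stays in the subtree until the state changes. -/
theorem IsGood.exists_play (h : IsGood M u T i F R) (hTq : IsQuasi T)
    (hb : ∀ p : List ℕ, p.length = i → num p ∈ T → num p ∈ F) {q : List ℕ} (hi : i ≤ q.length)
    (hq : num q ∈ nextTree M u T i F R) {σ : ℕ → ℕ} (hσ : code σ ∈ M) :
    ∃ x, Refutes u T ∅ q σ x ∧ ∀ n, q.length ≤ n →
      (∀ j, q.length < j → j < n → ¬ Hit u i (avoid (levelSeq M u T i F R)
        (nextState M u T i F R q)) (Game.initSeg x j)) →
      num (Game.initSeg x n) ∈ nextTree M u T i F R ∧ (∀ j, q.length ≤ j → j < n →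
        nextState M u T i F R (Game.initSeg x j) = nextState M u T i F R q) := by
  obtain ⟨x, hx, hx'⟩ := hMI.exists_play hβ hu hT (target_below_mem hβ hu hR _ _)
    (h.state_spec hTq hb hi hq).2 hσ
  refine ⟨x, hx.mono (Set.empty_subset _), fun n hn => ?_⟩
  induction n, hn using Nat.le_induction with
  | base =>
    intro _
    exact ⟨by rwa [hx.1], fun j h1 h2 => by omega⟩
  | succ n hn ih =>
    intro hj
    obtain ⟨h1, h2⟩ := ih fun j h1 h2 => hj j h1 (h2.trans n.lt_succ_self)
    have hl : i ≤ (Game.initSeg x n).length := by rw [length_initSeg]; omega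
    have e : nextState M u T i F R (Game.initSeg x n) = nextState M u T i F R q := by
      rcases Nat.eq_or_lt_of_le hn with rfl | hn
      · rw [hx.1]
      · obtain ⟨n, rfl⟩ : ∃ n', n = n' + 1 := ⟨n - 1, by omega⟩
        rw [initSeg_succ] at h1
        have e := h2 n (by omega) (by omega)
        rcases state_or hTq (by rw [length_initSeg]; omega) h1 with ⟨hh, -⟩ | ⟨-, e'⟩
        · rw [← initSeg_succ, e] at hh
          exact (hj _ hn (by omega) hh).elim
        · rw [← initSeg_succ] at e'
          rw [e', e]
    refine ⟨?_, fun j h3 h4 => ?_⟩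
    -- Safety is tested with the state before the move, so the first position inside the open set
    -- still belongs to the subtree.
    · rw [initSeg_succ, mem_subtree_concat hTq hl, ← initSeg_succ]
      refine ⟨h1, hx.2.1 _, ?_⟩
      rw [safe_levelSeq_iff]
      change _ ∈ Nonlosing M u T (Target u i (avoid _ (nextState M u T i F R _)) (below R
        (nextState M u T i F R _))) ∧ ¬ _ ∈ Target u i (avoid _ (nextState M u T i F R _)) (below R
        (nextState M u T i F R _))
      rw [e]
      exact ⟨hx' _ (by omega), hx.2.2.2.2 _ (by omega)⟩
    · rcases Nat.lt_succ_iff_lt_or_eq.1 h4 with h4 | rfl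
      · exact h2 j h3 h4
      · exact e

include hMI hβ hu hT hR in
-- Playing against the constant strategy with value b shows at once that I's move b is allowed and
-- that II has some move; below length i nothing was removed.
theorem IsGood.isQuasi (h : IsGood M u T i F R) (hTq : IsQuasi T)
    (hb : ∀ p : List ℕ, p.length = i → num p ∈ T → num p ∈ F) : IsQuasi (nextTree M u T i F R) := by
  have hplay : ∀ p : List ℕ, i ≤ p.length → num p ∈ nextTree M u T i F R → ∀ b, ∃ a,
      num (p ++ [a]) ∈ nextTree M u T i F R ∧ (p.length % 2 = 0 → a = b) := by
    intro p hi hp b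
    obtain ⟨x, hx, hx'⟩ := h.exists_play hMI hβ hu hT hR hTq hb hi hp (σ := fun _ => b)
      (hβ.code_apply (γ := Set ℕ) (Df.fun (t := fun (_ : Set ℕ) _ => b) inferInstance) hu)
    have := (hx' (p.length + 1) (by omega) fun j h1 h2 => by omega).1
    rw [initSeg_succ, hx.1] at this
    exact ⟨_, this, fun he => hx.2.2.1 _ le_rfl he⟩
  refine ⟨(mem_subtree_of_length_le (by simp)).2 hTq.nil, fun p a hp => ?_, fun p he hp a => ?_,
    fun p ho hp => ?_⟩
  · rcases le_or_gt i p.length with hi | hi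
    · exact ((mem_subtree_concat hTq hi).1 hp).1
    · exact (mem_subtree_of_length_le hi.le).2 (hTq.prefix_mem _ _ hp.1)
  · rcases le_or_gt i p.length with hi | hi
    · obtain ⟨b, hb, e⟩ := hplay p hi hp a
      rwa [← e he]
    · exact (mem_subtree_of_length_le (by simp; omega)).2 (hTq.even p he hp.1 a)
  · rcases le_or_gt i p.length with hi | hi
    · obtain ⟨b, hb, e⟩ := hplay p hi hp 0
      exact ⟨b, hb⟩
    · obtain ⟨a, ha⟩ := hTq.odd p ho hp.1
      exact ⟨a, (mem_subtree_of_length_le (by simp; omega)).2 ha⟩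

include hMI hβ hu hT hR in
/-- Player I has no winning strategy in the subtree. -/
theorem IsGood.mem_nonlosing (h : IsGood M u T i F R) (hTq : IsQuasi T)
    (hb : ∀ p : List ℕ, p.length = i → num p ∈ T → num p ∈ F) {q : List ℕ} (hi : i ≤ q.length)
    (hq : num q ∈ nextTree M u T i F R) : num q ∈ Nonlosing M u (nextTree M u T i F R) ∅ := by
  have key : ∀ r (q : List ℕ), i ≤ q.length → num q ∈ nextTree M u T i F R →
      nextState M u T i F R q = r → ∀ σ : ℕ → ℕ, code σ ∈ M →
        ∃ x, Refutes u (nextTree M u T i F R) ∅ q σ x := by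
    intro r
    induction r using h.wf.induction with
    | _ r ih =>
      intro q hi hq hr σ hσ
      obtain ⟨x, hx, hx'⟩ := h.exists_play hMI hβ hu hT hR hTq hb hi hq hσ
      rw [hr] at hx'
      have hpre : ∀ n k, k ≤ n → num (Game.initSeg x n) ∈ nextTree M u T i F R →
          num (Game.initSeg x k) ∈ nextTree M u T i F R := by
        intro n k hkn
        induction n, hkn using Nat.le_induction with
        | base => exact id
        | succ n hn ih2 =>
          intro h3
          rw [initSeg_succ] at h3
          exact ih2 ((h.isQuasi hMI hβ hu hT hR hTq hb).prefix_mem _ _ h3)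
      -- If the open set of r is never entered, the play x stays in the subtree. Otherwise, at the
      -- first entry the state drops below r, and the induction hypothesis extends that initial
      -- segment of x to a refutation of the same σ.
      by_cases hex : ∃ j, q.length < j ∧
          Hit u i (avoid (levelSeq M u T i F R) r) (Game.initSeg x j)
      · classical
        obtain ⟨hj1, hj2⟩ := Nat.find_spec hex
        have hmin : ∀ j, q.length < j → j < Nat.find hex →
            ¬ Hit u i (avoid (levelSeq M u T i F R) r) (Game.initSeg x j) := fun j h1 h2 h3 =>
          Nat.find_min hex h2 ⟨h1, h3⟩
        obtain ⟨k, hk⟩ : ∃ k, Nat.find hex = k + 1 := ⟨Nat.find hex - 1, by omega⟩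
        rw [hk] at hj1 hj2 hmin
        obtain ⟨hm, hst⟩ := hx' (k + 1) hj1.le hmin
        have hm' := hm
        rw [initSeg_succ] at hm'
        have hr' : Nat.pair (nextState M u T i F R (Game.initSeg x (k + 1))) r ∈ R := by
          rcases state_or hTq (by rw [length_initSeg]; omega) hm' with ⟨-, -, h3⟩ | ⟨h3, -⟩
          · rwa [hst k (by omega) (by omega), ← initSeg_succ] at h3
          · rw [hst k (by omega) (by omega), ← initSeg_succ] at h3
            exact (h3 hj2).elim
        obtain ⟨x', hx1, hx2, hx3, hx4, -⟩ := ih _ hr' (Game.initSeg x (k + 1))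
          (by rw [length_initSeg]; omega) hm rfl σ hσ
        rw [length_initSeg] at hx1 hx3
        have e := initSeg_eq_initSeg_iff.1 hx1
        have e' : ∀ j ≤ k + 1, Game.initSeg x' j = Game.initSeg x j := fun j hj =>
          initSeg_congr fun l hl => e l (by omega)
        refine ⟨x', by rw [e' _ hj1.le, hx.1], hx2, fun j h1 h2 => ?_, hx4, fun _ _ => id⟩
        rcases le_or_gt (k + 1) j with h3 | h3
        · exact hx3 j h3 h2
        · rw [e j h3, e' j h3.le]
          exact hx.2.2.1 j h1 h2
      · push Not at hex
        refine ⟨x, hx.1, fun k => ?_, hx.2.2⟩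
        refine hpre (q.length + k) k (by omega) (hx' _ (by omega) fun j h1 _ => hex j h1).1
  refine ⟨hq, fun σ hσ => ?_⟩
  rw [lst_encode]
  exact key _ q hi hq rfl σ hσ

end Step

/-! ### The strategy of Player II -/

/-! ### Uniqueness of the stage prewellorder. -/

section Unique

variable {M : Set (Set ℕ)} {u T F R F' R' : Set ℕ} {i : ℕ}

theorem nonlosing_mono {X Y : Set ℕ} (h : X ⊆ Y) {n m : ℕ}
    (hm : m ∈ Nonlosing M u T (Target u i n X)) : m ∈ Nonlosing M u T (Target u i n Y) :=
  ⟨hm.1, fun σ hσ => (hm.2 σ hσ).imp fun _ hx =>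
    hx.mono (show Target u i n Y ⊆ Target u i n X from fun _ hk => ⟨hk.1, fun hX => hk.2 (h hX)⟩)⟩

theorem IsGood.irrefl (h : IsGood M u T i F R) (k : ℕ) : ¬ Nat.pair k k ∈ R := h.wf.irrefl.irrefl k

theorem IsGood.below_subset (h : IsGood M u T i F R) (k : ℕ) : below R k ⊆ F :=
  fun _ hm => (h.field _ _ hm).1

theorem IsGood.exists_nonlosing (h : IsGood M u T i F R) {k : ℕ} (hk : k ∈ F) :
    ∃ n, k ∈ Nonlosing M u T (Target u i n (below R k)) :=
  ((h.stage k hk k).2 ⟨hk, h.irrefl k⟩).resolve_right (h.irrefl k)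

/-- By induction along ≺, every closed set absorbs each stage; only closure of F' is used. -/
theorem IsGood.subset (h : IsGood M u T i F R) (h' : IsGood M u T i F' R') : F ⊆ F' := by
  intro k
  induction k using h.wf.induction with
  | _ k ih =>
    intro hk
    obtain ⟨n, hn⟩ := h.exists_nonlosing hk
    exact h'.closed k n (nonlosing_mono (fun m hm => ih m hm (h.below_subset k hm)) hn)

theorem IsGood.notMem_of_below_eq (h : IsGood M u T i F R) (h' : IsGood M u T i F' R') {k m l : ℕ}
    (hk : k ∈ F) (hm : m ∈ F') (e : below R k = below R' m) :
    (l ∈ F ∧ ¬ Nat.pair k l ∈ R) ↔ (l ∈ F' ∧ ¬ Nat.pair m l ∈ R') := by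
  rw [← h.stage k hk, ← h'.stage m hm, e]
  exact or_congr_right (Set.ext_iff.1 e l)

/-- Two elements with the same predecessors in the two prewellorders enter at the same stage
(`IsGood.notMem_of_below_eq`); comparison then proceeds by induction on k. -/
theorem IsGood.below_eq (h : IsGood M u T i F R) (h' : IsGood M u T i F' R') {k : ℕ} (hk : k ∈ F) :
    below R k = below R' k := by
  have hF : F = F' := (h.subset h').antisymm (h'.subset h)
  subst hF
  induction k using h.wf.induction with
  | _ k ih =>
    have hsub : below R k ⊆ below R' k := by
      intro m hm
      have hmF := h.below_subset k hm
      by_contra hn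
      exact ((h.notMem_of_below_eq h' hmF hmF (ih m hm hmF)).2 ⟨hk, hn⟩).2 hm
    refine hsub.antisymm fun m hm => ?_
    by_contra hn
    -- A minimal surplus predecessor m' of k turns out to have the same predecessors as k. Then it
    -- enters together with k, contrary to its preceding k.
    obtain ⟨m', ⟨hm1, hm2⟩, hmin⟩ := h'.wf.has_min {m | Nat.pair m k ∈ R' ∧ ¬ Nat.pair m k ∈ R}
      ⟨m, hm, hn⟩
    have hmF := (h'.field _ _ hm1).1
    have e : below R k = below R' m' := by
      refine Set.Subset.antisymm (fun y hy => ?_) fun y hy => ?_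
      · have hyF := h.below_subset k hy
        have h1 : ¬ Nat.pair m' y ∈ R' := by
          intro h1
          have : m' ∈ below R y := (ih y hy hyF).symm ▸ h1
          exact hm2 (h.trans _ _ _ this hy)
        by_contra h2
        have e : below R y = below R' m' := by
          rw [ih y hy hyF]
          ext l
          constructor
          · intro hl
            exact (h'.compare _ _ hl m' hmF).resolve_right h1
          · intro hl
            exact (h'.compare _ _ hl y hyF).resolve_right h2
        have h3 := ((h.notMem_of_below_eq h' hyF hmF e).2 ⟨hmF, h'.irrefl m'⟩).2
        rcases h.compare _ _ hy m' hmF with h4 | h4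
        · exact h3 h4
        · exact hm2 h4
      · by_contra h1
        exact hmin y ⟨h'.trans _ _ _ hy hm1, h1⟩ hy
    exact ((h.notMem_of_below_eq h' hk hmF e).1 ⟨hk, h.irrefl k⟩).2 hm1

theorem IsGood.unique (h : IsGood M u T i F R) (h' : IsGood M u T i F' R') : F = F' ∧ R = R' := by
  have hs : ∀ {F R F' R'}, IsGood M u T i F R → IsGood M u T i F' R' → R ⊆ R' := by
    intro F R F' R' h h' p hp
    rw [← Nat.pair_unpair p] at hp ⊢
    have := h.below_eq h' (h.field _ _ hp).2
    exact this.subset hp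
  exact ⟨(h.subset h').antisymm (h'.subset h), (hs h h').antisymm (hs h' h)⟩

end Unique

/-! ### The descending trees and the diagonal strategy. -/

section Sequence

variable (M : Set (Set ℕ)) (u : Set ℕ)

open Classical in
/-- The stage prewellorder of the `i`-th operator for the tree `T`, with its field. -/
noncomputable def goodPair (T : Set ℕ) (i : ℕ) : Set ℕ × Set ℕ :=
  if h : ∃ p : Set ℕ × Set ℕ, p.1 ∈ M ∧ p.2 ∈ M ∧ IsGood M u T i p.1 p.2 then h.choose else (∅, ∅)

/-- The descending sequence of quasi-strategies. -/
noncomputable def tree : ℕ → Set ℕ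
  | 0 => Set.univ
  | i + 1 => nextTree M u (tree i) i (goodPair M u (tree i) i).1 (goodPair M u (tree i) i).2

/-- The strategy of Player II. -/
noncomputable def stratII (p : List ℕ) : ℕ :=
  sInf {a | num (p ++ [a]) ∈ tree M u (p.length + 1)}

variable {M u} (hMI : SatisfiesPi12MI M) (hβ : IsBetaModel M) (hu : u ∈ M)

include hMI hβ hu in
theorem goodPair_spec {T : Set ℕ} (hT : T ∈ M) (i : ℕ) : (goodPair M u T i).1 ∈ M ∧
    (goodPair M u T i).2 ∈ M ∧ IsGood M u T i (goodPair M u T i).1 (goodPair M u T i).2 := by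
  have h : ∃ p : Set ℕ × Set ℕ, p.1 ∈ M ∧ p.2 ∈ M ∧ IsGood M u T i p.1 p.2 := by
    obtain ⟨F, hF, R, hR, h⟩ := hMI.exists_isGood hβ hu hT i
    exact ⟨(F, R), hF, hR, h⟩
  rw [goodPair, dif_pos h]
  exact h.choose_spec

include hMI hβ hu in
theorem tree_mem (i : ℕ) : tree M u i ∈ M := by
  induction i with
  | zero =>
    exact hβ.code_apply (γ := Set ℕ) (δ := Set ℕ) (f := fun X => {k | k ∈ X ∨ ¬ k ∈ X})
      inferInstance hu |> fun h => by
        convert h using 1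
        ext k
        simpa [tree, code] using em _
  | succ i ih =>
    obtain ⟨hF, hR, -⟩ := goodPair_spec hMI hβ hu ih i
    exact hMI.nextTree_mem hβ hu ih hF hR

variable (h0 : ∀ σ : ℕ → ℕ, code σ ∈ M → ¬ Wins u Set.univ ∅ [] σ)

include hMI hβ hu h0 in
-- The two properties feed each other: nonlosing positions of length i cannot lie outside F, by
-- `IsGood.exists_wins`, and this is what the refinement step needs to produce the next
-- quasi-strategy.
theorem tree_spec (i : ℕ) : IsQuasi (tree M u i) ∧
    ∀ q : List ℕ, q.length = i → num q ∈ tree M u i → num q ∈ Nonlosing M u (tree M u i) ∅ := by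
  induction i with
  | zero =>
    refine ⟨⟨trivial, fun _ _ _ => trivial, fun _ _ _ _ => trivial, fun _ _ _ => ⟨0, trivial⟩⟩,
      fun q hq _ => ⟨trivial, fun σ hσ => ?_⟩⟩
    rw [List.length_eq_zero_iff.1 hq, lst_encode]
    have := h0 σ hσ
    rw [Wins, not_forall_not] at this
    exact this
  | succ i ih =>
    have hT := tree_mem hMI hβ hu i
    obtain ⟨hF, hR, h⟩ := goodPair_spec hMI hβ hu hT i
    have hb : ∀ p : List ℕ, p.length = i → num p ∈ tree M u i →
        num p ∈ (goodPair M u (tree M u i) i).1 := by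
      intro p hp hpT
      by_contra hpF
      obtain ⟨σ, hσ, hw⟩ := h.exists_wins hMI hβ hu hT hF hpF
      obtain ⟨x, hx⟩ := (ih.2 p hp hpT).2 σ hσ
      rw [lst_encode] at hx
      exact hw x hx
    exact ⟨h.isQuasi hMI hβ hu hT hR ih.1 hb, fun q hq hqT =>
      h.mem_nonlosing hMI hβ hu hT hR ih.1 hb (by omega) hqT⟩

include hMI hβ hu h0 in
/-- The strategy of Player II wins. -/
theorem stratII_wins {x : ℕ → ℕ}
    (hx : ∀ n, x (2 * n + 1) = stratII M u (Game.initSeg x (2 * n + 1))) : ¬ Payoff u x := by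
  have hq := fun i => (tree_spec hMI hβ hu h0 i).1
  have hsucc : ∀ k, num (Game.initSeg x k) ∈ tree M u k := by
    intro k
    induction k with
    | zero => trivial
    | succ k ih =>
      -- The k-th refinement removes only positions of length greater than k, so the tree for the
      -- next move is entered for free.
      have hk : num (Game.initSeg x k) ∈ tree M u (k + 1) :=
        (mem_subtree_of_length_le (by rw [length_initSeg])).2 ih
      rw [initSeg_succ]
      rcases Nat.even_or_odd' k with ⟨n, rfl | rfl⟩
      · exact (hq _).even _ (by rw [length_initSeg]; omega) hk _
      · have hne := (hq _).odd _ (by rw [length_initSeg]; omega) hk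
        rw [hx n, stratII, length_initSeg]
        exact Nat.sInf_mem (s := {a | num (Game.initSeg x (2 * n + 1) ++ [a]) ∈
          tree M u (2 * n + 1 + 1)}) hne
  have hanti : ∀ i k, i ≤ k → tree M u k ⊆ tree M u i := by
    intro i k hik
    induction k, hik using Nat.le_induction with
    | base => exact subset_rfl
    | succ k _ ih => exact subtree_subset.trans ih
  have hall : ∀ i k, num (Game.initSeg x k) ∈ tree M u i := by
    intro i k
    have : ∀ n, num (Game.initSeg x (k + n)) ∈ tree M u i → num (Game.initSeg x k) ∈ tree M u i := by
      intro n
      induction n with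
      | zero => exact id
      | succ n ih =>
        intro h
        rw [← add_assoc, initSeg_succ] at h
        exact ih ((hq i).prefix_mem _ _ h)
    -- A longer initial segment lies in a later, hence smaller, tree; closure under prefixes brings
    -- the membership down.
    exact this i (hanti _ _ (by omega) (hsucc (k + i)))
  rintro ⟨i, hi⟩
  exact (goodPair_spec hMI hβ hu (tree_mem hMI hβ hu i) i).2.2.not_gDelta (hq i) (hall (i + 1)) hi

end Sequence

/-! ### Definability of the strategy of Player II -/

/-- `F`, `R` and `N` satisfy the arithmetical conditions on a stage prewellorder and its nonlosing
positions, `Z` is not refuted by `y`, and `y` is not a descending sequence. -/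
def Certified (u : Set ℕ) (i : ℕ) (T F R N : Set ℕ) (Z y : ℕ → ℕ) : Prop :=
  (∀ m n, Nat.pair m n ∈ R → m ∈ F ∧ n ∈ F) ∧
    (∀ k m n, Nat.pair k m ∈ R → Nat.pair m n ∈ R → Nat.pair k n ∈ R) ∧
    (∀ m n, Nat.pair m n ∈ R → ∀ k, k ∈ F → Nat.pair m k ∈ R ∨ Nat.pair k n ∈ R) ∧
    (∀ k, k ∈ F → ∀ m, ((∃ n, Nat.pair (Nat.pair n (k + 1)) m ∈ N) ∨ Nat.pair m k ∈ R) ↔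
      m ∈ F ∧ ¬ Nat.pair k m ∈ R) ∧
    (∀ m n, Nat.pair (Nat.pair n 0) m ∈ N → m ∈ F) ∧
    (∀ t, t ∈ N → (Nat.unpair t).2 ∈ T) ∧
    (∀ t, ¬ t ∈ N → (Nat.unpair t).2 ∈ T →
      ¬ Refutes u T (sect (targetSeq u i F R) (Nat.unpair t).1) (lst (Nat.unpair t).2) (row Z t) y) ∧
    ¬ ∀ n, Nat.pair (y (n + 1)) (y n) ∈ R

/-- If `y` codes a nonlosing position and a strategy then `x` refutes the strategy. -/
def Answers (u : Set ℕ) (i : ℕ) (T F R N : Set ℕ) (y x : ℕ → ℕ) : Prop :=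
  i = (Nat.unpair (y 0)).1 → (Nat.unpair (y 0)).2 ∈ N →
    Refutes u T (sect (targetSeq u i F R) (Nat.unpair (Nat.unpair (y 0)).2).1)
      (lst (Nat.unpair (Nat.unpair (y 0)).2).2) (fun k => y (k + 1)) x

/-- The `j`-th member of the `c`-th sequence coded by `S`. -/
def entry (S : Set ℕ) (c j : ℕ) : Set ℕ := sect (sect S c) j

/-- `S` codes the first trees with their stage prewellorders, as far as `y` and `x` can tell. -/
def Coherent (u S : Set ℕ) (n : ℕ) (y x : ℕ → ℕ) : Prop :=
  (∀ m, m ∈ entry S 0 0) ∧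
    (∀ j, j < n → entry S 0 (j + 1) = subtree u j (entry S 0 j) (entry S 2 j) (entry S 3 j)) ∧
    ∀ j, j ≤ n →
      Certified u j (entry S 0 j) (entry S 1 j) (entry S 2 j) (entry S 3 j) (fn (entry S 4 j)) y ∧
        Answers u j (entry S 0 j) (entry S 1 j) (entry S 2 j) (entry S 3 j) y x

/-- The value of the strategy at a position, computed from `S`. -/
def Value (u S : Set ℕ) (k : ℕ) : Prop :=
  (Nat.unpair k).2 = sInf {a | num (lst (Nat.unpair k).1 ++ [a]) ∈
    subtree u (lst (Nat.unpair k).1).length (entry S 0 (lst (Nat.unpair k).1).length)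
      (entry S 2 (lst (Nat.unpair k).1).length) (entry S 3 (lst (Nat.unpair k).1).length)}

section Definability

variable {γ : Type} [Dom γ] {u T F R N S : γ → Set ℕ} {i : γ → ℕ} {Z y x : γ → ℕ → ℕ}

instance Df.setEq {X Y : γ → Set ℕ} [hX : Df X] [hY : Df Y] : Df fun c => X c = Y c :=
  Df.comp (f := fun p : Set ℕ × Set ℕ => p.1 = p.2) (g := fun c => (X c, Y c))
    (Df.of_eq (f := fun p : Set ℕ × Set ℕ => ∀ k, k ∈ p.1 ↔ k ∈ p.2) inferInstance
      fun _ => propext Set.ext_iff.symm) inferInstance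

instance Df.entry {c j : γ → ℕ} [hS : Df S] [hc : Df c] [hj : Df j] :
    Df fun p => entry (S p) (c p) (j p) :=
  inferInstanceAs (Df fun p => sect (sect (S p) (c p)) (j p))

instance Df.certified [hu : Df u] [hi : Df i] [hT : Df T] [hF : Df F] [hR : Df R] [hN : Df N]
    [hZ : Df Z] [hy : Df y] :
    Df fun c => Certified (u c) (i c) (T c) (F c) (R c) (N c) (Z c) (y c) :=
  Df.comp (f := fun p : ((((((Set ℕ × ℕ) × Set ℕ) × Set ℕ) × Set ℕ) × Set ℕ) × (ℕ → ℕ)) × (ℕ → ℕ) =>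
      Certified p.1.1.1.1.1.1.1 p.1.1.1.1.1.1.2 p.1.1.1.1.1.2 p.1.1.1.1.2 p.1.1.1.2 p.1.1.2 p.1.2 p.2)
    (g := fun c => (((((((u c, i c), T c), F c), R c), N c), Z c), y c))
    (by unfold Certified; infer_instance) inferInstance

theorem Df.tail : Df fun (y : ℕ → ℕ) k => y (k + 1) :=
  Df.fun (t := fun (y : ℕ → ℕ) k => y (k + 1)) inferInstance

instance Df.answers [hu : Df u] [hi : Df i] [hT : Df T] [hF : Df F] [hR : Df R] [hN : Df N]
    [hy : Df y] [hx : Df x] :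
    Df fun c => Answers (u c) (i c) (T c) (F c) (R c) (N c) (y c) (x c) := by
  refine Df.comp
    (f := fun p : ((((((Set ℕ × ℕ) × Set ℕ) × Set ℕ) × Set ℕ) × Set ℕ) × (ℕ → ℕ)) × (ℕ → ℕ) =>
      Answers p.1.1.1.1.1.1.1 p.1.1.1.1.1.1.2 p.1.1.1.1.1.2 p.1.1.1.1.2 p.1.1.1.2 p.1.1.2 p.1.2 p.2)
    (g := fun c => (((((((u c, i c), T c), F c), R c), N c), y c), x c)) ?_ inferInstance
  unfold Answers
  have : Df fun p : ((((((Set ℕ × ℕ) × Set ℕ) × Set ℕ) × Set ℕ) × Set ℕ) × (ℕ → ℕ)) × (ℕ → ℕ) =>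
      fun k => p.1.2 (k + 1) := Df.tail.comp (g := fun p :
        ((((((Set ℕ × ℕ) × Set ℕ) × Set ℕ) × Set ℕ) × Set ℕ) × (ℕ → ℕ)) × (ℕ → ℕ) => p.1.2) inferInstance
  infer_instance

instance Df.coherent {n : γ → ℕ} [hu : Df u] [hS : Df S] [hn : Df n] [hy : Df y] [hx : Df x] :
    Df fun c => Coherent (u c) (S c) (n c) (y c) (x c) :=
  Df.comp (f := fun p : (((Set ℕ × Set ℕ) × ℕ) × (ℕ → ℕ)) × (ℕ → ℕ) =>
      Coherent p.1.1.1.1 p.1.1.1.2 p.1.1.2 p.1.2 p.2)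
    (g := fun c => ((((u c, S c), n c), y c), x c)) (by unfold Coherent; infer_instance) inferInstance

instance Df.value {k : γ → ℕ} [hu : Df u] [hS : Df S] [hk : Df k] :
    Df fun c => Value (u c) (S c) (k c) :=
  Df.comp (f := fun p : (Set ℕ × Set ℕ) × ℕ => Value p.1.1 p.1.2 p.2)
    (g := fun c => ((u c, S c), k c)) (by unfold Value; infer_instance) inferInstance

end Definability

/-! ### The Π¹₂ conditions characterise the construction. -/

section Correctness

variable {M : Set (Set ℕ)} {u T F R N : Set ℕ} {i : ℕ} {Z : ℕ → ℕ}

theorem sect_targetSeq_mem (hβ : IsBetaModel M) (hu : u ∈ M) (hF : F ∈ M) (hR : R ∈ M) (i a : ℕ) :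
    sect (targetSeq u i F R) a ∈ M :=
  hβ.code_apply (γ := (Set ℕ × Set ℕ) × Set ℕ) (δ := Set ℕ)
    (f := fun p => sect (targetSeq p.1.1 i p.1.2 p.2) a) inferInstance (c := ((u, F), R))
    (hβ.code_pair (hβ.code_pair hu hF) hR)

theorem mem_levelSeq_iff {t : ℕ} : t ∈ levelSeq M u T i F R ↔ (Nat.unpair t).2 ∈
    Nonlosing M u T (sect (targetSeq u i F R) (Nat.unpair t).1) := by
  rw [sect_targetSeq, ← mem_levelSeq, Nat.pair_unpair, Nat.pair_unpair]

theorem IsGood.certified (h : IsGood M u T i F R)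
    (hZ : ∀ t, ¬ t ∈ levelSeq M u T i F R → (Nat.unpair t).2 ∈ T → Wins u T
      (sect (targetSeq u i F R) (Nat.unpair t).1) (lst (Nat.unpair t).2) (row Z t)) (y : ℕ → ℕ) :
    Certified u i T F R (levelSeq M u T i F R) Z y := by
  refine ⟨h.field, h.trans, h.compare, fun k hk m => ?_, fun m n hm => ?_, fun t ht => ?_,
    fun t ht htT => hZ t ht htT y, fun hd => ?_⟩
  · simp only [mem_levelSeq, level_succ]
    exact h.stage k hk m
  · rw [mem_levelSeq, level_zero] at hm
    exact h.closed m n hm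
  · exact (mem_levelSeq_iff.1 ht).1
  · exact (wellFounded_iff_isEmpty_descending_chain.1 h.wf).false ⟨y, hd⟩

/-- The set `N` is certified from both sides: every claimed nonlosing position must answer every
strategy, and every other position of `T` comes with a strategy in `Z` that no y refutes. Once `N`
is correct, the remaining clauses are arithmetical, apart from well-foundedness, which is Π¹₁. -/
theorem isGood_of_certified (hβ : IsBetaModel M) (hu : u ∈ M) (hT : T ∈ M) (hF : F ∈ M) (hR : R ∈ M)
    (hZ : code Z ∈ M) (h : ∀ y : ℕ → ℕ, code y ∈ M → ∃ x,
      Certified u i T F R N Z y ∧ Answers u i T F R N y x) :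
    IsGood M u T i F R ∧ N = levelSeq M u T i F R := by
  have hf : code (fn u) ∈ M := hβ.code_apply (Df.fn_comp (X := fun X => X)) hu
  obtain ⟨_, ⟨h1, h2, h3, h4, h5, h6, -⟩, -⟩ := h _ hf
  have hN : N = levelSeq M u T i F R := by
    ext t
    rw [mem_levelSeq_iff]
    constructor
    · refine fun ht => ⟨h6 t ht, fun σ hσ => ?_⟩
      -- The challenge puts the level and the claimed position into its value at 0 and the strategy,
      -- shifted by one, after it.
      obtain ⟨x, -, hx⟩ := h (fun k => if k = 0 then Nat.pair i t else σ (k - 1))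
        (hβ.code_apply (γ := ℕ → ℕ) (f := fun σ k => if k = 0 then Nat.pair i t else σ (k - 1))
          (Df.fun (t := fun (σ : ℕ → ℕ) k => if k = 0 then Nat.pair i t else σ (k - 1))
            inferInstance) hσ)
      simp only [Answers, if_true, Nat.unpair_pair, Nat.add_one_ne_zero, if_false,
        Nat.add_sub_cancel] at hx
      exact ⟨x, hx trivial ht⟩
    · rintro ⟨htT, ht⟩
      by_contra htN
      -- For a nonlosing position outside `N` the strategy in `Z` would be refuted within `M`,
      -- against the certificate.
      obtain ⟨x, hx, hr⟩ := hβ.exists_refutes hu hT (sect_targetSeq_mem hβ hu hF hR i _)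
        (hβ.code_apply (γ := ℕ → ℕ) (f := fun Z => row Z t) inferInstance hZ)
        (ht _ (hβ.code_apply (γ := ℕ → ℕ) (f := fun Z => row Z t) inferInstance hZ))
      obtain ⟨_, ⟨-, -, -, -, -, -, h7, -⟩, -⟩ := h x hx
      exact h7 t htN htT hr
  refine ⟨⟨?_, h1, h2, h3, fun k hk m => ?_, fun m n hm => ?_⟩, hN⟩
  · refine wellFounded_iff_isEmpty_descending_chain.2 ⟨fun ⟨f, hf⟩ => ?_⟩
    have hd : Df fun p : Set ℕ × (ℕ → ℕ) => ∀ n, Nat.pair (p.2 (n + 1)) (p.2 n) ∈ p.1 :=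
      inferInstance
    obtain ⟨y, hy, hyd⟩ := hβ.exists_real (γ := Set ℕ) (P := fun R y =>
      ∀ n, Nat.pair (y (n + 1)) (y n) ∈ R) hd hR ⟨f, hf⟩
    obtain ⟨_, ⟨-, -, -, -, -, -, -, h8⟩, -⟩ := h y hy
    exact h8 hyd
  · have := h4 k hk m
    simpa only [hN, mem_levelSeq, level_succ] using this
  · refine h5 m n ?_
    rwa [hN, mem_levelSeq, level_zero]

/-- Winning strategies from the losing positions. -/
theorem SatisfiesPi12MI.exists_levelStrategy (hMI : SatisfiesPi12MI M) (hβ : IsBetaModel M)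
    (hu : u ∈ M) (hT : T ∈ M) (hF : F ∈ M) (hR : R ∈ M) (i : ℕ) : ∃ Z : ℕ → ℕ, code Z ∈ M ∧
      ∀ t, ¬ t ∈ levelSeq M u T i F R → (Nat.unpair t).2 ∈ T → Wins u T
        (sect (targetSeq u i F R) (Nat.unpair t).1) (lst (Nat.unpair t).2) (row Z t) := by
  have hc : targetSeq u i F R ∈ M := hβ.code_apply (γ := (Set ℕ × Set ℕ) × Set ℕ) (δ := Set ℕ)
    (f := fun p => targetSeq p.1.1 i p.1.2 p.2) inferInstance (c := ((u, F), R))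
    (hβ.code_pair (hβ.code_pair hu hF) hR)
  obtain ⟨Z, hZ, h⟩ := hMI.exists_strategies hβ hu (hβ.constSeq_mem hT) hc
  refine ⟨Z, hZ, fun t ht htT => ?_⟩
  have := h (Nat.unpair t).1 (lst (Nat.unpair t).2)
  rw [sect_constSeq, num, encode_lst, Nat.pair_unpair] at this
  refine this (exists_wins_of_notMem (by rwa [num, encode_lst]) ?_)
  rwa [num, encode_lst, ← mem_levelSeq_iff]

/-- The sequence of the first `n` of given sets. -/
def upTo (n : ℕ) (g : ℕ → Set ℕ) : Set ℕ := {k | (Nat.unpair k).1 < n ∧ (Nat.unpair k).2 ∈ g (Nat.unpair k).1}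

theorem sect_upTo {n j : ℕ} (g : ℕ → Set ℕ) (h : j < n) : sect (upTo n g) j = g j := by
  ext k
  simp [sect, upTo, h]

theorem IsBetaModel.upTo_mem (hβ : IsBetaModel M) {g : ℕ → Set ℕ} (hg : ∀ j, g j ∈ M) (n : ℕ) :
    upTo n g ∈ M := by
  induction n with
  | zero =>
    have := hβ.code_apply (γ := Set ℕ) (δ := Set ℕ) (f := fun X => {k | k ∈ X ∧ ¬ k ∈ X})
      inferInstance (c := g 0) (hg 0)
    convert this using 1
    ext k
    simp [upTo, code]
  | succ n ih =>
    have := hβ.code_apply (γ := Set ℕ × Set ℕ) (δ := Set ℕ)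
      (f := fun p => {k | k ∈ p.1 ∨ ((Nat.unpair k).1 = n ∧ (Nat.unpair k).2 ∈ p.2)}) inferInstance
      (c := (upTo n g, g n)) (hβ.code_pair ih (hg n))
    convert this using 1
    ext k
    change _ ↔ (_ ∧ _) ∨ _ ∧ _
    constructor
    · rintro ⟨h1, h2⟩
      rcases Nat.lt_succ_iff_lt_or_eq.1 h1 with h1 | h1
      · exact Or.inl ⟨h1, h2⟩
      · exact Or.inr ⟨h1, h1 ▸ h2⟩
    · rintro (⟨h1, h2⟩ | ⟨h1, h2⟩)
      · exact ⟨h1.trans n.lt_succ_self, h2⟩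
      · exact ⟨h1 ▸ n.lt_succ_self, by rwa [h1]⟩

variable (hMI : SatisfiesPi12MI M) (hβ : IsBetaModel M) (hu : u ∈ M)

include hMI hβ hu in
theorem exists_coherent (n : ℕ) : ∃ S ∈ M, ∀ y : ℕ → ℕ, code y ∈ M →
    ∃ x : ℕ → ℕ, code x ∈ M ∧ Coherent u S n y x := by
  have hT := tree_mem hMI hβ hu
  have hg := fun i => goodPair_spec hMI hβ hu (hT i) i
  choose Z hZ hw using fun i => hMI.exists_levelStrategy hβ hu (hT i) (hg i).1 (hg i).2.1 i
  set g : ℕ → ℕ → Set ℕ := fun c j => if c = 0 then tree M u j else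
    if c = 1 then (goodPair M u (tree M u j) j).1 else
    if c = 2 then (goodPair M u (tree M u j) j).2 else
    if c = 3 then levelSeq M u (tree M u j) j (goodPair M u (tree M u j) j).1
      (goodPair M u (tree M u j) j).2 else realCode (Z j) with hgdef
  have hgM : ∀ c j, g c j ∈ M := by
    intro c j
    simp only [hgdef]
    split_ifs
    exacts [hT j, (hg j).1, (hg j).2.1, hMI.levelSeq_mem hβ hu (hT j) (hg j).1 (hg j).2.1, hZ j]
  refine ⟨upTo 5 fun c => upTo (n + 1) (g c), hβ.upTo_mem (fun c => hβ.upTo_mem (hgM c) _) _,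
    fun y hy => ?_⟩
  have e : ∀ c < 5, ∀ j ≤ n, entry (upTo 5 fun c => upTo (n + 1) (g c)) c j = g c j := fun c hc j hj => by
    rw [entry, sect_upTo _ hc, sect_upTo _ (Nat.lt_succ_of_le hj)]
  have e0 : ∀ j ≤ n, entry (upTo 5 fun c => upTo (n + 1) (g c)) 0 j = tree M u j := e 0 (by norm_num)
  have e1 := e 1 (by norm_num)
  have e2 := e 2 (by norm_num)
  have e3 := e 3 (by norm_num)
  have e4 := e 4 (by norm_num)
  simp only [hgdef, one_ne_zero, OfNat.ofNat_ne_zero, OfNat.ofNat_ne_one, if_false, if_true,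
    show (3 : ℕ) ≠ 2 by norm_num, show (4 : ℕ) ≠ 2 by norm_num, show (4 : ℕ) ≠ 3 by norm_num]
    at e1 e2 e3 e4
  -- A challenge y names only one level, so a single x answers at all levels; if nothing is
  -- demanded, y itself serves.
  have hx : ∃ x : ℕ → ℕ, code x ∈ M ∧ ∀ j, Answers u j (tree M u j)
      (goodPair M u (tree M u j) j).1 (goodPair M u (tree M u j) j).2
      (levelSeq M u (tree M u j) j (goodPair M u (tree M u j) j).1
        (goodPair M u (tree M u j) j).2) y x := by
    obtain ⟨j, hj⟩ : ∃ j, j = (Nat.unpair (y 0)).1 := ⟨_, rfl⟩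
    by_cases hN : (Nat.unpair (y 0)).2 ∈ levelSeq M u (tree M u j) j
      (goodPair M u (tree M u j) j).1 (goodPair M u (tree M u j) j).2
    · have hσ : code (fun k => y (k + 1)) ∈ M := hβ.code_apply Df.tail hy
      obtain ⟨x, hx, h⟩ := hβ.exists_refutes hu (hT j)
        (sect_targetSeq_mem hβ hu (hg j).1 (hg j).2.1 j _) hσ ((mem_levelSeq_iff.1 hN).2 _ hσ)
      refine ⟨x, hx, fun j' hj' _ => ?_⟩
      obtain rfl := hj'.trans hj.symm
      exact h
    · refine ⟨y, hy, fun j' hj' hN' => ?_⟩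
      obtain rfl := hj'.trans hj.symm
      exact (hN hN').elim
  obtain ⟨x, hx, h⟩ := hx
  refine ⟨x, hx, fun m => ?_, fun j hj => ?_, fun j hj => ?_⟩
  · rw [e0 0 (Nat.zero_le _)]
    trivial
  · rw [e0 _ hj, e0 _ hj.le, e2 _ hj.le, e3 _ hj.le]
    rfl
  · rw [e0 _ hj, e1 _ hj, e2 _ hj, e3 _ hj, e4 _ hj, fn_realCode]
    exact ⟨(hg j).2.2.certified (hw j) y, h j⟩

include hMI hβ hu in
-- Induction on the level: the trees determine the prewellorders by uniqueness, and these determine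
-- the next tree. The set F need not be tracked separately, since the refinement uses only ≺ and the
-- nonlosing positions.
theorem entry_eq_of_coherent {S : Set ℕ} (hS : S ∈ M) {n : ℕ} (h : ∀ y : ℕ → ℕ, code y ∈ M →
    ∃ x : ℕ → ℕ, code x ∈ M ∧ Coherent u S n y x) : ∀ j ≤ n, entry S 0 j = tree M u j ∧
      entry S 2 j = (goodPair M u (tree M u j) j).2 ∧
      entry S 3 j = levelSeq M u (tree M u j) j (goodPair M u (tree M u j) j).1
        (goodPair M u (tree M u j) j).2 := by
  have hf : code (fn u) ∈ M := hβ.code_apply (Df.fn_comp (X := fun X => X)) hu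
  obtain ⟨_, -, h0, h1, -⟩ := h _ hf
  have hc : ∀ c j, entry S c j ∈ M := fun c j =>
    hβ.code_apply (γ := Set ℕ) (δ := Set ℕ) (f := fun S => entry S c j) inferInstance hS
  have key : ∀ j ≤ n, entry S 0 j = tree M u j → entry S 2 j = (goodPair M u (tree M u j) j).2 ∧
      entry S 3 j = levelSeq M u (tree M u j) j (goodPair M u (tree M u j) j).1
        (goodPair M u (tree M u j) j).2 := by
    intro j hj e
    obtain ⟨hG, hN⟩ := isGood_of_certified hβ hu (hc 0 j) (hc 1 j) (hc 2 j) (i := j)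
      (N := entry S 3 j) (Z := fn (entry S 4 j))
      (hβ.code_apply (Df.fn_comp (X := fun X => X)) (hc 4 j)) fun y hy => by
        obtain ⟨x, -, -, -, hx⟩ := h y hy
        exact ⟨x, hx j hj⟩
    rw [e] at hG hN
    obtain ⟨e1, e2⟩ := hG.unique (goodPair_spec hMI hβ hu (tree_mem hMI hβ hu j) j).2.2
    rw [hN, e1, e2]
    exact ⟨rfl, rfl⟩
  intro j hj
  suffices e : entry S 0 j = tree M u j from ⟨e, key j hj e⟩
  induction j with
  | zero =>
    exact Set.eq_univ_of_forall h0
  | succ j ih =>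
    have e := ih (Nat.le_of_succ_le hj)
    obtain ⟨e2, e3⟩ := key j (Nat.le_of_succ_le hj) e
    rw [h1 j hj, e, e2, e3]
    rfl

include hMI hβ hu in
theorem value_iff_of_coherent {S : Set ℕ} (hS : S ∈ M) {k : ℕ} (h : ∀ y : ℕ → ℕ, code y ∈ M →
    ∃ x : ℕ → ℕ, code x ∈ M ∧ Coherent u S (lst (Nat.unpair k).1).length y x) :
    Value u S k ↔ k ∈ Game.strategyCode (stratII M u) := by
  obtain ⟨e0, e2, e3⟩ := entry_eq_of_coherent hMI hβ hu hS h _ le_rfl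
  rw [Value, e0, e2, e3]
  change (Nat.unpair k).2 = stratII M u (lst (Nat.unpair k).1) ↔ _
  constructor
  · intro h
    refine ⟨lst (Nat.unpair k).1, ?_⟩
    rw [← h, encode_lst, Nat.pair_unpair]
  · rintro ⟨p, rfl⟩
    rw [Nat.unpair_pair, lst_encode]

include hMI hβ hu in
/-- The strategy of Player II is `Δ¹₃` over the model. -/
theorem isDelta13Over_stratII {z : ℕ → ℕ} {γ : Type} [Dom γ] (c : γ) (hc : code c = realCode z)
    (hd : Df fun _ : γ => u) : IsDelta13Over M z (Game.strategyCode (stratII M u)) := by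
  have hd' : Df fun _ : (((γ × ℕ) × Set ℕ) × (ℕ → ℕ)) × (ℕ → ℕ) => u :=
    hd.comp (g := fun p : (((γ × ℕ) × Set ℕ) × (ℕ → ℕ)) × (ℕ → ℕ) => p.1.1.1.1) inferInstance
  obtain ⟨φ, h1, h2⟩ := Df.sigma13 hβ (γ := γ) (P := fun _ k S y x =>
    Coherent u S (lst (Nat.unpair k).1).length y x ∧ Value u S k) inferInstance
  obtain ⟨ψ, h3, h4⟩ := Df.pi13 hβ (γ := γ) (P := fun _ k S y x =>
    Coherent u S (lst (Nat.unpair k).1).length y x ∧ ¬ Value u S k) inferInstance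
  have hf : code (fn u) ∈ M := hβ.code_apply (Df.fn_comp (X := fun X => X)) hu
  -- The arithmetical condition on S does not involve y and x, so it can be moved out of the
  -- quantifiers over them; one instance of y suffices to recover it.
  have hex : ∀ k, ∀ Q : Set ℕ → Prop, (∃ S ∈ M, ∀ y : ℕ → ℕ, code y ∈ M → ∃ x : ℕ → ℕ, code x ∈ M ∧
      (Coherent u S (lst (Nat.unpair k).1).length y x ∧ Q S)) ↔ ∃ S ∈ M, (∀ y : ℕ → ℕ, code y ∈ M →
        ∃ x : ℕ → ℕ, code x ∈ M ∧ Coherent u S (lst (Nat.unpair k).1).length y x) ∧ Q S := by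
    refine fun k Q => exists_congr fun S => and_congr_right fun _ => ⟨fun h => ⟨fun y hy => ?_, ?_⟩,
      fun ⟨h, hQ⟩ y hy => ?_⟩
    · obtain ⟨x, hx, h, -⟩ := h y hy
      exact ⟨x, hx, h⟩
    · obtain ⟨x, -, -, h⟩ := h _ hf
      exact h
    · obtain ⟨x, hx, h⟩ := h y hy
      exact ⟨x, hx, h, hQ⟩
  refine ⟨⟨φ, h1, fun k => ?_⟩, ψ, h3, fun k => ?_⟩
  · rw [← hc, h2, hex k fun S => Value u S k]
    constructor
    · intro hk
      obtain ⟨S, hS, h⟩ := exists_coherent hMI hβ hu (lst (Nat.unpair k).1).length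
      exact ⟨S, hS, h, (value_iff_of_coherent hMI hβ hu hS h).2 hk⟩
    · rintro ⟨S, hS, h, hv⟩
      exact (value_iff_of_coherent hMI hβ hu hS h).1 hv
  · rw [← hc, h4, hex k fun S => ¬ Value u S k]
    constructor
    · rintro hk ⟨S, hS, h, hv⟩
      exact hv ((value_iff_of_coherent hMI hβ hu hS h).2 hk)
    · intro hk
      obtain ⟨S, hS, h⟩ := exists_coherent hMI hβ hu (lst (Nat.unpair k).1).length
      by_contra hn
      exact hk ⟨S, hS, h, fun hv => hn ((value_iff_of_coherent hMI hβ hu hS h).1 hv)⟩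

end Correctness

/-! ### The theorem -/

/-- A type with one member, which is coded by the graph of `z`. -/
inductive Oracle (z : ℕ → ℕ) : Type
  | mk : Oracle z

instance (z : ℕ → ℕ) : Dom (Oracle z) := ⟨fun _ => realCode z⟩

theorem DfGraph.oracle (z : ℕ → ℕ) : DfGraph (Oracle z) (z : ℕ →. ℕ) := by
  have h : Df fun p : (ℕ → ℕ) × ℕ × ℕ => p.2.2 = p.1 p.2.1 := inferInstance
  have h' : Df fun _ : Oracle z => z := ⟨(Ar.mem (.var 0) 0).congr fun _ _ => Iff.rfl⟩
  have h'' : Df fun p : Oracle z × ℕ × ℕ => z := h'.comp Df.fst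
  exact (h.comp (g := fun p : Oracle z × ℕ × ℕ => (z, p.2)) inferInstance).of_eq fun p =>
    propext Part.mem_some_iff.symm

theorem Df.of_computableIn {z : ℕ → ℕ} {U : ℕ × ℕ × List ℕ → Bool}
    (hU : ComputableIn {(z : ℕ →. ℕ)} U) : Df fun _ : Oracle z =>
      {m | ∃ i j p, m = Nat.pair i (Nat.pair j (num p)) ∧ U (i, j, p) = true} := by
  have h : DfGraph (Oracle z) _ := DfGraph.of_recursiveIn (O := {(z : ℕ →. ℕ)})
    (by rintro _ rfl; exact DfGraph.oracle z) hU
  -- The output 1 is the code of `true`.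
  have h1 := h.app (δ := Oracle z × ℕ) (o := Prod.fst) (t := Prod.snd) (u := fun _ => 1)
    Df.fst Df.snd inferInstance
  refine Df.set (h1.of_eq fun p => propext ?_)
  simp only [Part.map_some, Part.mem_bind_iff, Part.mem_some_iff, Part.mem_ofOption]
  constructor
  · rintro ⟨⟨i, j, q⟩, hd, hU⟩
    refine ⟨i, j, q, ?_, ?_⟩
    · have h2 : Denumerable.ofNat (ℕ × ℕ × List ℕ) p.2 = (i, j, q) :=
        Option.some.inj ((Denumerable.decode_eq_ofNat _ _).symm.trans hd)
      exact (Denumerable.encode_ofNat (α := ℕ × ℕ × List ℕ) p.2).symm.trans (congrArg _ h2)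
    · cases h2 : U (i, j, q)
      · rw [h2] at hU
        exact absurd hU (by decide)
      · rfl
  · rintro ⟨i, j, q, hp, hU⟩
    refine ⟨(i, j, q), ?_, by rw [hU]; rfl⟩
    rw [hp, show Nat.pair i (Nat.pair j (num q)) = Encodable.encode (i, j, q) from rfl]
    exact Encodable.encodek _

end L2

theorem mainTheorem2 (M : Set (Set ℕ)) (hβ : L2.IsBetaModel M) (hMI : L2.SatisfiesPi12MI M)
    (z : ℕ → ℕ) (hz : L2.realCode z ∈ M) (A : Set (ℕ → ℕ)) (hA : Game.IsSigma03 z A) :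
    (∃ σ : List ℕ → ℕ, Game.strategyCode σ ∈ M ∧ Game.WinsI A σ) ∨
      (∃ τ : List ℕ → ℕ, L2.IsDelta13Over M z (Game.strategyCode τ) ∧ Game.WinsII A τ) := by
  obtain ⟨U, hU, hA⟩ := hA
  have hd := L2.Df.of_computableIn hU
  set u : Set ℕ := {m | ∃ i j p, m = Nat.pair i (Nat.pair j (L2.num p)) ∧ U (i, j, p) = true} with hu'
  have hu : u ∈ M := hβ.code_apply hd (c := L2.Oracle.mk) hz
  have hmem : ∀ i j p, Nat.pair i (Nat.pair j (L2.num p)) ∈ u ↔ U (i, j, p) = true := by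
    intro i j p
    constructor
    · rintro ⟨i', j', p', h, hU⟩
      simp only [Nat.pair_eq_pair, L2.num, Encodable.encode_inj] at h
      obtain ⟨rfl, rfl, rfl⟩ := h
      exact hU
    · exact fun h => ⟨i, j, p, rfl, h⟩
  have hP : ∀ x, x ∈ A ↔ L2.Payoff u x := by
    intro x
    rw [hA]
    -- `Hit` asks for some initial segment listed in u, whereas U lists the segment itself;
    -- quantifying over k removes the difference.
    refine exists_congr fun i => forall_congr' fun j => ⟨fun ⟨k, hk⟩ => ⟨k, k, ?_, ?_⟩, ?_⟩
    · rw [L2.length_initSeg]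
    · rwa [L2.take_initSeg le_rfl, hmem]
    · rintro ⟨k, l, hl, h⟩
      rw [L2.length_initSeg] at hl
      rw [L2.take_initSeg hl, hmem] at h
      exact ⟨l, h⟩
  -- On the full tree with empty target, `Wins` at the empty position is winning the game, so either
  -- I wins in `M` or the construction for II can start.
  by_cases h0 : ∀ σ : ℕ → ℕ, L2.Dom.code σ ∈ M → ¬ L2.Wins u Set.univ ∅ [] σ
  · refine Or.inr ⟨L2.stratII M u, L2.isDelta13Over_stratII hMI hβ hu L2.Oracle.mk rfl hd,
      fun x hx => ?_⟩
    rw [hP]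
    exact L2.stratII_wins hMI hβ hu h0 hx
  · push Not at h0
    obtain ⟨σ, hσ, hw⟩ := h0
    refine Or.inl ⟨fun p => σ (L2.num p), ?_, fun x hx => ?_⟩
    · convert hσ using 1
      ext m
      exact ⟨fun ⟨p, hp⟩ => ⟨_, hp⟩, fun ⟨n, hn⟩ => ⟨L2.lst n, by rw [hn]; simp [L2.num]⟩⟩
    · rw [hP]
      by_contra hx'
      refine hw x ⟨rfl, fun _ => trivial, fun k _ hk => ?_, hx', fun _ _ => id⟩
      obtain ⟨n, rfl⟩ : ∃ n, k = 2 * n := ⟨k / 2, by omega⟩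
      exact hx n
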